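/- Proposition. There exist non-degenerate integrable second-order PDEs $F(x,u,Du,D^2u)=0$ in 3D and in 4D that are not contact-equivalent to any translation-invariant equation. Conventions. $F$ is a smooth function on an open subset of $J^2\mathbb R^d$. The equation is *non-degenerate* if the quadratic form $\sum_{\alpha\le\beta}\frac{\partial F}{\partial u_{\alpha\beta}}p_\alpha p_\beta$ is non-degenerate at every 2-jet with $F=0$. It is *integrable* if near every 2-jet with $F=0$ it has a non-trivial dispersionless Lax pair: two pointwise independent vector fields $X,Y$ on $\mathbb R^d$, with coefficients depending smoothly on $j^2u$ and on a parameter $\lambda$ from an open interval, such that $[X,Y]\in\operatorname{span}(X,Y)$ on every solution, where *non-trivial* means that the planes $\operatorname{span}(X,Y)$ are different for different $\lambda$ and that no modification of $X,Y$ which coincides with $X,Y$ on the equation (components along $\partial_\lambda$ being allowed) satisfies the Frobenius condition for all functions $u$. Two equations are *contact-equivalent* if, near some 2-jet satisfying the first one, the prolongation of a local diffeomorphism of $J^1$ preserving the contact distribution maps the first equation to the second. An equation is *translation-invariant* if it is preserved by translations of $x$. An abelian Lie algebra of vector fields *acts simply transitively on its local orbits* if a basis of it is linearly independent at every point. (3D)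 Consider $$(x_1-x_2)u_3u_{12}+(x_2-x_3)u_1u_{23}+(x_3-x_1)u_2u_{13}=0$$ on the open set where $x_1,x_2,x_3$ are distinct and $u_1,u_2,u_3\neq0$. This equation has 2-jets satisfying it, is non-degenerate and integrable, and is not contact-equivalent to any translation-invariant equation. Over no non-empty open subset of $J^1$ over which it lies does its contact symmetry algebra contain a 3-dimensional abelian subalgebra acting simply transitively on its local orbits in $J^1$. (4D) Let $a_1,\dots,a_4$ be non-zero real constants and consider $$\begin{aligned}&a_4[(x_1-x_2)u_3u_{12}+(x_2-x_3)u_1u_{23}+(x_3-x_1)u_2u_{13}]\\+\,&a_3[(x_4-x_2)u_1u_{24}+(x_2-x_1)u_4u_{12}+(x_1-x_4)u_2u_{14}]\\+\,&a_2[(x_3-x_4)u_1u_{34}+(x_1-x_3)u_4u_{13}+(x_4-x_1)u_3u_{14}]\\+\,&a_1[(x_3-x_2)u_4u_{23}+(x_2-x_4)u_3u_{24}+(x_4-x_3)u_2u_{34}]=0\end{aligned}$$ on the open set where its characteristic quadratic form is non-degenerate, that is, with $q_{ij}=a_iu_j-a_ju_i$, where $(x_1-x_2)(x_3-x_4)q_{14}q_{23}\neq(x_1-x_4)(x_2-x_3)q_{12}q_{34}$.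 This equation has 2-jets satisfying it, is non-degenerate and integrable. If moreover $|a_1|,\dots,|a_4|$ are not all equal, then it is not contact-equivalent to any translation-invariant equation, and over no non-empty open subset of $J^1$ over which it lies does its contact symmetry algebra contain a 4-dimensional abelian subalgebra acting simply transitively on its local orbits in $J^1$. -/

import Mathlib

open scoped ContDiff

noncomputable section

namespace JetPDE

/-! ### Jet spaces -/

/-- The space of symmetric `d × d` real arrays. -/
def symSubmodule (d : ℕ) : Submodule ℝ (Fin d → Fin d → ℝ) where
  carrier := {H | ∀ i j, H i j = H j i}
  add_mem' := fun {A B} hA hB i j => by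
    change A i j + B i j = A j i + B j i
    rw [hA i j, hB i j]
  zero_mem' := fun _ _ => rfl
  smul_mem' := fun c A hA i j => by
    change c • A i j = c • A j i
    rw [hA i j]

/-- Symmetric arrays as a type: the values of the second derivatives `D²u`. -/
abbrev Sym (d : ℕ) : Type := symSubmodule d

/-- Symmetrization `H ↦ (H + Hᵀ) / 2`; it is the identity on symmetric arrays. -/
def symm {d : ℕ} (H : Fin d → Fin d → ℝ) : Sym d :=
  ⟨fun i j => (H i j + H j i) / 2, fun i j => by
    change (H i j + H j i) / 2 = (H j i + H i j) / 2
    ring⟩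

/-- The first jet space `J¹(ℝ^d)`, a point of which is `(x, u, p)` with `p = Du`. -/
abbrev J1 (d : ℕ) : Type := (Fin d → ℝ) × ℝ × (Fin d → ℝ)

/-- The second jet space `J²(ℝ^d)`, a point of which is `((x, u, p), H)` with `H = D²u`. -/
abbrev J2 (d : ℕ) : Type := J1 d × Sym d

variable {d : ℕ}

/-- `∂u/∂x_i`. -/
def pd (i : Fin d) (u : (Fin d → ℝ) → ℝ) (x : Fin d → ℝ) : ℝ :=
  fderiv ℝ u x (Pi.single i 1)

/-- The second jet `j²u(x)` (for `u` of class `C²` near `x` the symmetrization does nothing). -/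
def jet2 (u : (Fin d → ℝ) → ℝ) (x : Fin d → ℝ) : J2 d :=
  ((x, u x, fun i => pd i u x), symm fun i j => pd i (pd j u) x)

/-! ### Second-order PDEs -/

/-- A scalar second-order PDE `F(x, u, Du, D²u) = 0`, with `F` a smooth function on an open
domain of the second jet space. -/
structure PDE (d : ℕ) where
  dom : Set (J2 d)
  isOpen_dom : IsOpen dom
  F : J2 d → ℝ
  smooth : ContDiffOn ℝ ∞ F dom

/-- The hypersurface `F = 0` in the second jet space. -/
def PDE.locus (A : PDE d) : Set (J2 d) := {θ | θ ∈ A.dom ∧ A.F θ = 0}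

/-- The symmetric bilinear form on covectors whose quadratic form is
`∑_{i ≤ j} (∂F/∂u_{ij}) p_i p_j`, the derivative of `F` along `D²u ↦ D²u + t p ⊗ p`. -/
def PDE.symbol (A : PDE d) (θ : J2 d) (p q : Fin d → ℝ) : ℝ :=
  fderiv ℝ A.F θ (0, symm fun i j => p i * q j)

/-- The characteristic quadric is non-degenerate at every 2-jet satisfying the equation. -/
def PDE.IsNondegenerate (A : PDE d) : Prop :=
  ∀ θ ∈ A.locus, ∀ p, (∀ q, A.symbol θ p q = 0) → p = 0

/-- `u` is a smooth function on the open set `V` all of whose 2-jets lie in `W`. -/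
structure IsSection (W : Set (J2 d)) (V : Set (Fin d → ℝ)) (u : (Fin d → ℝ) → ℝ) : Prop where
  isOpen : IsOpen V
  smooth : ContDiffOn ℝ ∞ u V
  jet_mem : ∀ x ∈ V, jet2 u x ∈ W

/-! ### Integrability by a dispersionless Lax pair -/

/-- A vector field on `ℝ^d × ℝ` (independent variables and spectral parameter) whose coefficients
depend on the 2-jet of a function `u` and on the spectral parameter `lam`; the second component is
the coefficient of `∂/∂lam`. -/
abbrev SpectralField (d : ℕ) : Type := J2 d → ℝ → (Fin d → ℝ) × ℝ

/-- The vector field on `ℝ^d × ℝ` obtained by evaluating the coefficients on `u`. -/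
def SpectralField.along (X : SpectralField d) (u : (Fin d → ℝ) → ℝ) :
    (Fin d → ℝ) × ℝ → (Fin d → ℝ) × ℝ :=
  fun q => X (jet2 u q.1) q.2

def SpectralField.SmoothOn (X : SpectralField d) (W : Set (J2 d)) (I : Set ℝ) : Prop :=
  ContDiffOn ℝ ∞ (fun q : J2 d × ℝ => X q.1 q.2) (W ×ˢ I)

/-- The Frobenius condition `[X, Y] ∈ span(X, Y)` for the fields evaluated on `u`,
at the point `q = (x, lam)`. -/
def InvolutiveAt (X Y : SpectralField d) (u : (Fin d → ℝ) → ℝ) (q : (Fin d → ℝ) × ℝ) : Prop :=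
  VectorField.lieBracket ℝ (X.along u) (Y.along u) q ∈
    Submodule.span ℝ {X.along u q, Y.along u q}

/-- `X, Y` is a dispersionless Lax pair of the equation for 2-jets in `W` and spectral parameters
in `I`: two pointwise independent parameter-dependent vector fields on `ℝ^d` (no `∂/∂lam`
component) such that `[X, Y] ∈ span(X, Y)` on every solution, for every parameter value. -/
structure PDE.IsLaxPair (A : PDE d) (W : Set (J2 d)) (I : Set ℝ) (X Y : SpectralField d) :
    Prop where
  smooth_left : X.SmoothOn W I
  smooth_right : Y.SmoothOn W I
  no_param_left : ∀ θ ∈ W, ∀ lam ∈ I, (X θ lam).2 = 0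
  no_param_right : ∀ θ ∈ W, ∀ lam ∈ I, (Y θ lam).2 = 0
  independent : ∀ θ ∈ W, ∀ lam ∈ I, LinearIndependent ℝ ![X θ lam, Y θ lam]
  involutive : ∀ V u, IsSection W V u → (∀ x ∈ V, A.F (jet2 u x) = 0) →
    ∀ x ∈ V, ∀ lam ∈ I, InvolutiveAt X Y u (x, lam)

/-- Non-triviality of a Lax pair. First, the 2-planes `span(X, Y)` really depend on the spectral
parameter. Second, the Frobenius condition holds essentially modulo the equation: whenever the
pair is modified to a pair `X', Y'` that is identical with `X, Y` on the equation (`∂/∂lam`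
components being allowed), the Frobenius condition for `X', Y'` fails for some function. -/
structure PDE.IsNontrivialPair (A : PDE d) (W : Set (J2 d)) (I : Set ℝ) (X Y : SpectralField d) :
    Prop where
  depends_on_param : ∀ θ ∈ W, ∀ lam ∈ I, ∀ mu ∈ I,
    Submodule.span ℝ {X θ lam, Y θ lam} = Submodule.span ℝ {X θ mu, Y θ mu} → lam = mu
  essential : ∀ X' Y' : SpectralField d, X'.SmoothOn W I → Y'.SmoothOn W I →
    (∀ θ ∈ W, A.F θ = 0 → ∀ lam ∈ I, X' θ lam = X θ lam ∧ Y' θ lam = Y θ lam) →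
    ∃ V u, IsSection W V u ∧ ∃ x ∈ V, ∃ lam ∈ I, ¬ InvolutiveAt X' Y' u (x, lam)

/-- The equation is integrable: near each of its points it has a non-trivial dispersionless
Lax pair. -/
def PDE.IsIntegrable (A : PDE d) : Prop :=
  ∀ θ₀ ∈ A.locus, ∃ W : Set (J2 d), IsOpen W ∧ θ₀ ∈ W ∧ W ⊆ A.dom ∧
    ∃ s t : ℝ, s < t ∧ ∃ X Y : SpectralField d,
      A.IsLaxPair W (Set.Ioo s t) X Y ∧ A.IsNontrivialPair W (Set.Ioo s t) X Y

/-! ### Contact transformations and contact equivalence -/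

/-- The contact form `du - ∑ p_i dx_i` at `z`, evaluated on the tangent vector `v`. -/
def contactForm (z v : J1 d) : ℝ := v.2.1 - ∑ i, z.2.2 i * v.1 i

/-- The lift of `v` to the integral plane of the contact distribution determined by the 2-jet
`θ = (x, u, p, H)`: the value at `v` of `∑ v_i D_i`, where
`D_i = ∂/∂x_i + p_i ∂/∂u + ∑_k H_{ik} ∂/∂p_k`. -/
def lift (θ : J2 d) (v : Fin d → ℝ) : J1 d :=
  (v, ∑ i, θ.1.2.2 i * v i, fun k => ∑ i, θ.2.1 i k * v i)

/-- The integral plane in `T J¹` determined by a 2-jet. -/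
def jetPlane (θ : J2 d) : Submodule ℝ (J1 d) :=
  Submodule.span ℝ (Set.range (lift θ))

/-- A local contact transformation: a diffeomorphism between open subsets of `J¹` preserving
the contact distribution. -/
structure IsContactTransformation (Φ : OpenPartialHomeomorph (J1 d) (J1 d)) : Prop where
  smooth : ContDiffOn ℝ ∞ Φ Φ.source
  smooth_symm : ContDiffOn ℝ ∞ Φ.symm Φ.target
  contact : ∀ z ∈ Φ.source, ∀ v, contactForm z v = 0 → contactForm (Φ z) (fderiv ℝ Φ z v) = 0

/-- The prolongation of `Φ` to `J²` sends `θ` to `θ'`. -/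
def Prolongs (Φ : J1 d → J1 d) (θ θ' : J2 d) : Prop :=
  θ'.1 = Φ θ.1 ∧ (jetPlane θ).map (fderiv ℝ Φ θ.1 : J1 d →ₗ[ℝ] J1 d) = jetPlane θ'

/-- Near the point `θ₀` of `A`, some local contact transformation maps the equation `A` to the
equation `B`. -/
def LocallyContactEquivalentAt (A B : PDE d) (θ₀ : J2 d) : Prop :=
  ∃ Φ : OpenPartialHomeomorph (J1 d) (J1 d), IsContactTransformation Φ ∧
    ∃ W : Set (J2 d), IsOpen W ∧ θ₀ ∈ W ∧ W ⊆ A.dom ∧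
      ∀ θ ∈ W, θ.1 ∈ Φ.source ∧
        ∃ θ' ∈ B.dom, Prolongs Φ θ θ' ∧ (A.F θ = 0 ↔ B.F θ' = 0)

/-- Contact equivalence in the weakest sense: local equivalence somewhere on the equation. -/
def ContactEquivalent (A B : PDE d) : Prop :=
  ∃ θ₀ ∈ A.locus, LocallyContactEquivalentAt A B θ₀

/-- Translation of the independent variables. -/
def translate (c : Fin d → ℝ) (θ : J2 d) : J2 d := ((θ.1.1 + c, θ.1.2), θ.2)

/-- The equation is invariant under translations of the independent variables. -/
def PDE.IsTranslationInvariant (A : PDE d) : Prop :=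
  ∀ θ ∈ A.dom, ∀ c, translate c θ ∈ A.dom → A.F θ = 0 → A.F (translate c θ) = 0

/-! ### Contact symmetries -/

/-- `Z` is a smooth contact vector field on `U`: the Lie derivative of the contact form along `Z`
is a multiple of the contact form. For a constant vector `v`, the value of that Lie derivative at
`v` is the expression below. -/
structure IsContactField (U : Set (J1 d)) (Z : J1 d → J1 d) : Prop where
  smooth : ContDiffOn ℝ ∞ Z U
  contact : ∀ z ∈ U, ∀ v, contactForm z v = 0 →
    contactForm z (fderiv ℝ Z z v) - ∑ i, (Z z).2.2 i * v.1 i = 0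

/-- The prolongation to `J²` of the vector field `Z = ξ ∂/∂x + η ∂/∂u + ζ ∂/∂p`; its component
along `u_{ij}` is `D_j ζ_i - ∑_k u_{ik} D_j ξ_k` (symmetric when `Z` is a contact field). -/
def prolongField (Z : J1 d → J1 d) (θ : J2 d) : J2 d :=
  (Z θ.1, symm fun i j =>
    (fderiv ℝ Z θ.1 (lift θ (Pi.single j 1))).2.2 i
      - ∑ k, θ.2.1 i k * (fderiv ℝ Z θ.1 (lift θ (Pi.single j 1))).1 k)

/-- `Z` is an infinitesimal contact symmetry over `U`: a contact vector field whose prolongation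
is tangent to the equation. -/
def PDE.IsContactSymmetry (A : PDE d) (U : Set (J1 d)) (Z : J1 d → J1 d) : Prop :=
  IsContactField U Z ∧ ∀ θ ∈ A.locus, θ.1 ∈ U → fderiv ℝ A.F θ (prolongField Z θ) = 0

/-- Over `U`, the contact symmetry algebra of the equation contains a `d`-dimensional abelian
subalgebra (spanned by `Z 0, …, Z (d-1)`) that acts simply transitively on its local orbits,
i.e. whose basis is linearly independent at every point of `U ⊆ J¹`. -/
def PDE.HasSimplyTransitiveAbelianSymmetry (A : PDE d) (U : Set (J1 d)) : Prop :=
  ∃ Z : Fin d → J1 d → J1 d, (∀ i, A.IsContactSymmetry U (Z i)) ∧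
    (∀ i j, ∀ z ∈ U, VectorField.lieBracket ℝ (Z i) (Z j) z = 0) ∧
    ∀ z ∈ U, LinearIndependent ℝ fun i => Z i z

/-- The points of `J¹` over which the equation lies. -/
def PDE.base (A : PDE d) : Set (J1 d) := Prod.fst '' A.locus

/-! ### The two equations -/

lemma contDiff_hess (i j : Fin d) : ContDiff ℝ ∞ fun θ : J2 d => (θ.2 : Fin d → Fin d → ℝ) i j := by
  have h : ContDiff ℝ ∞ fun H : Sym d => (H : Fin d → Fin d → ℝ) :=
    (symSubmodule d).subtypeL.contDiff
  have h2 : ContDiff ℝ ∞ fun θ : J2 d => (θ.2 : Fin d → Fin d → ℝ) := h.comp contDiff_snd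
  exact contDiff_pi.1 (contDiff_pi.1 h2 i) j

lemma contDiff_x (i : Fin d) : ContDiff ℝ ∞ fun θ : J2 d => θ.1.1 i := by fun_prop

lemma contDiff_p (i : Fin d) : ContDiff ℝ ∞ fun θ : J2 d => θ.1.2.2 i := by fun_prop

/-- The expression `(x_i - x_j) u_k u_{ij} + (x_j - x_k) u_i u_{jk} + (x_k - x_i) u_j u_{ik}`. -/
def web (i j k : Fin d) (θ : J2 d) : ℝ :=
  (θ.1.1 i - θ.1.1 j) * θ.1.2.2 k * θ.2.1 i j
    + (θ.1.1 j - θ.1.1 k) * θ.1.2.2 i * θ.2.1 j k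
    + (θ.1.1 k - θ.1.1 i) * θ.1.2.2 j * θ.2.1 i k

lemma contDiff_web (i j k : Fin d) : ContDiff ℝ ∞ (web i j k) := by
  unfold web
  have hx := @contDiff_x d
  have hp := @contDiff_p d
  have hh := @contDiff_hess d
  exact (((((hx i).sub (hx j)).mul (hp k)).mul (hh i j)).add
    ((((hx j).sub (hx k)).mul (hp i)).mul (hh j k))).add
    ((((hx k).sub (hx i)).mul (hp j)).mul (hh i k))

/-- The deformed Veronese web equation in dimension three, on the open set where `x_1, x_2, x_3`
are distinct and `u_1, u_2, u_3` are non-zero. -/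
def veronese3 : PDE 3 where
  dom := {θ | (θ.1.1 0 ≠ θ.1.1 1 ∧ θ.1.1 1 ≠ θ.1.1 2 ∧ θ.1.1 2 ≠ θ.1.1 0) ∧
    θ.1.2.2 0 ≠ 0 ∧ θ.1.2.2 1 ≠ 0 ∧ θ.1.2.2 2 ≠ 0}
  isOpen_dom := by
    have hx := fun i => (contDiff_x (d := 3) i).continuous
    have hp := fun i => (contDiff_p (d := 3) i).continuous
    exact ((isOpen_ne_fun (hx 0) (hx 1)).inter ((isOpen_ne_fun (hx 1) (hx 2)).inter
      (isOpen_ne_fun (hx 2) (hx 0)))).inter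
      ((isOpen_ne_fun (hp 0) continuous_const).inter
        ((isOpen_ne_fun (hp 1) continuous_const).inter (isOpen_ne_fun (hp 2) continuous_const)))
  F := web 0 1 2
  smooth := (contDiff_web 0 1 2).contDiffOn

/-- The function `a_i u_j - a_j u_i`. -/
def minor (a : Fin 4 → ℝ) (i j : Fin 4) (θ : J2 4) : ℝ :=
  a i * θ.1.2.2 j - a j * θ.1.2.2 i

/-- The linear combination of four copies of the Veronese web equation
(on the variables `123`, `421`, `341`, `324`) with coefficients `a_4, a_3, a_2, a_1`, on the open
set where the determinant of its characteristic quadratic form does not vanish. -/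
def veronese4 (a : Fin 4 → ℝ) : PDE 4 where
  dom := {θ | (θ.1.1 0 - θ.1.1 1) * (θ.1.1 2 - θ.1.1 3) * (minor a 0 3 θ * minor a 1 2 θ) ≠
    (θ.1.1 0 - θ.1.1 3) * (θ.1.1 1 - θ.1.1 2) * (minor a 0 1 θ * minor a 2 3 θ)}
  isOpen_dom := by
    unfold minor
    exact isOpen_ne_fun (by fun_prop) (by fun_prop)
  F := fun θ => a 3 * web 0 1 2 θ + a 2 * web 3 1 0 θ + a 1 * web 2 3 0 θ + a 0 * web 2 1 3 θ
  smooth := by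
    have h := @contDiff_web 4
    exact ((((contDiff_const.mul (h 0 1 2)).add (contDiff_const.mul (h 3 1 0))).add
      (contDiff_const.mul (h 2 3 0))).add (contDiff_const.mul (h 2 1 3))).contDiffOn

end JetPDE

end

/-! Both equations have the shape ½ Σ c_ij u_ij = 0 with c_ii = 0 and c_ij = (x_i - x_j) m_ij(p),
where m_ij is linear in p = Du.

Non-equivalence. A contact transformation onto a translation-invariant equation pulls the
translations back to d commuting, pointwise independent contact fields. Over an open set of J¹ these
are tangent to the equation, at least near one 2-jet in every fibre (`isLocalSymmetry_pullConst`,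
`ContactEquivalent.exists_isLocalSymmetry`). A simply transitive abelian symmetry algebra has the
same property, so both negative claims reduce to excluding such d-tuples.

Write Z = ξ ∂_x + η ∂_u + ζ ∂_p. Tangency is a polynomial condition of degree two in D²u on a
hyperplane, so it may be split by degree. The quadratic part forces ξ, and then η, to be independent
of p (`PDE.IsLocalSymmetry.xiC_ep`). The linear part is then polynomial in p with coefficients
depending only on (x, u), so it holds for every p and can be tested at convenient p
(`PDE.IsLocalSymmetry.sum_fibre`, `PDE.IsLocalSymmetry.fibreCoeff_mul`).

In dimension three the outcome is ξ_i = r x_i + s and η = η(u). The value of Z at a point is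
determined by the pairs (ξ_0, r) and (η, η_u), and commutativity makes each pair of linear forms on
the three-dimensional coefficient space of rank at most one. Hence some non-zero combination of the
fields vanishes at the point (`not_simplyTransitive_three`).

In dimension four, ξ_i = b_i + α x_i + β with constants α, β, and ∂_k η = τ a_k. The b_i satisfy a
closed linear first-order system involving a further function S, with ∂_k Σ a_j ξ_j = a_k S.
Equality of mixed derivatives, differentiated once more, gives linear conditions on (S - α, b), the
line conditions (`onLines`). If the |a_i| are not all equal, then at generic x these conditions,
together with S - α = 0 and Σ a_n b_n = 0, force b = 0 (`exists_onLines_det`). So at such points Z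
is determined by the seven numbers α, β, S, κ = Σ a_j ξ_j, η, η_u, τ. Commutativity gives α ∧ β = 0,
κ ∧ S = 0 and κ ∧ τ + η ∧ η_u = 0 on the four-dimensional coefficient space. A dimension count then
yields a non-zero combination that vanishes at a point (`not_simplyTransitive_four_of_convex`).

Integrability. The Lax fields span the kernel of Σ u_n/(λ - x_n) dx_n, and in dimension four also of
Σ a_n/(λ - x_n) dx_n. Normalised to have components (1, 0) and (0, 1) in two coordinates, they
satisfy [X, Y] = F·C with C ≠ 0. Suppose a modification agreeing on F = 0 were involutive for every
u. After the same normalisation it commutes; testing on cubics u with arbitrary third derivatives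
shows that the correction vanishes to second order along F = 0, as far as the bracket sees it.
Differentiating across F = 0 then contradicts C ≠ 0 (`false_of_commuting_modification`,
`PDE.IsNormalPair.essential`). -/

open scoped ContDiff

noncomputable section

namespace JetPDE

/-! ### Directional derivatives -/

section Calculus

variable {E : Type*} [NormedAddCommGroup E] [NormedSpace ℝ E] {U : Set E} {z v w : E}
  {f g : E → ℝ} {a b : ℝ}

/-- The derivative of `f` along the constant vector field `v`. -/
def dirD (v : E) (f : E → ℝ) : E → ℝ := fun z => fderiv ℝ f z v

/-- `f` is differentiable at `z` and its derivative along `v` is `a`. -/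
def HasDirD (f : E → ℝ) (a : ℝ) (v z : E) : Prop := DifferentiableAt ℝ f z ∧ dirD v f z = a

lemma HasDirD.of_contDiffOn (hU : IsOpen U) (hf : ContDiffOn ℝ ∞ f U) (hz : z ∈ U) :
    HasDirD f (dirD v f z) v z :=
  ⟨(hf.contDiffAt (hU.mem_nhds hz)).differentiableAt (by simp), rfl⟩

lemma HasFDerivAt.hasDirD {f' : E →L[ℝ] ℝ} (h : HasFDerivAt f f' z) : HasDirD f (f' v) v z :=
  ⟨h.differentiableAt, by rw [dirD, h.fderiv]⟩

lemma HasDirD.hasFDerivAt (h : HasDirD f a v z) : HasFDerivAt f (fderiv ℝ f z) z :=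
  h.1.hasFDerivAt

lemma HasDirD.const (c : ℝ) : HasDirD (fun _ => c) 0 v z :=
  HasFDerivAt.hasDirD (f' := 0) (hasFDerivAt_const c z)

lemma HasDirD.add (hf : HasDirD f a v z) (hg : HasDirD g b v z) :
    HasDirD (fun z => f z + g z) (a + b) v z := by
  have := HasFDerivAt.hasDirD (v := v) (hf.hasFDerivAt.fun_add hg.hasFDerivAt)
  rwa [add_apply, show fderiv ℝ f z v = a from hf.2,
    show fderiv ℝ g z v = b from hg.2] at this

lemma HasDirD.sub (hf : HasDirD f a v z) (hg : HasDirD g b v z) :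
    HasDirD (fun z => f z - g z) (a - b) v z := by
  have := HasFDerivAt.hasDirD (v := v) (hf.hasFDerivAt.fun_sub hg.hasFDerivAt)
  rwa [sub_apply, show fderiv ℝ f z v = a from hf.2,
    show fderiv ℝ g z v = b from hg.2] at this

lemma HasDirD.mul (hf : HasDirD f a v z) (hg : HasDirD g b v z) :
    HasDirD (fun z => f z * g z) (a * g z + f z * b) v z := by
  have := HasFDerivAt.hasDirD (v := v) (hf.hasFDerivAt.fun_mul hg.hasFDerivAt)
  rw [add_apply, smul_apply,
    smul_apply, show fderiv ℝ f z v = a from hf.2,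
    show fderiv ℝ g z v = b from hg.2, smul_eq_mul, smul_eq_mul] at this
  convert this using 1
  ring

lemma HasDirD.sum {ι : Type*} {s : Finset ι} {f : ι → E → ℝ} {a : ι → ℝ}
    (h : ∀ i ∈ s, HasDirD (f i) (a i) v z) :
    HasDirD (fun z => ∑ i ∈ s, f i z) (∑ i ∈ s, a i) v z := by
  have := HasFDerivAt.hasDirD (v := v) (HasFDerivAt.fun_sum fun i hi => (h i hi).hasFDerivAt)
  rw [sum_apply] at this
  rwa [Finset.sum_congr rfl fun i hi => (h i hi).2.symm]

lemma HasDirD.eq_of_eqOn (hU : IsOpen U) (hz : z ∈ U) (h : ∀ z ∈ U, f z = g z)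
    (hf : HasDirD f a v z) (hg : HasDirD g b v z) : a = b := by
  have : f =ᶠ[nhds z] g := Filter.eventuallyEq_of_mem (hU.mem_nhds hz) h
  rw [← hf.2, ← hg.2, dirD, dirD, this.fderiv_eq]

lemma HasDirD.congr_of_eqOn (hU : IsOpen U) (hz : z ∈ U) (h : ∀ z ∈ U, f z = g z)
    (hg : HasDirD g b v z) : HasDirD f b v z := by
  have : f =ᶠ[nhds z] g := Filter.eventuallyEq_of_mem (hU.mem_nhds hz) h
  exact ⟨this.differentiableAt_iff.2 hg.1, by rw [dirD, this.fderiv_eq]; exact hg.2⟩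

lemma dirD_contDiffOn (hU : IsOpen U) (hf : ContDiffOn ℝ ∞ f U) (v : E) :
    ContDiffOn ℝ ∞ (dirD v f) U :=
  (hf.fderiv_of_isOpen hU (by simp)).clm_apply contDiffOn_const

lemma dirD_comm (hU : IsOpen U) (hf : ContDiffOn ℝ ∞ f U) (hz : z ∈ U) (v w : E) :
    dirD v (dirD w f) z = dirD w (dirD v f) z := by
  have hs : IsSymmSndFDerivAt ℝ f z :=
    (hf.contDiffAt (hU.mem_nhds hz)).isSymmSndFDerivAt (by
      rw [minSmoothness_of_isRCLikeNormedField]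
      exact WithTop.coe_le_coe.2 (le_top : (2 : ℕ∞) ≤ ⊤))
  have hd : DifferentiableAt ℝ (fderiv ℝ f) z :=
    ((hf.fderiv_of_isOpen hU (m := ∞) (by simp)).contDiffAt (hU.mem_nhds hz)).differentiableAt
      (by simp)
  have key : ∀ v w : E, dirD v (dirD w f) z = fderiv ℝ (fderiv ℝ f) z v w := by
    intro v w
    have := (hd.hasFDerivAt.clm_apply (hasFDerivAt_const w z)).fderiv
    unfold dirD
    rw [this]
    simp
  rw [key, key]
  exact hs v w

lemma dirD_eq_zero_of_eqOn (hU : IsOpen U) (hz : z ∈ U) (h : ∀ z ∈ U, f z = 0) :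
    dirD v f z = 0 :=
  (HasDirD.congr_of_eqOn hU hz h (HasDirD.const 0)).2

lemma dirD_add_smul (v w : E) (c : ℝ) (f : E → ℝ) (z : E) :
    dirD (v + c • w) f z = dirD v f z + c * dirD w f z := by
  simp [dirD]

/-- A function of degree at most two along every line that vanishes on a non-empty open set
vanishes identically. -/
lemma eq_zero_of_quadratic {q : E → ℝ} {p : E}
    (hq : ∀ p v, ∃ A B : ℝ, ∀ t : ℝ, q (p + t • v) = q p + t * A + t ^ 2 * B)
    (h0 : ∀ᶠ x in nhds p, q x = 0) (x : E) : q x = 0 := by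
  obtain ⟨A, B, h⟩ := hq p (x - p)
  have hp : q p = 0 := h0.self_of_nhds
  have hc : Filter.Tendsto (fun t : ℝ => p + t • (x - p)) (nhds 0) (nhds p) := by
    have : Continuous fun t : ℝ => p + t • (x - p) := by fun_prop
    simpa using this.tendsto 0
  have h1 := hc.eventually h0
  obtain ⟨ε, hε, hb⟩ := Metric.eventually_nhds_iff.1 h1
  -- Two opposite parameters separate the linear coefficient from the quadratic one.
  have e1 : q (p + (ε / 2) • (x - p)) = 0 := hb (by
    rw [Real.dist_eq, sub_zero, abs_of_pos (by positivity)]; linarith)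
  have e2 : q (p + (-(ε / 2)) • (x - p)) = 0 := hb (by
    rw [Real.dist_eq, sub_zero, abs_neg, abs_of_pos (by positivity)]; linarith)
  rw [h] at e1 e2
  have hA : A = 0 := by
    have : ε * A = 0 := by linarith
    rcases mul_eq_zero.1 this with h | h
    · linarith
    · exact h
  have hB : B = 0 := by
    have : ε ^ 2 * B = 0 := by rw [hp, hA] at e1; linarith
    rcases mul_eq_zero.1 this with h | h
    · have := pow_pos hε 2; linarith
    · exact h
  have := h 1
  rw [hp, hA, hB] at this
  simpa using this

end Calculus

/-! ### Coordinate vectors on the first jet space -/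

section Coordinates

variable {d : ℕ}

/-- The coordinate vector `∂/∂x_i` on `J¹`. -/
def ex (i : Fin d) : J1 d := (Pi.single i 1, 0, 0)

/-- The coordinate vector `∂/∂u` on `J¹`. -/
def eu : J1 d := (0, 1, 0)

/-- The coordinate vector `∂/∂p_i` on `J¹`. -/
def ep (i : Fin d) : J1 d := (0, 0, Pi.single i 1)

@[simp] lemma ex_fst (i j : Fin d) : (ex i).1 j = if j = i then 1 else 0 := Pi.single_apply i 1 j


lemma hasDirD_x (i : Fin d) (v z : J1 d) : HasDirD (fun z : J1 d => z.1 i) (v.1 i) v z :=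
  HasFDerivAt.hasDirD 
    ((ContinuousLinearMap.proj (R := ℝ) (φ := fun _ : Fin d => ℝ) i).comp
      (ContinuousLinearMap.fst ℝ (Fin d → ℝ) (ℝ × (Fin d → ℝ)))).hasFDerivAt

lemma hasDirD_p (i : Fin d) (v z : J1 d) : HasDirD (fun z : J1 d => z.2.2 i) (v.2.2 i) v z :=
  HasFDerivAt.hasDirD 
    ((ContinuousLinearMap.proj (R := ℝ) (φ := fun _ : Fin d => ℝ) i).comp
      ((ContinuousLinearMap.snd ℝ ℝ (Fin d → ℝ)).comp
        (ContinuousLinearMap.snd ℝ (Fin d → ℝ) (ℝ × (Fin d → ℝ))))).hasFDerivAt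

lemma J1.eq_sum (w : J1 d) :
    w = ∑ i, w.1 i • ex i + w.2.1 • eu + ∑ i, w.2.2 i • ep i := by
  have h1 : (∑ i, w.1 i • ex i : J1 d) = (w.1, 0, 0) := by
    refine Prod.ext ?_ (Prod.ext ?_ ?_)
    · simp only [Prod.fst_sum, Prod.smul_fst, ex]
      exact (pi_eq_sum_univ' w.1).symm
    · simp [Prod.snd_sum, ex]
    · simp [Prod.snd_sum, ex]
  have h2 : (∑ i, w.2.2 i • ep i : J1 d) = (0, 0, w.2.2) := by
    refine Prod.ext ?_ (Prod.ext ?_ ?_)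
    · simp [Prod.fst_sum, ep]
    · simp [Prod.snd_sum, Prod.fst_sum, ep]
    · simp only [Prod.snd_sum, Prod.smul_snd, ep]
      exact (pi_eq_sum_univ' w.2.2).symm
  rw [h1, h2]
  refine Prod.ext ?_ (Prod.ext ?_ ?_) <;> simp [eu]

/-- The derivative along an arbitrary vector in terms of the coordinate derivatives. -/
lemma dirD_eq_sum (w : J1 d) (f : J1 d → ℝ) (z : J1 d) :
    dirD w f z = ∑ i, w.1 i * dirD (ex i) f z + w.2.1 * dirD eu f z
      + ∑ i, w.2.2 i * dirD (ep i) f z := by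
  unfold dirD
  conv_lhs => rw [J1.eq_sum w]
  simp

/-- A function whose derivatives along the `p`-directions vanish is locally independent of `p`. -/
lemma eventually_eq_of_dirD_ep_eq_zero {U : Set (J1 d)} (hU : IsOpen U) {f : J1 d → ℝ}
    (hf : ContDiffOn ℝ ∞ f U) (h : ∀ z ∈ U, ∀ l, dirD (ep l) f z = 0) {z : J1 d} (hz : z ∈ U) :
    ∀ᶠ p in nhds z.2.2, f (z.1, z.2.1, p) = f z := by
  have hc : Continuous fun p : Fin d → ℝ => ((z.1, z.2.1, p) : J1 d) := by fun_prop
  have hm : (fun p : Fin d → ℝ => ((z.1, z.2.1, p) : J1 d)) ⁻¹' U ∈ nhds z.2.2 :=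
    (hU.preimage hc).mem_nhds hz
  obtain ⟨ε, hε, hb⟩ := Metric.mem_nhds_iff.1 hm
  have hd : ∀ p ∈ Metric.ball z.2.2 ε,
      HasFDerivAt (fun p : Fin d → ℝ => f (z.1, z.2.1, p)) (0 : (Fin d → ℝ) →L[ℝ] ℝ) p := by
    intro p hp
    have hp' : ((z.1, z.2.1, p) : J1 d) ∈ U := hb hp
    have h1 : HasFDerivAt f (fderiv ℝ f (z.1, z.2.1, p)) (z.1, z.2.1, p) :=
      ((hf.contDiffAt (hU.mem_nhds hp')).differentiableAt (by simp)).hasFDerivAt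
    have h2 : HasFDerivAt (fun p : Fin d → ℝ => ((z.1, z.2.1, p) : J1 d))
        ((0 : (Fin d → ℝ) →L[ℝ] (Fin d → ℝ)).prod ((0 : (Fin d → ℝ) →L[ℝ] ℝ).prod
          (ContinuousLinearMap.id ℝ _))) p :=
      (hasFDerivAt_const _ _).prodMk ((hasFDerivAt_const _ _).prodMk (hasFDerivAt_id _))
    refine (h1.comp p h2).congr_fderiv ?_
    refine ContinuousLinearMap.ext fun w => ?_
    have h3 : dirD ((0, 0, w) : J1 d) f (z.1, z.2.1, p) = 0 := by
      rw [dirD_eq_sum]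
      simp [h _ hp']
    simpa [dirD] using h3
  filter_upwards [Metric.ball_mem_nhds _ hε] with p hp
  have := IsOpen.is_const_of_fderiv_eq_zero (𝕜 := ℝ) Metric.isOpen_ball
    (convex_ball z.2.2 ε).isPreconnected
    (fun p hp => (hd p hp).differentiableAt.differentiableWithinAt)
    (fun p hp => (hd p hp).fderiv) hp (Metric.mem_ball_self hε)
  exact this

end Coordinates

section ContactFields

variable {d : ℕ}

/-! ### Quasilinear equations without diagonal second derivatives -/

/-- The equation is `½ ∑ c_{ij}(x, u, p) u_{ij} = 0` with `c` symmetric and without diagonal. -/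
structure PDE.IsQuasilinear (A : PDE d) (c : Fin d → Fin d → J1 d → ℝ) : Prop where
  smooth : ∀ i j, ContDiff ℝ ∞ (c i j)
  symmetric : ∀ i j, c i j = c j i
  diag : ∀ i, c i i = 0
  eq : ∀ θ, A.F θ = 2⁻¹ * ∑ i, ∑ j, c i j θ.1 * θ.2.1 i j

/-- Contact vector fields tangent to the equation over an open piece of every fibre. -/
structure PDE.IsLocalSymmetry (A : PDE d) (U : Set (J1 d)) (Z : J1 d → J1 d) : Prop where
  field : IsContactField U Z
  tangent : ∀ z ∈ U, ∃ H₀ : Sym d, A.F (z, H₀) = 0 ∧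
    ∀ᶠ H in nhds H₀, A.F (z, H) = 0 → fderiv ℝ A.F (z, H) (prolongField Z (z, H)) = 0

lemma sum_symm_eq {c : Fin d → Fin d → ℝ} (hc : ∀ i j, c i j = c j i) (M : Fin d → Fin d → ℝ) :
    ∑ i, ∑ j, c i j * (symm M).1 i j = ∑ i, ∑ j, c i j * M i j := by
  have h : ∑ i, ∑ j, c i j * M j i = ∑ i, ∑ j, c i j * M i j := by
    rw [Finset.sum_comm]
    exact Finset.sum_congr rfl fun i _ => Finset.sum_congr rfl fun j _ => by rw [hc]
  have h2 : ∑ i, ∑ j, c i j * (symm M).1 i j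
      = 2⁻¹ * (∑ i, ∑ j, c i j * M i j + ∑ i, ∑ j, c i j * M j i) := by
    rw [← Finset.sum_add_distrib, Finset.mul_sum]
    refine Finset.sum_congr rfl fun i _ => ?_
    rw [← Finset.sum_add_distrib, Finset.mul_sum]
    refine Finset.sum_congr rfl fun j _ => ?_
    simp only [symm]
    ring
  rw [h2, h]
  ring

lemma PDE.IsQuasilinear.hasFDerivAt {A : PDE d} {c : Fin d → Fin d → J1 d → ℝ}
    (hA : A.IsQuasilinear c) (θ w : J2 d) :
    HasDirD A.F (2⁻¹ * ∑ i, ∑ j, (dirD w.1 (c i j) θ.1 * θ.2.1 i j + c i j θ.1 * w.2.1 i j)) w θ := by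
  have hF : A.F = fun θ : J2 d => 2⁻¹ * ∑ i, ∑ j, c i j θ.1 * θ.2.1 i j := funext hA.eq
  have hc : ∀ i j, HasDirD (fun θ : J2 d => c i j θ.1) (dirD w.1 (c i j) θ.1) w θ := fun i j =>
    HasFDerivAt.hasDirD (f := fun θ : J2 d => c i j θ.1)
      (f' := (fderiv ℝ (c i j) θ.1).comp (ContinuousLinearMap.fst ℝ (J1 d) (Sym d)))
      ((((hA.smooth i j).differentiable (by simp)) θ.1).hasFDerivAt.comp θ hasFDerivAt_fst)
  have hh : ∀ i j, HasDirD (fun θ : J2 d => θ.2.1 i j) (w.2.1 i j) w θ := fun i j =>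
    HasFDerivAt.hasDirD ((ContinuousLinearMap.proj (R := ℝ) (φ := fun _ : Fin d => ℝ) j).comp
      ((ContinuousLinearMap.proj (R := ℝ) (φ := fun _ : Fin d => Fin d → ℝ) i).comp
      ((symSubmodule d).subtypeL.comp (ContinuousLinearMap.snd ℝ (J1 d) (Sym d))))).hasFDerivAt
  rw [hF]
  have := (HasDirD.const (2⁻¹ : ℝ)).mul (HasDirD.sum (s := Finset.univ) fun i _ =>
    HasDirD.sum (s := Finset.univ) fun j _ => (hc i j).mul (hh i j))
  convert this using 1
  ring

/-- The matrix unit `E_{ab} + E_{ba}`. -/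
def symUnit (a b : Fin d) : Sym d :=
  ⟨fun i j => (if i = a then 1 else 0) * (if j = b then 1 else 0)
    + (if i = b then 1 else 0) * (if j = a then 1 else 0), fun i j => by ring⟩

lemma symUnit_apply (a b i j : Fin d) : (symUnit a b).1 i j =
    (if i = a then 1 else 0) * (if j = b then 1 else 0)
    + (if i = b then 1 else 0) * (if j = a then 1 else 0) := rfl

lemma sum_symUnit (g : Fin d → Fin d → ℝ) (a b : Fin d) :
    ∑ i, ∑ j, g i j * (symUnit a b).1 i j = g a b + g b a := by
  simp [symUnit_apply, mul_add, Finset.sum_add_distrib]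

/-! ### The determining equations of contact symmetries -/

/-- The coefficients `ξ_k` of a vector field on `J¹`. -/
def xiC (Z : J1 d → J1 d) (k : Fin d) : J1 d → ℝ := fun z => (Z z).1 k
/-- The coefficient `η` of a vector field on `J¹`. -/
def etaC (Z : J1 d → J1 d) : J1 d → ℝ := fun z => (Z z).2.1
/-- The coefficients `ζ_k` of a vector field on `J¹`. -/
def zetaC (Z : J1 d → J1 d) (k : Fin d) : J1 d → ℝ := fun z => (Z z).2.2 k

/-- The truncated total derivative `∂/∂x_i + p_i ∂/∂u`. -/
def totD (i : Fin d) (f : J1 d → ℝ) (z : J1 d) : ℝ := dirD (ex i) f z + z.2.2 i * dirD eu f z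

variable {U : Set (J1 d)} {Z : J1 d → J1 d} {z : J1 d}

section smooth

variable (hU : IsOpen U) (hZ : ContDiffOn ℝ ∞ Z U)
include hZ

lemma xiC_contDiffOn (k : Fin d) : ContDiffOn ℝ ∞ (xiC Z k) U :=
  contDiffOn_pi.1 hZ.fst k

lemma etaC_contDiffOn : ContDiffOn ℝ ∞ (etaC Z) U := hZ.snd.fst

include hU

lemma fderiv_xiC (hz : z ∈ U) (v : J1 d) (k : Fin d) :
    (fderiv ℝ Z z v).1 k = dirD v (xiC Z k) z := by
  have h := ((hZ.contDiffAt (hU.mem_nhds hz)).differentiableAt (by simp)).hasFDerivAt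
  exact ((HasFDerivAt.hasDirD (v := v) (((ContinuousLinearMap.proj (R := ℝ) (φ := fun _ : Fin d => ℝ) k).comp
      (ContinuousLinearMap.fst ℝ (Fin d → ℝ) (ℝ × (Fin d → ℝ)))).hasFDerivAt.comp z h)).2).symm

lemma fderiv_etaC (hz : z ∈ U) (v : J1 d) : (fderiv ℝ Z z v).2.1 = dirD v (etaC Z) z := by
  have h := ((hZ.contDiffAt (hU.mem_nhds hz)).differentiableAt (by simp)).hasFDerivAt
  exact ((HasFDerivAt.hasDirD (v := v) (((ContinuousLinearMap.fst ℝ ℝ (Fin d → ℝ)).comp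
      (ContinuousLinearMap.snd ℝ (Fin d → ℝ) (ℝ × (Fin d → ℝ)))).hasFDerivAt.comp z h)).2).symm

lemma fderiv_zetaC (hz : z ∈ U) (v : J1 d) (k : Fin d) :
    (fderiv ℝ Z z v).2.2 k = dirD v (zetaC Z k) z := by
  have h := ((hZ.contDiffAt (hU.mem_nhds hz)).differentiableAt (by simp)).hasFDerivAt
  exact ((HasFDerivAt.hasDirD (v := v) (((ContinuousLinearMap.proj (R := ℝ) (φ := fun _ : Fin d => ℝ) k).comp
      ((ContinuousLinearMap.snd ℝ ℝ (Fin d → ℝ)).comp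
      (ContinuousLinearMap.snd ℝ (Fin d → ℝ) (ℝ × (Fin d → ℝ))))).hasFDerivAt.comp z h)).2).symm

end smooth

lemma lift_single (θ : J2 d) (j : Fin d) :
    lift θ (Pi.single j 1) = ex j + θ.1.2.2 j • eu + ∑ l, θ.2.1 j l • ep l := by
  have h2 : (∑ l, θ.2.1 j l • ep l : J1 d) = (0, 0, θ.2.1 j) := by
    refine Prod.ext ?_ (Prod.ext ?_ ?_)
    · simp [Prod.fst_sum, ep]
    · simp [Prod.snd_sum, Prod.fst_sum, ep]
    · simp only [Prod.snd_sum, Prod.smul_snd, ep]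
      exact (pi_eq_sum_univ' (θ.2.1 j)).symm
  rw [h2]
  refine Prod.ext ?_ (Prod.ext ?_ ?_)
  · simp [lift, ex, eu]
  · simp [lift, ex, eu, Pi.single_apply]
  · funext k
    simp [lift, ex, eu, Pi.single_apply]

lemma dirD_lift (θ : J2 d) (j : Fin d) (f : J1 d → ℝ) :
    dirD (lift θ (Pi.single j 1)) f θ.1
      = totD j f θ.1 + ∑ l, θ.2.1 j l * dirD (ep l) f θ.1 := by
  rw [lift_single]
  simp [dirD, totD]

section contact

variable (hU : IsOpen U) (hZ : IsContactField U Z)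
include hU hZ

/-- The contact condition evaluated on the vertical contact vector ∂/∂p_k. -/
lemma IsContactField.etaC_ep (hz : z ∈ U) (k : Fin d) :
    dirD (ep k) (etaC Z) z = ∑ i, z.2.2 i * dirD (ep k) (xiC Z i) z := by
  have h := hZ.contact z hz (ep k) (by simp [contactForm, ep])
  simp only [contactForm, fderiv_xiC hU hZ.smooth hz, fderiv_etaC hU hZ.smooth hz] at h
  simp only [ep, Pi.zero_apply, mul_zero, Finset.sum_const_zero, sub_zero] at h
  simp only [ep]
  linarith

/-- The contact condition evaluated on the contact vector ∂/∂x_j + p_j ∂/∂u; thus ζ is determined by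
ξ and η. -/
lemma IsContactField.zetaC_eq (hz : z ∈ U) (j : Fin d) :
    zetaC Z j z = totD j (etaC Z) z - ∑ i, z.2.2 i * totD j (xiC Z i) z := by
  have h := hZ.contact z hz (ex j + z.2.2 j • eu)
    (by simp [contactForm, ex, eu, Pi.single_apply])
  simp only [contactForm, fderiv_xiC hU hZ.smooth hz, fderiv_etaC hU hZ.smooth hz,
    dirD_add_smul] at h
  have h2 : ∑ i, (Z z).2.2 i * (ex j + z.2.2 j • eu : J1 d).1 i = zetaC Z j z := by
    simp [ex, eu, Pi.single_apply, zetaC]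
  rw [h2] at h
  simp only [totD]
  linarith

/-- Differentiating `IsContactField.etaC_ep` in p_l and using the symmetry of the second
p-derivatives of η and of the ξ_i leaves exactly this symmetry. -/
lemma IsContactField.xiC_ep_symm (hz : z ∈ U) (k l : Fin d) :
    dirD (ep l) (xiC Z k) z = dirD (ep k) (xiC Z l) z := by
  have key : ∀ k l : Fin d, dirD (ep l) (dirD (ep k) (etaC Z)) z
      = dirD (ep k) (fun z => xiC Z l z) z + ∑ i, z.2.2 i * dirD (ep l) (dirD (ep k) (xiC Z i)) z := by
    intro k l
    have h1 := HasDirD.of_contDiffOn (v := ep l) hU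
      (dirD_contDiffOn hU (etaC_contDiffOn hZ.smooth) (ep k)) hz
    have h2 := HasDirD.sum (s := Finset.univ) fun i (_ : i ∈ Finset.univ) =>
      (hasDirD_p i (ep l) z).mul (HasDirD.of_contDiffOn (v := ep l) hU
        (dirD_contDiffOn hU (xiC_contDiffOn hZ.smooth i) (ep k)) hz)
    rw [HasDirD.eq_of_eqOn hU hz (fun z hz => hZ.etaC_ep hU hz k) h1 h2, Finset.sum_add_distrib]
    simp [ep, Pi.single_apply]
  have h1 := key k l
  have h2 := key l k
  have h3 : ∑ i, z.2.2 i * dirD (ep l) (dirD (ep k) (xiC Z i)) z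
      = ∑ i, z.2.2 i * dirD (ep k) (dirD (ep l) (xiC Z i)) z :=
    Finset.sum_congr rfl fun i _ => by
      rw [dirD_comm hU (xiC_contDiffOn hZ.smooth i) hz]
  rw [dirD_comm hU (etaC_contDiffOn hZ.smooth) hz, h2, h3] at h1
  simpa using h1

end contact

/-- The component of the determining equation of degree zero in the second derivatives. -/
def detZero (c : Fin d → Fin d → J1 d → ℝ) (Z : J1 d → J1 d) (z : J1 d) : ℝ :=
  ∑ i, ∑ j, c i j z * totD j (zetaC Z i) z
/-- The component of the determining equation of degree one in the second derivatives. -/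
def detOne (c : Fin d → Fin d → J1 d → ℝ) (Z : J1 d → J1 d) (z : J1 d)
    (H : Fin d → Fin d → ℝ) : ℝ :=
  ∑ i, ∑ j, (dirD (Z z) (c i j) z * H i j
    + c i j z * (∑ l, H j l * dirD (ep l) (zetaC Z i) z - ∑ k, H i k * totD j (xiC Z k) z))
/-- The component of the determining equation of degree two in the second derivatives. -/
def detTwo (c : Fin d → Fin d → J1 d → ℝ) (Z : J1 d → J1 d) (z : J1 d)
    (H K : Fin d → Fin d → ℝ) : ℝ :=
  ∑ i, ∑ j, ∑ k, ∑ l, c i j z * (H i k * K j l * dirD (ep l) (xiC Z k) z)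

variable {c : Fin d → Fin d → J1 d → ℝ}

lemma detOne_add_smul (H K : Fin d → Fin d → ℝ) (t : ℝ) :
    detOne c Z z (H + t • K) = detOne c Z z H + t * detOne c Z z K := by
  have key : ∀ (i : Fin d) (g : Fin d → ℝ), ∑ l, (H + t • K) i l * g l
      = ∑ l, H i l * g l + t * ∑ l, K i l * g l := fun i g => by
    rw [Finset.mul_sum, ← Finset.sum_add_distrib]
    refine Finset.sum_congr rfl fun l _ => ?_
    simp only [Pi.add_apply, Pi.smul_apply, smul_eq_mul]
    ring
  unfold detOne
  rw [Finset.mul_sum, ← Finset.sum_add_distrib]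
  refine Finset.sum_congr rfl fun i _ => ?_
  rw [Finset.mul_sum, ← Finset.sum_add_distrib]
  refine Finset.sum_congr rfl fun j _ => ?_
  rw [key, key]
  simp only [Pi.add_apply, Pi.smul_apply, smul_eq_mul]
  ring

lemma detTwo_add_smul_left (H K L : Fin d → Fin d → ℝ) (t : ℝ) :
    detTwo c Z z (H + t • K) L = detTwo c Z z H L + t * detTwo c Z z K L := by
  simp only [detTwo, Finset.mul_sum, ← Finset.sum_add_distrib]
  refine Finset.sum_congr rfl fun i _ => Finset.sum_congr rfl fun j _ =>
    Finset.sum_congr rfl fun k _ => Finset.sum_congr rfl fun l _ => ?_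
  simp only [Pi.add_apply, Pi.smul_apply, smul_eq_mul]
  ring

lemma detTwo_add_smul_right (H K L : Fin d → Fin d → ℝ) (t : ℝ) :
    detTwo c Z z L (H + t • K) = detTwo c Z z L H + t * detTwo c Z z L K := by
  simp only [detTwo, Finset.mul_sum, ← Finset.sum_add_distrib]
  refine Finset.sum_congr rfl fun i _ => Finset.sum_congr rfl fun j _ =>
    Finset.sum_congr rfl fun k _ => Finset.sum_congr rfl fun l _ => ?_
  simp only [Pi.add_apply, Pi.smul_apply, smul_eq_mul]
  ring

/-- The prolongation coefficient D_j ζ_i - Σ u_ik D_j ξ_k is quadratic in D²u because D_j itself is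
affine in D²u. Since c is symmetric, the symmetrization in `prolongField` has no effect here. -/
lemma PDE.IsQuasilinear.fderiv_prolongField {A : PDE d} (hA : A.IsQuasilinear c) (hU : IsOpen U)
    (hZ : ContDiffOn ℝ ∞ Z U) (hz : z ∈ U) (H : Sym d) :
    2 * fderiv ℝ A.F (z, H) (prolongField Z (z, H))
      = detZero c Z z + detOne c Z z H.1 - detTwo c Z z H.1 H.1 := by
  have h := (hA.hasFDerivAt (z, H) (prolongField Z (z, H))).2
  unfold dirD at h
  rw [h, ← mul_assoc, mul_inv_cancel₀ two_ne_zero, one_mul]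
  simp only [Finset.sum_add_distrib]
  rw [show (prolongField Z (z, H)).2 = JetPDE.symm fun i j =>
    (fderiv ℝ Z z (lift (z, H) (Pi.single j 1))).2.2 i
      - ∑ k, H.1 i k * (fderiv ℝ Z z (lift (z, H) (Pi.single j 1))).1 k from rfl,
    sum_symm_eq (c := fun i j => c i j z) (fun i j => by rw [hA.symmetric])]
  have e1 : ∀ i j, (fderiv ℝ Z z (lift (z, H) (Pi.single j 1))).2.2 i
      = totD j (zetaC Z i) z + ∑ l, H.1 j l * dirD (ep l) (zetaC Z i) z := fun i j => by
    rw [fderiv_zetaC hU hZ hz]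
    exact dirD_lift (z, H) j _
  have e2 : ∀ k j, (fderiv ℝ Z z (lift (z, H) (Pi.single j 1))).1 k
      = totD j (xiC Z k) z + ∑ l, H.1 j l * dirD (ep l) (xiC Z k) z := fun k j => by
    rw [fderiv_xiC hU hZ hz]
    exact dirD_lift (z, H) j _
  simp only [e1, e2]
  simp only [detZero, detOne, detTwo, ← Finset.sum_add_distrib, ← Finset.sum_sub_distrib]
  refine Finset.sum_congr rfl fun i _ => Finset.sum_congr rfl fun j _ => ?_
  simp only [mul_add, Finset.sum_add_distrib, Finset.mul_sum, mul_sub, Finset.sum_sub_distrib]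
  have : ∀ k l, c i j z * (H.1 i k * (H.1 j l * dirD (ep l) (xiC Z k) z))
      = c i j z * (H.1 i k * H.1 j l * dirD (ep l) (xiC Z k) z) := fun k l => by ring
  simp only [this]
  simp only [dirD, prolongField]
  ring

/-- Evaluation of the quadratic part on matrix units, from which single p-derivatives of ξ are
isolated. -/
lemma detTwo_symUnit (a b e f : Fin d) :
    detTwo c Z z (symUnit a b).1 (symUnit e f).1
      = c a e z * dirD (ep f) (xiC Z b) z + c b e z * dirD (ep f) (xiC Z a) z
        + c a f z * dirD (ep e) (xiC Z b) z + c b f z * dirD (ep e) (xiC Z a) z := by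
  have : detTwo c Z z (symUnit a b).1 (symUnit e f).1
      = ∑ i, ∑ k, (symUnit a b).1 i k * ∑ j, ∑ l, (c i j z * dirD (ep l) (xiC Z k) z)
        * (symUnit e f).1 j l := by
    unfold detTwo
    refine Finset.sum_congr rfl fun i _ => ?_
    rw [Finset.sum_comm]
    refine Finset.sum_congr rfl fun k _ => ?_
    simp only [Finset.mul_sum]
    exact Finset.sum_congr rfl fun j _ => Finset.sum_congr rfl fun l _ => by ring
  rw [this]
  simp only [sum_symUnit]
  simp only [mul_comm ((symUnit a b).1 _ _), sum_symUnit]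
  ring

end ContactFields

/-! ### Reduction of contact symmetries to point symmetries. -/

section PointSymmetries

variable {d : ℕ} {U : Set (J1 d)} {Z : J1 d → J1 d} {z : J1 d} {c : Fin d → Fin d → J1 d → ℝ}
  {A : PDE d}

/-- The linear form `H ↦ ∑ c_{ij} H_{ij}`. -/
def traceForm (g : Fin d → Fin d → ℝ) : Sym d →ₗ[ℝ] ℝ where
  toFun H := ∑ i, ∑ j, g i j * H.1 i j
  map_add' H K := by
    simp only [← Finset.sum_add_distrib, Submodule.coe_add, Pi.add_apply, mul_add]
  map_smul' t H := by
    simp only [Finset.mul_sum, Submodule.coe_smul, Pi.smul_apply, smul_eq_mul, RingHom.id_apply]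
    exact Finset.sum_congr rfl fun i _ => Finset.sum_congr rfl fun j _ => by ring

lemma traceForm_symUnit (g : Fin d → Fin d → ℝ) (a b : Fin d) :
    traceForm g (symUnit a b) = g a b + g b a := sum_symUnit g a b

/-- On a fibre the equation is the hyperplane `traceForm = 0`. Tangency near one of its points makes
a polynomial of degree two vanish on an open piece of the hyperplane, hence on all of it; the values
at 0, H and -H separate the degrees. -/
lemma PDE.IsLocalSymmetry.det_eq_zero (hA : A.IsQuasilinear c) (hU : IsOpen U)
    (hS : A.IsLocalSymmetry U Z) (hz : z ∈ U) {H : Sym d}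
    (hH : traceForm (fun i j => c i j z) H = 0) :
    detOne c Z z H.1 = 0 ∧ detTwo c Z z H.1 H.1 = 0 := by
  obtain ⟨H₀, h0, hev⟩ := hS.tangent z hz
  have hF : ∀ K : Sym d, A.F (z, K) = 2⁻¹ * traceForm (fun i j => c i j z) K :=
    fun K => hA.eq (z, K)
  let E := LinearMap.ker (traceForm fun i j => c i j z)
  let q : E → ℝ := fun K => detZero c Z z + detOne c Z z K.1.1 - detTwo c Z z K.1.1 K.1.1
  have hq : ∀ K : E, q K = 0 := by
    have hH₀ : H₀ ∈ E := by
      rw [hF] at h0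
      exact LinearMap.mem_ker.2 (by linarith)
    refine eq_zero_of_quadratic (p := ⟨H₀, hH₀⟩) (fun p v => ?_) ?_
    · refine ⟨detOne c Z z v.1.1 - detTwo c Z z p.1.1 v.1.1 - detTwo c Z z v.1.1 p.1.1,
        - detTwo c Z z v.1.1 v.1.1, fun t => ?_⟩
      change detZero c Z z + detOne c Z z (p.1.1 + t • v.1.1)
        - detTwo c Z z (p.1.1 + t • v.1.1) (p.1.1 + t • v.1.1) = _
      rw [detOne_add_smul, detTwo_add_smul_left, detTwo_add_smul_right, detTwo_add_smul_right]
      ring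
    · have hc : Filter.Tendsto (fun K : E => K.1) (nhds ⟨H₀, hH₀⟩) (nhds H₀) :=
        continuous_subtype_val.tendsto _
      filter_upwards [hc.eventually hev] with K hK
      have h1 := hK (by rw [hF, LinearMap.mem_ker.1 K.2, mul_zero])
      have h2 := hA.fderiv_prolongField hU hS.field.smooth hz K.1
      rw [h1, mul_zero] at h2
      exact h2.symm
  have e0 := hq 0
  have e1 := hq ⟨H, hH⟩
  have e2 := hq (-⟨H, hH⟩)
  have hz0 : detOne c Z z 0 = 0 ∧ detTwo c Z z 0 0 = 0 := by simp [detOne, detTwo]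
  have hn1 : detOne c Z z (-H.1) = - detOne c Z z H.1 := by
    have := detOne_add_smul (c := c) (Z := Z) (z := z) 0 H.1 (-1)
    simpa [hz0.1] using this
  have hn2 : detTwo c Z z (-H.1) (-H.1) = detTwo c Z z H.1 H.1 := by
    simp [detTwo]
  change detZero c Z z + detOne c Z z 0 - detTwo c Z z 0 0 = 0 at e0
  change detZero c Z z + detOne c Z z H.1 - detTwo c Z z H.1 H.1 = 0 at e1
  change detZero c Z z + detOne c Z z (-H.1) - detTwo c Z z (-H.1) (-H.1) = 0 at e2
  rw [hz0.1, hz0.2] at e0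
  rw [hn1, hn2] at e2
  constructor <;> linarith

/-- Polarisation of the quadratic part. -/
lemma PDE.IsLocalSymmetry.detTwo_add_eq_zero (hA : A.IsQuasilinear c) (hU : IsOpen U)
    (hS : A.IsLocalSymmetry U Z) (hz : z ∈ U) {H K : Sym d}
    (hH : traceForm (fun i j => c i j z) H = 0) (hK : traceForm (fun i j => c i j z) K = 0) :
    detTwo c Z z H.1 K.1 + detTwo c Z z K.1 H.1 = 0 := by
  have h1 := (hS.det_eq_zero hA hU hz hH).2
  have h2 := (hS.det_eq_zero hA hU hz hK).2
  have h3 := (hS.det_eq_zero hA hU hz (H := H + (1 : ℝ) • K) (by simp [hH, hK])).2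
  change detTwo c Z z (H.1 + (1 : ℝ) • K.1) (H.1 + (1 : ℝ) • K.1) = 0 at h3
  rw [detTwo_add_smul_left, detTwo_add_smul_right, detTwo_add_smul_right] at h3
  linarith

section

variable (hA : A.IsQuasilinear c) (hU : IsOpen U) (hS : A.IsLocalSymmetry U Z)
  (hc : ∀ z ∈ U, ∀ i j, i ≠ j → c i j z ≠ 0) (hd : 3 ≤ d)
include hA hU hS hc hd

/-- Contact symmetries are point symmetries. -/
theorem PDE.IsLocalSymmetry.xiC_ep (hz : z ∈ U) (k l : Fin d) :
    dirD (ep l) (xiC Z k) z = 0 := by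
  have hdiag : ∀ a, c a a z = 0 := fun a => by rw [hA.diag]; rfl
  have hsym : ∀ a b, c a b z = c b a z := fun a b => by rw [hA.symmetric]
  have hX := fun k l => hS.field.xiC_ep_symm hU hz k l
  have hoff : ∀ a b, a ≠ b → dirD (ep b) (xiC Z a) z = 0 := by
    intro a b hab
    -- As c has no diagonal, E_aa and E_bb both lie in the hyperplane; their polarised value is a
    -- non-zero multiple of c_ab ∂ξ_a/∂p_b.
    have h := hS.detTwo_add_eq_zero hA hU hz (H := symUnit a a) (K := symUnit b b)
      (by rw [traceForm_symUnit]; simp [hdiag]) (by rw [traceForm_symUnit]; simp [hdiag])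
    rw [detTwo_symUnit, detTwo_symUnit, hsym b a, hX b a] at h
    have : c a b z * dirD (ep b) (xiC Z a) z = 0 := by linarith
    exact (mul_eq_zero.1 this).resolve_left (hc z hz a b hab)
  rcases ne_or_eq k l with h | rfl
  · exact hoff k l h
  obtain ⟨b, hb⟩ : ∃ b : Fin d, b ≠ k := by
    have : Nontrivial (Fin d) := Fin.nontrivial_iff_two_le.2 (by omega)
    exact exists_ne k
  obtain ⟨e, he⟩ : ∃ e : Fin d, e ∉ ({k, b} : Finset (Fin d)) := by
    by_contra! h
    have h1 : (Finset.univ : Finset (Fin d)) ⊆ {k, b} := fun x _ => h x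
    have h2 := Finset.card_le_card h1
    have h3 := Finset.card_le_two (a := k) (b := b)
    rw [Finset.card_univ, Fintype.card_fin] at h2
    omega
  simp only [Finset.mem_insert, Finset.mem_singleton, not_or] at he
  -- The diagonal derivative needs three distinct indices: c_be E_kb - c_kb E_be lies in the
  -- hyperplane, and paired with E_kk it leaves only c_kb c_be ∂ξ_k/∂p_k.
  have h := hS.detTwo_add_eq_zero hA hU hz (H := symUnit k k)
    (K := c b e z • symUnit k b + (-(c k b z)) • symUnit b e)
    (by rw [traceForm_symUnit]; simp [hdiag])
    (by
      rw [map_add, map_smul, map_smul, traceForm_symUnit, traceForm_symUnit, hsym b k, hsym e b]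
      simp only [smul_eq_mul]; ring)
  have e1 : (c b e z • symUnit k b + (-(c k b z)) • symUnit b e : Sym d).1
      = (0 + c b e z • (symUnit k b).1) + (-(c k b z)) • (symUnit b e).1 := by
    rw [zero_add]; rfl
  have z1 : ∀ K, detTwo c Z z 0 K = 0 := fun K => by simp [detTwo]
  have z2 : ∀ K, detTwo c Z z K 0 = 0 := fun K => by simp [detTwo]
  rw [e1] at h
  simp only [detTwo_add_smul_left, detTwo_add_smul_right, detTwo_symUnit, z1, z2, hdiag,
    hoff k b hb.symm, hoff b k hb, hoff k e (Ne.symm he.1), hoff e k he.1, hsym b k, hsym e k] at h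
  have : c k b z * c b e z * dirD (ep k) (xiC Z k) z = 0 := by linarith
  exact (mul_eq_zero.1 this).resolve_left
    (mul_ne_zero (hc z hz k b hb.symm) (hc z hz b e (Ne.symm he.2)))

theorem PDE.IsLocalSymmetry.etaC_ep (hz : z ∈ U) (l : Fin d) : dirD (ep l) (etaC Z) z = 0 := by
  rw [hS.field.etaC_ep hU hz]
  exact Finset.sum_eq_zero fun i _ => by rw [hS.xiC_ep hA hU hc hd hz, mul_zero]

/-- As ξ and η are free of p, in ζ_i = D_i η - Σ p_k D_i ξ_k the variable p_l enters only through
the explicit factors p_k and through D_i. -/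
lemma PDE.IsLocalSymmetry.zetaC_ep (hz : z ∈ U) (i l : Fin d) :
    dirD (ep l) (zetaC Z i) z
      = (if i = l then dirD eu (etaC Z) z - ∑ k, z.2.2 k * dirD eu (xiC Z k) z else 0)
        - totD i (xiC Z l) z := by
  have hsm := hS.field.smooth
  have hpc : ∀ f : J1 d → ℝ, ContDiffOn ℝ ∞ f U → (∀ z ∈ U, dirD (ep l) f z = 0) →
      HasDirD (totD i f) (if i = l then dirD eu f z else 0) (ep l) z := by
    intro f hf h0
    have h1 := HasDirD.of_contDiffOn (v := ep l) hU (dirD_contDiffOn hU hf (ex i)) hz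
    have h2 := HasDirD.of_contDiffOn (v := ep l) hU (dirD_contDiffOn hU hf eu) hz
    rw [dirD_comm hU hf hz, dirD_eq_zero_of_eqOn hU hz h0] at h1 h2
    have h3 := h1.add ((hasDirD_p i (ep l) z).mul h2)
    have e : 0 + ((ep l : J1 d).2.2 i * dirD eu f z + z.2.2 i * 0)
        = if i = l then dirD eu f z else 0 := by
      simp [ep, Pi.single_apply]
    rwa [e] at h3
  have hη := hpc _ (etaC_contDiffOn hsm) fun z hz => hS.etaC_ep hA hU hc hd hz l
  have hξ := fun k => hpc _ (xiC_contDiffOn hsm k) fun z hz => hS.xiC_ep hA hU hc hd hz k l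
  have h := hη.sub (HasDirD.sum (s := Finset.univ) fun k (_ : k ∈ Finset.univ) =>
    (hasDirD_p k (ep l) z).mul (hξ k))
  rw [(HasDirD.congr_of_eqOn hU hz (fun z hz => hS.field.zetaC_eq hU hz i) h).2]
  rw [Finset.sum_add_distrib]
  simp only [ep, Pi.single_apply, ite_mul, one_mul, zero_mul, Finset.sum_ite_eq',
    Finset.mem_univ, if_true]
  by_cases h : i = l
  · simp only [h, if_true]
    ring
  · simp [h]

/-- The coefficient of `u_{ab}` in the Lie derivative of the equation, up to multiples of `c_{ab}`. -/
def detCoeff (c : Fin d → Fin d → J1 d → ℝ) (Z : J1 d → J1 d) (z : J1 d) (a b : Fin d) : ℝ :=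
  dirD (Z z) (c a b) z - ∑ m, (c a m z * totD m (xiC Z b) z + c b m z * totD m (xiC Z a) z)

/-- The second summand is proportional to c_ab, so it drops out modulo the equation and only
`detCoeff` matters. -/
lemma PDE.IsLocalSymmetry.detOne_symUnit (hz : z ∈ U) (a b : Fin d) :
    detOne c Z z (symUnit a b).1 = 2 * detCoeff c Z z a b
      + 2 * c a b z * (dirD eu (etaC Z) z - ∑ k, z.2.2 k * dirD eu (xiC Z k) z) := by
  have hsym : ∀ a b, c a b z = c b a z := fun a b => by rw [hA.symmetric]
  set N := dirD eu (etaC Z) z - ∑ k, z.2.2 k * dirD eu (xiC Z k) z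
  have e1 : ∀ i j, ∑ l, (symUnit a b).1 j l * dirD (ep l) (zetaC Z i) z
      = (symUnit a b).1 j i * N - ∑ l, (symUnit a b).1 j l * totD i (xiC Z l) z := by
    intro i j
    simp only [hS.zetaC_ep hA hU hc hd hz, mul_sub, Finset.sum_sub_distrib, mul_ite, mul_zero,
      Finset.sum_ite_eq, Finset.mem_univ, if_true, N]
  have e2 : ∑ i, ∑ j, c i j z * ∑ l, (symUnit a b).1 j l * totD i (xiC Z l) z
      = ∑ i, ∑ j, c i j z * ∑ l, (symUnit a b).1 i l * totD j (xiC Z l) z := by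
    rw [Finset.sum_comm]
    exact Finset.sum_congr rfl fun i _ => Finset.sum_congr rfl fun j _ => by rw [hsym]
  have e3 : ∑ i, ∑ j, c i j z * ∑ l, (symUnit a b).1 i l * totD j (xiC Z l) z
      = ∑ m, (c a m z * totD m (xiC Z b) z + c b m z * totD m (xiC Z a) z) := by
    have : ∑ i, ∑ j, c i j z * ∑ l, (symUnit a b).1 i l * totD j (xiC Z l) z
        = ∑ i, ∑ l, (∑ j, c i j z * totD j (xiC Z l) z) * (symUnit a b).1 i l := by
      refine Finset.sum_congr rfl fun i _ => ?_
      simp only [Finset.mul_sum, Finset.sum_mul]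
      rw [Finset.sum_comm]
      exact Finset.sum_congr rfl fun j _ => Finset.sum_congr rfl fun l _ => by ring
    rw [this, sum_symUnit (fun i l => ∑ j, c i j z * totD j (xiC Z l) z), Finset.sum_add_distrib]
  have e4 : ∀ i j, (symUnit a b).1 j i = (symUnit a b).1 i j := fun i j => (symUnit a b).2 j i
  have e5 := sum_symUnit (fun i j => dirD (Z z) (c i j) z) a b
  have e6 := sum_symUnit (fun i j => c i j z) a b
  unfold detOne
  simp only [e1, mul_sub, Finset.sum_add_distrib, Finset.sum_sub_distrib, e2, e3, e4, e5]
  have e7 : ∑ i, ∑ j, c i j z * ((symUnit a b).1 i j * N)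
      = (∑ i, ∑ j, c i j z * (symUnit a b).1 i j) * N := by
    simp only [Finset.sum_mul]
    exact Finset.sum_congr rfl fun i _ => Finset.sum_congr rfl fun j _ => by ring
  rw [e7, e6, hsym b a, hA.symmetric b a]
  unfold detCoeff
  rw [Finset.sum_add_distrib]
  ring

/-- The first system of determining equations of point symmetries. -/
theorem PDE.IsLocalSymmetry.sum_totD (hz : z ∈ U) (i : Fin d) :
    ∑ j, c i j z * totD j (xiC Z i) z = 0 := by
  have hdiag : c i i z = 0 := by rw [hA.diag]; rfl
  -- E_ii lies in the hyperplane because c_ii = 0.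
  have h := (hS.det_eq_zero hA hU hz (H := symUnit i i)
    (by rw [traceForm_symUnit]; simp [hdiag])).1
  rw [hS.detOne_symUnit hA hU hc hd hz, hdiag] at h
  have h0 : dirD (Z z) (c i i) z = 0 := by
    rw [hA.diag]; simp [dirD]
  unfold detCoeff at h
  rw [h0, Finset.sum_add_distrib] at h
  linarith

/-- The second system of determining equations of point symmetries. -/
theorem PDE.IsLocalSymmetry.detCoeff_mul (hz : z ∈ U) (i j k l : Fin d) :
    detCoeff c Z z i j * c k l z = detCoeff c Z z k l * c i j z := by
  have hsym : ∀ a b, c a b z = c b a z := fun a b => by rw [hA.symmetric]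
  -- The matrix c_kl E_ij - c_ij E_kl lies in the hyperplane, so the linear part is proportional to
  -- c.
  have h := (hS.det_eq_zero hA hU hz
    (H := c k l z • symUnit i j + (-(c i j z)) • symUnit k l)
    (by
      rw [map_add, map_smul, map_smul, traceForm_symUnit, traceForm_symUnit, hsym j i, hsym l k]
      simp only [smul_eq_mul]; ring)).1
  have e1 : (c k l z • symUnit i j + (-(c i j z)) • symUnit k l : Sym d).1
      = (0 + c k l z • (symUnit i j).1) + (-(c i j z)) • (symUnit k l).1 := by
    rw [zero_add]; rfl
  have z1 : detOne c Z z 0 = 0 := by simp [detOne]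
  rw [e1, detOne_add_smul, detOne_add_smul, hS.detOne_symUnit hA hU hc hd hz,
    hS.detOne_symUnit hA hU hc hd hz, z1] at h
  linarith

end

end PointSymmetries

/-! ### Coefficients (x_i - x_j) m_ij(p): determining equations as polynomial identities in p. -/

section WebEquations

variable {d : ℕ}

/-- Coefficients of the form `(x_i - x_j) m_{ij}(p)` with `m_{ij}` linear. -/
def webCoeff (m : Fin d → Fin d → (Fin d → ℝ) →ₗ[ℝ] ℝ) (i j : Fin d) : J1 d → ℝ :=
  fun z => (z.1 i - z.1 j) * m i j z.2.2

variable {m : Fin d → Fin d → (Fin d → ℝ) →ₗ[ℝ] ℝ} {U : Set (J1 d)} {Z : J1 d → J1 d}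
  {z : J1 d} {A : PDE d}

lemma hasDirD_linear (l : (Fin d → ℝ) →ₗ[ℝ] ℝ) (v z : J1 d) :
    HasDirD (fun z : J1 d => l z.2.2) (l v.2.2) v z :=
  HasFDerivAt.hasDirD ((l.toContinuousLinearMap.comp ((ContinuousLinearMap.snd ℝ ℝ (Fin d → ℝ)).comp
    (ContinuousLinearMap.snd ℝ (Fin d → ℝ) (ℝ × (Fin d → ℝ))))).hasFDerivAt)

lemma dirD_webCoeff (i j : Fin d) (w z : J1 d) : dirD w (webCoeff m i j) z
    = (w.1 i - w.1 j) * m i j z.2.2 + (z.1 i - z.1 j) * m i j w.2.2 :=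
  (((hasDirD_x i w z).sub (hasDirD_x j w z)).mul (hasDirD_linear (m i j) w z)).2

lemma isQuasilinear_webCoeff (hm : ∀ i j p, m i j p = - m j i p)
    (hF : ∀ θ, A.F θ = 2⁻¹ * ∑ i, ∑ j, webCoeff m i j θ.1 * θ.2.1 i j) :
    A.IsQuasilinear (webCoeff m) where
  smooth i j := by
    have h : ContDiff ℝ ∞ fun p : Fin d → ℝ => m i j p :=
      (m i j).toContinuousLinearMap.contDiff
    have h2 : ContDiff ℝ ∞ fun z : J1 d => m i j z.2.2 := h.comp (by fun_prop)
    have h3 : ContDiff ℝ ∞ fun z : J1 d => z.1 i - z.1 j := by fun_prop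
    exact h3.mul h2
  symmetric i j := by
    funext z
    unfold webCoeff
    rw [hm]
    ring
  diag i := by
    funext z
    simp [webCoeff]
  eq := hF

/-- The coefficient `detCoeff` of a point symmetry as a function of `p` for fixed `(x, u)`. -/
def fibreCoeff (m : Fin d → Fin d → (Fin d → ℝ) →ₗ[ℝ] ℝ) (Z : J1 d → J1 d) (z : J1 d)
    (i j : Fin d) (p : Fin d → ℝ) : ℝ :=
  (xiC Z i z - xiC Z j z) * m i j p
    + (z.1 i - z.1 j) * m i j (fun k => dirD (ex k) (etaC Z) z + p k * dirD eu (etaC Z) z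
        - ∑ n, p n * dirD (ex k) (xiC Z n) z)
    - ∑ n, ((z.1 i - z.1 n) * m i n p * dirD (ex n) (xiC Z j) z
        + (z.1 j - z.1 n) * m j n p * dirD (ex n) (xiC Z i) z)

/-- `fibreCoeff` is affine in p; multiplied by a linear form it is therefore quadratic along lines,
as `eq_zero_of_quadratic` requires. -/
lemma fibreCoeff_add_smul (i j : Fin d) (p v : Fin d → ℝ) (t : ℝ) :
    fibreCoeff m Z z i j (p + t • v)
      = fibreCoeff m Z z i j p + t * (fibreCoeff m Z z i j v - fibreCoeff m Z z i j 0) := by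
  have e : (fun k => dirD (ex k) (etaC Z) z + (p + t • v) k * dirD eu (etaC Z) z
        - ∑ n, (p + t • v) n * dirD (ex k) (xiC Z n) z)
      = (fun k => dirD (ex k) (etaC Z) z + p k * dirD eu (etaC Z) z
        - ∑ n, p n * dirD (ex k) (xiC Z n) z)
        + t • ((fun k => dirD (ex k) (etaC Z) z + v k * dirD eu (etaC Z) z
        - ∑ n, v n * dirD (ex k) (xiC Z n) z) - (fun k => dirD (ex k) (etaC Z) z
          + (0 : Fin d → ℝ) k * dirD eu (etaC Z) z
        - ∑ n, (0 : Fin d → ℝ) n * dirD (ex k) (xiC Z n) z)) := by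
    funext k
    simp only [Pi.add_apply, Pi.smul_apply, smul_eq_mul, Pi.sub_apply, add_mul,
      Finset.sum_add_distrib, Pi.zero_apply, zero_mul, Finset.sum_const_zero, mul_assoc,
      ← Finset.mul_sum]
    ring
  have e2 : ∑ n, ((z.1 i - z.1 n) * m i n (p + t • v) * dirD (ex n) (xiC Z j) z
        + (z.1 j - z.1 n) * m j n (p + t • v) * dirD (ex n) (xiC Z i) z)
      = ∑ n, ((z.1 i - z.1 n) * m i n p * dirD (ex n) (xiC Z j) z
        + (z.1 j - z.1 n) * m j n p * dirD (ex n) (xiC Z i) z)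
        + t * ∑ n, ((z.1 i - z.1 n) * m i n v * dirD (ex n) (xiC Z j) z
        + (z.1 j - z.1 n) * m j n v * dirD (ex n) (xiC Z i) z) := by
    rw [Finset.mul_sum, ← Finset.sum_add_distrib]
    refine Finset.sum_congr rfl fun n _ => ?_
    simp only [map_add, map_smul, smul_eq_mul]
    ring
  unfold fibreCoeff
  rw [e, e2]
  simp only [map_add, map_smul, map_sub, map_zero, smul_eq_mul, mul_zero, zero_mul, add_zero,
    Finset.sum_const_zero, sub_zero]
  ring

section

variable (hA : A.IsQuasilinear (webCoeff m)) (hU : IsOpen U) (hS : A.IsLocalSymmetry U Z)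
  (hc : ∀ z ∈ U, ∀ i j, i ≠ j → webCoeff m i j z ≠ 0) (hd : 3 ≤ d)
include hA hU hS hc hd

lemma PDE.IsLocalSymmetry.dirD_ep_dirD (hz : z ∈ U) (v : J1 d) (k l : Fin d) :
    dirD (ep l) (dirD v (xiC Z k)) z = 0 := by
  rw [dirD_comm hU (xiC_contDiffOn hS.field.smooth k) hz]
  exact dirD_eq_zero_of_eqOn hU hz fun z hz => hS.xiC_ep hA hU hc hd hz k l

lemma PDE.IsLocalSymmetry.dirD_ep_dirD_etaC (hz : z ∈ U) (v : J1 d) (l : Fin d) :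
    dirD (ep l) (dirD v (etaC Z)) z = 0 := by
  rw [dirD_comm hU (etaC_contDiffOn hS.field.smooth) hz]
  exact dirD_eq_zero_of_eqOn hU hz fun z hz => hS.etaC_ep hA hU hc hd hz l

lemma PDE.IsLocalSymmetry.eventually_xiC (hz : z ∈ U) (v : J1 d) :
    ∀ᶠ p in nhds z.2.2, ∀ k, dirD v (xiC Z k) (z.1, z.2.1, p) = dirD v (xiC Z k) z :=
  Filter.eventually_all.2 fun k => eventually_eq_of_dirD_ep_eq_zero hU
    (dirD_contDiffOn hU (xiC_contDiffOn hS.field.smooth k) v)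
    (fun _ hz l => hS.dirD_ep_dirD hA hU hc hd hz v k l) hz

lemma PDE.IsLocalSymmetry.eventually_etaC (hz : z ∈ U) (v : J1 d) :
    ∀ᶠ p in nhds z.2.2, dirD v (etaC Z) (z.1, z.2.1, p) = dirD v (etaC Z) z :=
  eventually_eq_of_dirD_ep_eq_zero hU
    (dirD_contDiffOn hU (etaC_contDiffOn hS.field.smooth) v)
    (fun _ hz l => hS.dirD_ep_dirD_etaC hA hU hc hd hz v l) hz

omit hA hS hc hd in
lemma eventually_mem_fibre (hz : z ∈ U) :
    ∀ᶠ p in nhds z.2.2, ((z.1, z.2.1, p) : J1 d) ∈ U := by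
  have hcont : Continuous fun p : Fin d → ℝ => ((z.1, z.2.1, p) : J1 d) := by fun_prop
  exact (hU.preimage hcont).mem_nhds hz

/-- The first system of determining equations holds for all `p` if the coefficients are frozen. -/
theorem PDE.IsLocalSymmetry.sum_fibre (hz : z ∈ U) (i : Fin d) (p : Fin d → ℝ) :
    ∑ j, (z.1 i - z.1 j) * m i j p * (dirD (ex j) (xiC Z i) z + p j * dirD eu (xiC Z i) z) = 0 := by
  refine eq_zero_of_quadratic (p := z.2.2) (q := fun p => ∑ j, (z.1 i - z.1 j) * m i j p
    * (dirD (ex j) (xiC Z i) z + p j * dirD eu (xiC Z i) z)) (fun p v => ?_) ?_ p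
  · refine ⟨∑ j, ((z.1 i - z.1 j) * m i j v * (dirD (ex j) (xiC Z i) z + p j * dirD eu (xiC Z i) z)
      + (z.1 i - z.1 j) * m i j p * (v j * dirD eu (xiC Z i) z)),
      ∑ j, (z.1 i - z.1 j) * m i j v * (v j * dirD eu (xiC Z i) z), fun t => ?_⟩
    rw [Finset.mul_sum, Finset.mul_sum, ← Finset.sum_add_distrib, ← Finset.sum_add_distrib]
    refine Finset.sum_congr rfl fun j _ => ?_
    simp only [map_add, map_smul, smul_eq_mul, Pi.add_apply, Pi.smul_apply]
    ring
  -- Near the given p the derivatives of ξ do not change along the fibre, so the frozen expression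
  -- agrees with the true determining equation on an open set.
  · filter_upwards [eventually_mem_fibre hU hz,
      Filter.eventually_all.2 fun j => hS.eventually_xiC hA hU hc hd hz (ex j),
      hS.eventually_xiC hA hU hc hd hz eu] with p h1 h2 h3
    have h := hS.sum_totD hA hU hc hd h1 i
    simpa only [totD, h2, h3, webCoeff] using h

/-- The second system of determining equations holds for all `p` if the coefficients are frozen. -/
theorem PDE.IsLocalSymmetry.fibreCoeff_mul (hu : ∀ z ∈ U, ∀ k, dirD eu (xiC Z k) z = 0)
    (hz : z ∈ U) (i j k l : Fin d) (p : Fin d → ℝ) :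
    fibreCoeff m Z z i j p * ((z.1 k - z.1 l) * m k l p)
      = fibreCoeff m Z z k l p * ((z.1 i - z.1 j) * m i j p) := by
  refine sub_eq_zero.1 (eq_zero_of_quadratic (p := z.2.2)
    (q := fun p => fibreCoeff m Z z i j p * ((z.1 k - z.1 l) * m k l p)
      - fibreCoeff m Z z k l p * ((z.1 i - z.1 j) * m i j p)) (fun p v => ?_) ?_ p)
  · refine ⟨(fibreCoeff m Z z i j v - fibreCoeff m Z z i j 0) * ((z.1 k - z.1 l) * m k l p)
      + fibreCoeff m Z z i j p * ((z.1 k - z.1 l) * m k l v)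
      - (fibreCoeff m Z z k l v - fibreCoeff m Z z k l 0) * ((z.1 i - z.1 j) * m i j p)
      - fibreCoeff m Z z k l p * ((z.1 i - z.1 j) * m i j v),
      (fibreCoeff m Z z i j v - fibreCoeff m Z z i j 0) * ((z.1 k - z.1 l) * m k l v)
      - (fibreCoeff m Z z k l v - fibreCoeff m Z z k l 0) * ((z.1 i - z.1 j) * m i j v),
      fun t => ?_⟩
    simp only [fibreCoeff_add_smul, map_add, map_smul, smul_eq_mul]
    ring
  · have hξ := Filter.eventually_all.2 fun k => eventually_eq_of_dirD_ep_eq_zero hU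
      (xiC_contDiffOn hS.field.smooth k) (fun z hz l => hS.xiC_ep hA hU hc hd hz k l) hz
    filter_upwards [eventually_mem_fibre hU hz, hξ,
      Filter.eventually_all.2 fun j => hS.eventually_xiC hA hU hc hd hz (ex j),
      Filter.eventually_all.2 fun j => hS.eventually_etaC hA hU hc hd hz (ex j),
      hS.eventually_etaC hA hU hc hd hz eu] with p h1 h2 h3 h4 h5
    -- By `hu` the total derivatives of ξ reduce to x-derivatives, so ζ is affine in p with frozen
    -- coefficients.
    have key : ∀ i j, detCoeff (webCoeff m) Z (z.1, z.2.1, p) i j = fibreCoeff m Z z i j p := by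
      intro i j
      have hζ : (Z (z.1, z.2.1, p)).2.2 = fun k => dirD (ex k) (etaC Z) z
          + p k * dirD eu (etaC Z) z - ∑ n, p n * dirD (ex k) (xiC Z n) z := by
        funext k
        have := hS.field.zetaC_eq hU h1 k
        simp only [totD, h3, h4, h5, hu _ h1, mul_zero, add_zero] at this
        exact this
      have h2' : ∀ k, (Z (z.1, z.2.1, p)).1 k = xiC Z k z := h2
      unfold detCoeff fibreCoeff
      rw [dirD_webCoeff, hζ, h2', h2']
      simp only [totD, h3, hu _ h1, mul_zero, add_zero, webCoeff]
    have h := hS.detCoeff_mul hA hU hc hd h1 i j k l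
    rw [key, key] at h
    simp only [webCoeff] at h
    exact sub_eq_zero.2 h

end

end WebEquations

/-! ### Counting dimensions with pairs of linear forms of rank at most one. -/

section LinearAlgebra

variable {M : Type*} [AddCommGroup M] [Module ℝ M] [FiniteDimensional ℝ M]

lemma finrank_le_finrank_inf_ker (S : Submodule ℝ M) (f : M →ₗ[ℝ] ℝ) :
    Module.finrank ℝ S ≤ Module.finrank ℝ (S ⊓ LinearMap.ker f : Submodule ℝ M) + 1 := by
  have h1 := LinearMap.finrank_range_add_finrank_ker (f.domRestrict S)
  have h2 : Module.finrank ℝ (LinearMap.range (f.domRestrict S)) ≤ 1 := by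
    simpa using Submodule.finrank_le (LinearMap.range (f.domRestrict S))
  have h3 : Module.finrank ℝ (LinearMap.ker (f.domRestrict S))
      ≤ Module.finrank ℝ (S ⊓ LinearMap.ker f : Submodule ℝ M) := by
    have e : (LinearMap.ker (f.domRestrict S)).map S.subtype = S ⊓ LinearMap.ker f := by
      ext x
      simp only [Submodule.mem_map, LinearMap.mem_ker, Submodule.mem_inf]
      constructor
      · rintro ⟨y, hy, rfl⟩
        exact ⟨y.2, hy⟩
      · rintro ⟨hx, hf⟩
        exact ⟨⟨x, hx⟩, hf, rfl⟩
    rw [← e]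
    exact (LinearEquiv.finrank_eq (Submodule.equivMapOfInjective _
      (Submodule.injective_subtype S) _)).le
  omega

/-- Two linear forms whose wedge product vanishes on `S` vanish on a hyperplane of `S`. -/
lemma exists_le_of_wedge_eq_zero (S : Submodule ℝ M) (f g : M →ₗ[ℝ] ℝ)
    (h : ∀ x ∈ S, ∀ y ∈ S, f x * g y = f y * g x) :
    ∃ T ≤ S, Module.finrank ℝ S ≤ Module.finrank ℝ T + 1 ∧ ∀ x ∈ T, f x = 0 ∧ g x = 0 := by
  by_cases hf : ∃ x ∈ S, f x ≠ 0
  · obtain ⟨x, hx, hfx⟩ := hf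
    refine ⟨S ⊓ LinearMap.ker f, inf_le_left, finrank_le_finrank_inf_ker S f, fun y hy => ?_⟩
    have hy0 : f y = 0 := hy.2
    refine ⟨hy0, ?_⟩
    have := h x hx y hy.1
    rw [hy0, zero_mul] at this
    exact (mul_eq_zero.1 this).resolve_left hfx
  · push Not at hf
    exact ⟨S ⊓ LinearMap.ker g, inf_le_left, finrank_le_finrank_inf_ker S g,
      fun y hy => ⟨hf y hy.1, hy.2⟩⟩

omit [FiniteDimensional ℝ M] in
lemma exists_ne_zero_of_finrank_pos (S : Submodule ℝ M) (h : 1 ≤ Module.finrank ℝ S) :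
    ∃ x ∈ S, x ≠ 0 := by
  by_contra! h0
  have : S = ⊥ := (Submodule.eq_bot_iff S).2 h0
  rw [this, finrank_bot] at h
  omega

end LinearAlgebra

/-! ### Constant-coefficient combinations of commuting fields. -/

section combination

variable {d n : ℕ} {U : Set (J1 d)} {z : J1 d}

/-- The linear form `w ↦ ∑ w_a f_a`. -/
def combo (f : Fin n → ℝ) : (Fin n → ℝ) →ₗ[ℝ] ℝ :=
  ∑ a, f a • LinearMap.proj a

lemma combo_apply (f : Fin n → ℝ) (w : Fin n → ℝ) : combo f w = ∑ a, f a * w a := by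
  simp [combo]

/-- Bilinear extension: vanishing of the 2 × 2 minors on the given fields becomes vanishing of the
wedge product on all their combinations. -/
lemma combo_wedge {f g : Fin n → ℝ} (h : ∀ a b, f a * g b = f b * g a) (v w : Fin n → ℝ) :
    combo f v * combo g w = combo f w * combo g v := by
  simp only [combo_apply, Finset.sum_mul_sum]
  rw [Finset.sum_comm]
  refine Finset.sum_congr rfl fun a _ => Finset.sum_congr rfl fun b _ => ?_
  have := h b a
  linear_combination v b * w a * this

lemma dirD_eq_of_lieBracket {Z Z' : J1 d → J1 d} (hU : IsOpen U) (hZ : ContDiffOn ℝ ∞ Z U)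
    (hZ' : ContDiffOn ℝ ∞ Z' U) (hz : z ∈ U) (h : VectorField.lieBracket ℝ Z Z' z = 0) :
    (∀ k, dirD (Z z) (xiC Z' k) z = dirD (Z' z) (xiC Z k) z) ∧
      dirD (Z z) (etaC Z') z = dirD (Z' z) (etaC Z) z := by
  have h1 : fderiv ℝ Z' z (Z z) = fderiv ℝ Z z (Z' z) := sub_eq_zero.1 h
  refine ⟨fun k => ?_, ?_⟩
  · rw [← fderiv_xiC hU hZ hz, ← fderiv_xiC hU hZ' hz, h1]
  · rw [← fderiv_etaC hU hZ hz, ← fderiv_etaC hU hZ' hz, h1]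

/-- If the combination with coefficients `w` of the fields has vanishing components, then `w = 0`. -/
lemma eq_zero_of_combo {Z : Fin n → J1 d → J1 d} (h : LinearIndependent ℝ fun a => Z a z)
    {w : Fin n → ℝ} (hx : ∀ k, combo (fun a => xiC (Z a) k z) w = 0)
    (hη : combo (fun a => etaC (Z a) z) w = 0)
    (hζ : ∀ k, combo (fun a => zetaC (Z a) k z) w = 0) : w = 0 := by
  have h0 : ∑ a, w a • Z a z = 0 := by
    refine Prod.ext (funext fun k => ?_) (Prod.ext ?_ (funext fun k => ?_))
    · have := hx k
      rw [combo_apply] at this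
      simpa [Prod.fst_sum, xiC, mul_comm] using this
    · rw [combo_apply] at hη
      simpa [Prod.fst_sum, Prod.snd_sum, etaC, mul_comm] using hη
    · have := hζ k
      rw [combo_apply] at this
      simpa [Prod.snd_sum, zetaC, mul_comm] using this
  exact funext fun a => Fintype.linearIndependent_iff.1 h w h0 a

end combination

/-! ### The equation in dimension three -/

section ThreeDim

/-- The linear forms `∑_k ε_{ijk} p_k`. -/
def crossForm (i j : Fin 3) : (Fin 3 → ℝ) →ₗ[ℝ] ℝ :=
  (![![0, LinearMap.proj 2, -LinearMap.proj 1], ![-LinearMap.proj 2, 0, LinearMap.proj 0],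
    ![LinearMap.proj 1, -LinearMap.proj 0, 0]] : Fin 3 → Fin 3 → (Fin 3 → ℝ) →ₗ[ℝ] ℝ) i j

lemma isQuasilinear_veronese3 : veronese3.IsQuasilinear (webCoeff crossForm) := by
  refine isQuasilinear_webCoeff (fun i j p => ?_) fun θ => ?_
  · fin_cases i <;> fin_cases j <;> simp [crossForm]
  · have h10 : θ.2.1 1 0 = θ.2.1 0 1 := θ.2.2 1 0
    have h20 : θ.2.1 2 0 = θ.2.1 0 2 := θ.2.2 2 0
    have h21 : θ.2.1 2 1 = θ.2.1 1 2 := θ.2.2 2 1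
    simp only [veronese3, web, Fin.sum_univ_three, webCoeff, crossForm]
    simp [h10, h20, h21]
    ring

variable {U : Set (J1 3)} {Z : J1 3 → J1 3} {z : J1 3}

lemma webCoeff_crossForm_ne_zero
    (hb : ∀ z ∈ U, (z.1 0 ≠ z.1 1 ∧ z.1 1 ≠ z.1 2 ∧ z.1 2 ≠ z.1 0) ∧
      z.2.2 0 ≠ 0 ∧ z.2.2 1 ≠ 0 ∧ z.2.2 2 ≠ 0) :
    ∀ z ∈ U, ∀ i j, i ≠ j → webCoeff crossForm i j z ≠ 0 := by
  intro z hz i j hij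
  obtain ⟨⟨h1, h2, h3⟩, h4, h5, h6⟩ := hb z hz
  have := sub_ne_zero.2 h1
  have := sub_ne_zero.2 h2
  have := sub_ne_zero.2 h3
  have := sub_ne_zero.2 h1.symm
  have := sub_ne_zero.2 h2.symm
  have := sub_ne_zero.2 h3.symm
  fin_cases i <;> fin_cases j <;> simp [webCoeff, crossForm] at hij ⊢ <;> constructor <;> assumption

variable (hU : IsOpen U) (hb : ∀ z ∈ U, (z.1 0 ≠ z.1 1 ∧ z.1 1 ≠ z.1 2 ∧ z.1 2 ≠ z.1 0) ∧
      z.2.2 0 ≠ 0 ∧ z.2.2 1 ≠ 0 ∧ z.2.2 2 ≠ 0) (hS : veronese3.IsLocalSymmetry U Z)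
include hU hb hS

/-- For fixed i the identity `sum_fibre` involves only the two other components of p. Unit vectors
isolate the x-derivatives of ξ_i; the sum of two of them then isolates the u-derivative, multiplied
by a difference of coordinates. -/
lemma xiC_eq_zero_three (hz : z ∈ U) :
    (∀ i, dirD eu (xiC Z i) z = 0) ∧ ∀ i j, i ≠ j → dirD (ex j) (xiC Z i) z = 0 := by
  have h := fun i p => hS.sum_fibre isQuasilinear_veronese3 hU (webCoeff_crossForm_ne_zero hb)
    le_rfl hz i p
  obtain ⟨⟨h1, h2, h3⟩, -⟩ := hb z hz
  have n1 := sub_ne_zero.2 h1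
  have n2 := sub_ne_zero.2 h2
  have n3 := sub_ne_zero.2 h3
  have a0 := h 0 ![0, 0, 1]
  have a1 := h 0 ![0, 1, 0]
  have a2 := h 0 ![0, 1, 1]
  have b0 := h 1 ![0, 0, 1]
  have b1 := h 1 ![1, 0, 0]
  have b2 := h 1 ![1, 0, 1]
  have c0 := h 2 ![0, 1, 0]
  have c1 := h 2 ![1, 0, 0]
  have c2 := h 2 ![1, 1, 0]
  simp [Fin.sum_univ_three, crossForm] at a0 a1 a2 b0 b1 b2 c0 c1 c2
  have a0' := a0.resolve_left n1
  have a1' := a1.resolve_left (by intro h; apply n3; linarith)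
  have b0' := b0.resolve_left (by intro h; apply n1; linarith)
  have b1' := b1.resolve_left n2
  have c0' := c0.resolve_left n3
  have c1' := c1.resolve_left (by intro h; apply n2; linarith)
  rw [a0', a1'] at a2
  rw [b0', b1'] at b2
  rw [c0', c1'] at c2
  have a2' : (z.1 2 - z.1 1) * dirD eu (xiC Z 0) z = 0 := by linear_combination a2
  have b2' : (z.1 0 - z.1 2) * dirD eu (xiC Z 1) z = 0 := by linear_combination b2
  have c2' : (z.1 1 - z.1 0) * dirD eu (xiC Z 2) z = 0 := by linear_combination c2
  refine ⟨fun i => ?_, fun i j hij => ?_⟩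
  · fin_cases i
    · exact (mul_eq_zero.1 a2').resolve_left (sub_ne_zero.2 h2.symm)
    · exact (mul_eq_zero.1 b2').resolve_left (sub_ne_zero.2 h3.symm)
    · exact (mul_eq_zero.1 c2').resolve_left (sub_ne_zero.2 h1.symm)
  · fin_cases i <;> fin_cases j <;> simp at hij ⊢ <;> assumption

/-- Point symmetries of the equation: affine transformations of `x` together with
transformations of `u`. -/
lemma slopes_three (hz : z ∈ U) :
    (∀ k, dirD (ex k) (etaC Z) z = 0) ∧
      (xiC Z 0 z - xiC Z 1 z) * (z.1 1 - z.1 2) = (xiC Z 1 z - xiC Z 2 z) * (z.1 0 - z.1 1) := by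
  have h := fun i j k l p => hS.fibreCoeff_mul isQuasilinear_veronese3 hU
    (webCoeff_crossForm_ne_zero hb) le_rfl
    (fun z hz => (xiC_eq_zero_three hU hb hS hz).1) hz i j k l p
  have h0 := (xiC_eq_zero_three hU hb hS hz).2
  have h01 := h0 0 1 (by decide)
  have h02 := h0 0 2 (by decide)
  have h10 := h0 1 0 (by decide)
  have h12 := h0 1 2 (by decide)
  have h20 := h0 2 0 (by decide)
  have h21 := h0 2 1 (by decide)
  obtain ⟨⟨h1, h2, h3⟩, -⟩ := hb z hz
  have n1 := sub_ne_zero.2 h1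
  have n2 := sub_ne_zero.2 h2
  have n3 := sub_ne_zero.2 h3
  -- In the first three evaluations one of the two forms c vanishes and the other does not; each
  -- yields one x-derivative of η. The last one then gives the collinearity of the points (x_i,
  -- ξ_i).
  have a0 := h 0 1 1 2 ![1, 0, 0]
  have a1 := h 0 1 1 2 ![0, 0, 1]
  have a2 := h 2 0 1 2 ![1, 0, 0]
  have a3 := h 0 1 1 2 ![1, 0, 1]
  simp [Fin.sum_univ_three, crossForm, fibreCoeff, h01, h02, h10, h12, h20, h21, n1, n2,
    n3] at a0 a1 a2 a3
  rw [a1, a0] at a3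
  refine ⟨fun k => by fin_cases k <;> assumption, ?_⟩
  linear_combination a3

/-- The points (x_i, ξ_i) are collinear and ξ_i depends on no x_j with j ≠ i. Differentiating the
collinearity in each x_i identifies every ∂_i ξ_i with the common slope. -/
lemma xiC_slope_three (hz : z ∈ U) :
    (xiC Z 1 z = xiC Z 0 z + dirD (ex 0) (xiC Z 0) z * (z.1 1 - z.1 0)) ∧
    (xiC Z 2 z = xiC Z 0 z + dirD (ex 0) (xiC Z 0) z * (z.1 2 - z.1 0)) ∧
    dirD (ex 1) (xiC Z 1) z = dirD (ex 0) (xiC Z 0) z ∧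
    dirD (ex 2) (xiC Z 2) z = dirD (ex 0) (xiC Z 0) z := by
  have hd := fun (i : Fin 3) (v : J1 3) =>
    HasDirD.of_contDiffOn (v := v) hU (xiC_contDiffOn hS.field.smooth i) hz
  have h0 := (xiC_eq_zero_three hU hb hS hz).2
  have key := fun v : J1 3 => HasDirD.eq_of_eqOn hU hz
    (fun z hz => (slopes_three hU hb hS hz).2)
    (((hd 0 v).sub (hd 1 v)).mul ((hasDirD_x 1 v z).sub (hasDirD_x 2 v z)))
    (((hd 1 v).sub (hd 2 v)).mul ((hasDirD_x 0 v z).sub (hasDirD_x 1 v z)))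
  have hs := (slopes_three hU hb hS hz).2
  obtain ⟨⟨h1, h2, h3⟩, -⟩ := hb z hz
  have n1 := sub_ne_zero.2 h1
  have n2 := sub_ne_zero.2 h2
  have n3 := sub_ne_zero.2 h3
  have k0 := key (ex 0)
  have k1 := key (ex 1)
  have k2 := key (ex 2)
  simp [h0 0 1 (by decide), h0 0 2 (by decide), h0 1 0 (by decide), h0 1 2 (by decide),
    h0 2 0 (by decide), h0 2 1 (by decide)] at k0 k1 k2
  set r := dirD (ex 0) (xiC Z 0) z
  have s1 : xiC Z 0 z - xiC Z 1 z = r * (z.1 0 - z.1 1) :=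
    mul_right_cancel₀ n2 (by linear_combination hs - (z.1 0 - z.1 1) * k0)
  refine ⟨by linear_combination -s1, by linear_combination -s1 + k0, ?_, ?_⟩
  · refine mul_right_cancel₀ n3 ?_
    linear_combination k1 - s1 + k0
  · refine mul_right_cancel₀ n1 ?_
    linear_combination k2 + s1

omit hS in
theorem not_simplyTransitive_three {Z : Fin 3 → J1 3 → J1 3}
    (hS : ∀ a, veronese3.IsLocalSymmetry U (Z a)) (hz : z ∈ U)
    (hcomm : ∀ a b, VectorField.lieBracket ℝ (Z a) (Z b) z = 0) :
    ¬ LinearIndependent ℝ fun a => Z a z := by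
  intro hli
  have hsm := fun a => (hS a).field.smooth
  have hx := fun a => xiC_eq_zero_three hU hb (hS a) hz
  have hη := fun a => (slopes_three hU hb (hS a) hz).1
  have hsl := fun a => xiC_slope_three hU hb (hS a) hz
  have hηp := fun a => (hS a).etaC_ep isQuasilinear_veronese3 hU
    (webCoeff_crossForm_ne_zero hb) le_rfl hz
  have hξp := fun a => (hS a).xiC_ep isQuasilinear_veronese3 hU
    (webCoeff_crossForm_ne_zero hb) le_rfl hz
  -- Since ξ_0 depends only on x_0, the ξ_0-component of the bracket is a Wronskian in one variable;
  -- the same happens for η as a function of u.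
  have w1 : ∀ a b, xiC (Z a) 0 z * dirD (ex 0) (xiC (Z b) 0) z
      = xiC (Z b) 0 z * dirD (ex 0) (xiC (Z a) 0) z := fun a b => by
    have h := (dirD_eq_of_lieBracket hU (hsm a) (hsm b) hz (hcomm a b)).1 0
    simp only [dirD_eq_sum (Z _ z), Fin.sum_univ_three, (hx _).1, hξp, (hx _).2 0 1 (by decide),
      (hx _).2 0 2 (by decide), mul_zero, add_zero] at h
    exact h
  have w2 : ∀ a b, etaC (Z a) z * dirD eu (etaC (Z b)) z
      = etaC (Z b) z * dirD eu (etaC (Z a)) z := fun a b => by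
    have h := (dirD_eq_of_lieBracket hU (hsm a) (hsm b) hz (hcomm a b)).2
    simp only [dirD_eq_sum (Z _ z), hη, hηp, mul_zero, add_zero, Finset.sum_const_zero,
      zero_add] at h
    exact h
  obtain ⟨S, -, hS1, hS2⟩ := exists_le_of_wedge_eq_zero (⊤ : Submodule ℝ (Fin 3 → ℝ)) _ _
    (fun v _ w _ => combo_wedge w1 v w)
  obtain ⟨T, hTS, hT1, hT2⟩ := exists_le_of_wedge_eq_zero S _ _
    (fun v _ w _ => combo_wedge w2 v w)
  rw [finrank_top, Module.finrank_fin_fun] at hS1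
  -- Two rank-one conditions on a three-dimensional space leave at least a line.
  obtain ⟨w, hw, hw0⟩ := exists_ne_zero_of_finrank_pos T (by omega)
  obtain ⟨e1, e2⟩ := hS2 w (hTS hw)
  obtain ⟨e3, e4⟩ := hT2 w hw
  simp only [combo_apply, Fin.sum_univ_three] at e1 e2 e3 e4
  refine hw0 (eq_zero_of_combo hli (fun k => ?_) ?_ fun k => ?_)
  · simp only [combo_apply, Fin.sum_univ_three]
    fin_cases k
    · exact e1
    · simp only [Fin.mk_one, (hsl _).1]
      linear_combination e1 + (z.1 1 - z.1 0) * e2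
    · simp only [Fin.reduceFinMk, (hsl _).2.1]
      linear_combination e1 + (z.1 2 - z.1 0) * e2
  · simp only [combo_apply, Fin.sum_univ_three]
    exact e3
  · have hζ : ∀ a, zetaC (Z a) k z
        = z.2.2 k * (dirD eu (etaC (Z a)) z - dirD (ex 0) (xiC (Z a) 0) z) := fun a => by
      rw [(hS a).field.zetaC_eq hU hz]
      have h := (hsl a).2.2
      have h' := (hx a).2
      fin_cases k <;> simp [totD, hη, Fin.sum_univ_three, (hx a).1, h.1, h.2, h'] <;> ring
    simp only [combo_apply, Fin.sum_univ_three, hζ]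
    linear_combination z.2.2 k * e4 - z.2.2 k * e2

end ThreeDim

/-! ### The equation in dimension four: determining equations -/

section FourDim

/-- `i, j, k, l` are the four indices in some order. -/
def Distinct4 (i j k l : Fin 4) : Prop := i ≠ j ∧ i ≠ k ∧ i ≠ l ∧ j ≠ k ∧ j ≠ l ∧ k ≠ l

instance (i j k l : Fin 4) : Decidable (Distinct4 i j k l) := by
  unfold Distinct4
  infer_instance

namespace Distinct4

variable {i j k l : Fin 4}

lemma swap12 (h : Distinct4 i j k l) : Distinct4 j i k l :=
  ⟨h.1.symm, h.2.2.2.1, h.2.2.2.2.1, h.2.1, h.2.2.1, h.2.2.2.2.2⟩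

lemma swap23 (h : Distinct4 i j k l) : Distinct4 i k j l :=
  ⟨h.2.1, h.1, h.2.2.1, h.2.2.2.1.symm, h.2.2.2.2.2, h.2.2.2.2.1⟩

lemma swap34 (h : Distinct4 i j k l) : Distinct4 i j l k :=
  ⟨h.1, h.2.2.1, h.2.1, h.2.2.2.2.1, h.2.2.2.1, h.2.2.2.2.2.symm⟩

lemma sum_eq (h : Distinct4 i j k l) (f : Fin 4 → ℝ) : ∑ n, f n = f i + f j + f k + f l := by
  have e : (Finset.univ : Finset (Fin 4)) = {i, j, k, l} := by
    revert i j k l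
    decide
  obtain ⟨h1, h2, h3, h4, h5, h6⟩ := h
  rw [e, Finset.sum_insert (by simp [h1, h2, h3]), Finset.sum_insert (by simp [h4, h5]),
    Finset.sum_insert (by simp [h6]), Finset.sum_singleton]
  ring

lemma exists_of_ne (h : i ≠ j) : ∃ k l, Distinct4 i j k l := by
  revert i j
  decide

lemma exists_of_ne₃ (h1 : i ≠ j) (h2 : i ≠ k) (h3 : j ≠ k) : ∃ l, Distinct4 i j k l := by
  revert i j k
  decide

end Distinct4

variable (a : Fin 4 → ℝ)

/-- The linear form `a_i p_j - a_j p_i`. -/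
def minorForm (i j : Fin 4) : (Fin 4 → ℝ) →ₗ[ℝ] ℝ :=
  a i • LinearMap.proj j - a j • LinearMap.proj i

lemma minorForm_apply (i j : Fin 4) (p : Fin 4 → ℝ) : minorForm a i j p = a i * p j - a j * p i :=
  rfl

/-- The linear forms `½ ∑ ε_{ijlk} (a_l p_k - a_k p_l)`. -/
def dualForm (i j : Fin 4) : (Fin 4 → ℝ) →ₗ[ℝ] ℝ :=
  (![![0, minorForm a 3 2, minorForm a 1 3, minorForm a 2 1],
    ![minorForm a 2 3, 0, minorForm a 3 0, minorForm a 0 2],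
    ![minorForm a 3 1, minorForm a 0 3, 0, minorForm a 1 0],
    ![minorForm a 1 2, minorForm a 2 0, minorForm a 0 1, 0]] :
    Fin 4 → Fin 4 → (Fin 4 → ℝ) →ₗ[ℝ] ℝ) i j

lemma dualForm_antisymm (i j : Fin 4) (p : Fin 4 → ℝ) : dualForm a i j p = - dualForm a j i p := by
  fin_cases i <;> fin_cases j <;> simp [dualForm, minorForm]

lemma isQuasilinear_veronese4 : (veronese4 a).IsQuasilinear (webCoeff (dualForm a)) := by
  refine isQuasilinear_webCoeff (dualForm_antisymm a) fun θ => ?_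
  have h10 : θ.2.1 1 0 = θ.2.1 0 1 := θ.2.2 1 0
  have h20 : θ.2.1 2 0 = θ.2.1 0 2 := θ.2.2 2 0
  have h21 : θ.2.1 2 1 = θ.2.1 1 2 := θ.2.2 2 1
  have h30 : θ.2.1 3 0 = θ.2.1 0 3 := θ.2.2 3 0
  have h31 : θ.2.1 3 1 = θ.2.1 1 3 := θ.2.2 3 1
  have h32 : θ.2.1 3 2 = θ.2.1 2 3 := θ.2.2 3 2
  simp only [veronese4, web, Fin.sum_univ_four, webCoeff, dualForm]
  simp [h10, h20, h21, h30, h31, h32, minorForm_apply]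
  ring

/-- A relabelling of the indices multiplies all six forms by a common sign. Later computations can
therefore be carried out for an arbitrary ordering i, j, k, l. -/
lemma dualForm_eq {i j k l : Fin 4} (h : Distinct4 i j k l) :
    ∃ s : ℝ, s ≠ 0 ∧ dualForm a i j = s • minorForm a l k ∧ dualForm a i k = s • minorForm a j l ∧
      dualForm a i l = s • minorForm a k j ∧ dualForm a j k = s • minorForm a l i ∧
      dualForm a j l = s • minorForm a i k ∧ dualForm a k l = s • minorForm a j i := by
  have hn : ∀ i j, minorForm a i j = (-1 : ℝ) • minorForm a j i := fun i j => by
    ext; simp [minorForm]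
  obtain ⟨h1, h2, h3, h4, h5, h6⟩ := h
  fin_cases i <;> fin_cases j <;> first | exact absurd rfl h1 | skip
  all_goals fin_cases k <;> first | exact absurd rfl h2 | exact absurd rfl h4 | skip
  all_goals
    fin_cases l <;> first | exact absurd rfl h3 | exact absurd rfl h5 | exact absurd rfl h6 | skip
  all_goals first
    | exact ⟨1, one_ne_zero, by rw [one_smul]; rfl, by rw [one_smul]; rfl, by rw [one_smul]; rfl,
        by rw [one_smul]; rfl, by rw [one_smul]; rfl, by rw [one_smul]; rfl⟩
    | exact ⟨-1, by norm_num, by rw [← hn]; rfl, by rw [← hn]; rfl, by rw [← hn]; rfl,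
        by rw [← hn]; rfl, by rw [← hn]; rfl, by rw [← hn]; rfl⟩

variable {a} {U : Set (J1 4)} {Z : J1 4 → J1 4} {z : J1 4}

variable (ha : ∀ i, a i ≠ 0) (hU : IsOpen U)
  (hb : ∀ z ∈ U, ∀ i j, i ≠ j → webCoeff (dualForm a) i j z ≠ 0)
  (hS : (veronese4 a).IsLocalSymmetry U Z)

include hb in
lemma sub_ne_zero_of_mem (hz : z ∈ U) {i j : Fin 4} (h : i ≠ j) : z.1 i - z.1 j ≠ 0 :=
  left_ne_zero_of_mul (hb z hz i j h)

include ha hU hb hS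

/-- The identity `sum_fibre` is tested at unit vectors: p = e_l compares the derivatives along x_j
and x_k, while e_j + e_k minus the values at e_j and e_k isolates the u-derivative. -/
lemma xiC_four {i j k l : Fin 4} (h : Distinct4 i j k l) (hz : z ∈ U) :
    dirD eu (xiC Z i) z = 0 ∧
    (z.1 i - z.1 j) * dirD (ex j) (xiC Z i) z * a k
      = (z.1 i - z.1 k) * dirD (ex k) (xiC Z i) z * a j := by
  have key := fun p => hS.sum_fibre (isQuasilinear_veronese4 a) hU hb (by norm_num) hz i p
  have hT : ∀ p : Fin 4 → ℝ, (z.1 i - z.1 j) * (a l * p k - a k * p l)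
        * (dirD (ex j) (xiC Z i) z + p j * dirD eu (xiC Z i) z)
      + (z.1 i - z.1 k) * (a j * p l - a l * p j)
        * (dirD (ex k) (xiC Z i) z + p k * dirD eu (xiC Z i) z)
      + (z.1 i - z.1 l) * (a k * p j - a j * p k)
        * (dirD (ex l) (xiC Z i) z + p l * dirD eu (xiC Z i) z) = 0 := by
    intro p
    obtain ⟨s, hs, e1, e2, e3, -⟩ := dualForm_eq a h
    have := key p
    rw [h.sum_eq, e1, e2, e3] at this
    simp only [LinearMap.smul_apply, minorForm_apply, smul_eq_mul, sub_self, zero_mul] at this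
    refine (mul_eq_zero.1 ?_).resolve_left hs
    linear_combination this
  obtain ⟨h1, h2, h3, h4, h5, h6⟩ := h
  have t1 := hT (Pi.single j 1)
  have t2 := hT (Pi.single j 1 + Pi.single k 1)
  have t3 := hT (Pi.single k 1)
  have t4 := hT (Pi.single l 1)
  simp [h4, h5, h6, h4.symm, h5.symm, h6.symm] at t1 t2 t3 t4
  constructor
  · have : (a l * (z.1 k - z.1 j)) * dirD eu (xiC Z i) z = 0 := by
      linear_combination t2 - t1 - t3
    exact (mul_eq_zero.1 this).resolve_left
      (mul_ne_zero (ha l) (sub_ne_zero_of_mem hb hz h4.symm))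
  · linear_combination -t4

/-- The component `b_i` of a symmetry, determined by `a_i (x_i - x_j) ∂_j ξ_i = b_i a_j`. -/
def bC (a : Fin 4 → ℝ) (Z : J1 4 → J1 4) (i : Fin 4) (z : J1 4) : ℝ :=
  a i * (z.1 i - z.1 (i + 1)) * dirD (ex (i + 1)) (xiC Z i) z * (a (i + 1))⁻¹

/-- `bC` is defined through the single index i + 1 (cyclically); `xiC_four` shows that any other j ≠
i gives the same value. -/
lemma bC_eq {i j : Fin 4} (hij : i ≠ j) (hz : z ∈ U) :
    a i * (z.1 i - z.1 j) * dirD (ex j) (xiC Z i) z = bC a Z i z * a j := by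
  have h1 := ha (i + 1)
  unfold bC
  rcases eq_or_ne j (i + 1) with rfl | hj
  · field_simp
  · obtain ⟨l, hl⟩ := Distinct4.exists_of_ne₃ hij (k := i + 1) ((by decide : ∀ i : Fin 4, i ≠ i + 1) i) hj
    have := (xiC_four ha hU hb hS hl hz).2
    field_simp
    linear_combination a i * this

lemma dirD_xiC {i j : Fin 4} (hij : i ≠ j) (hz : z ∈ U) :
    dirD (ex j) (xiC Z i) z = bC a Z i z * a j / (a i * (z.1 i - z.1 j)) := by
  have := sub_ne_zero_of_mem hb hz hij
  have := ha i
  rw [eq_div_iff (by positivity), ← bC_eq ha hU hb hS hij hz]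
  ring

omit ha hU hb hS in
-- The form attached to i, j involves only p_k and p_l, with non-zero coefficients. Suitable unit
-- vectors thus switch off one side of `fibreCoeff_mul`.
lemma dualForm_single {i j k l : Fin 4} (h : Distinct4 i j k l) (ha : ∀ i, a i ≠ 0) :
    dualForm a i j (Pi.single i 1) = 0 ∧ dualForm a i j (Pi.single j 1) = 0 ∧
      dualForm a i j (Pi.single k 1) ≠ 0 := by
  obtain ⟨s, hs, e1, -⟩ := dualForm_eq a h
  obtain ⟨h1, h2, h3, h4, h5, h6⟩ := h
  rw [e1]
  simp [minorForm_apply, h2.symm, h3.symm, h4.symm, h5.symm, h6.symm, hs,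
    ha l]

omit ha hU hb hS in
lemma fibreCoeff_add (i j : Fin 4) (p v : Fin 4 → ℝ) :
    fibreCoeff (dualForm a) Z z i j (p + v) = fibreCoeff (dualForm a) Z z i j p
      + fibreCoeff (dualForm a) Z z i j v - fibreCoeff (dualForm a) Z z i j 0 := by
  have := fibreCoeff_add_smul (m := dualForm a) (Z := Z) (z := z) i j p v 1
  rw [one_smul] at this
  rw [this]
  ring

/-- At p = e_i the form for i, j vanishes and the form for k, l does not, so proportionality kills
the coefficient at e_i. The same holds at 2 e_i, and affinity in p then kills its value at 0. -/
lemma fibreCoeff_single {i j k l : Fin 4} (h : Distinct4 i j k l) (hz : z ∈ U) :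
    fibreCoeff (dualForm a) Z z i j 0 = 0 ∧ fibreCoeff (dualForm a) Z z i j (Pi.single i 1) = 0 ∧
      fibreCoeff (dualForm a) Z z i j (Pi.single j 1) = 0 := by
  have key := hS.fibreCoeff_mul (isQuasilinear_veronese4 a) hU hb (by norm_num)
    (fun z hz i => by
      obtain ⟨l, k, m, hl⟩ := (by decide : ∀ i : Fin 4, ∃ j k l, Distinct4 i j k l) i
      exact (xiC_four ha hU hb hS hl hz).1) hz i j k l
  obtain ⟨h1, -, -⟩ := dualForm_single h ha
  obtain ⟨-, h2, -⟩ := dualForm_single h ha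
  have h3 := (dualForm_single (h.swap23.swap34.swap12.swap23) ha).2.2
  have h4 := (dualForm_single (h.swap23.swap34.swap12.swap23.swap34) ha).2.2
  have hx := sub_ne_zero_of_mem hb hz h.2.2.2.2.2
  have k1 := key (Pi.single i 1)
  have k2 := key (Pi.single i 1 + Pi.single i 1)
  have k3 := key (Pi.single j 1)
  rw [h1, mul_zero, mul_zero] at k1
  rw [map_add, map_add, h1, add_zero, mul_zero, mul_zero, fibreCoeff_add] at k2
  rw [h2, mul_zero, mul_zero] at k3
  have f1 := (mul_eq_zero.1 k1).resolve_right (mul_ne_zero hx h3)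
  have f3 := (mul_eq_zero.1 k3).resolve_right (mul_ne_zero hx h4)
  have f2 := (mul_eq_zero.1 k2).resolve_right (mul_ne_zero hx (by
    rw [← two_mul]; exact mul_ne_zero two_ne_zero h3))
  rw [f1] at f2
  exact ⟨by linarith, f1, f3⟩

/-- At p = 0 only the x-gradient of η survives in `fibreCoeff`, as (x_i - x_j) m_ij(∂_x η). -/
lemma etaC_four {k l : Fin 4} (h : k ≠ l) (hz : z ∈ U) :
    dirD (ex k) (etaC Z) z * a l = dirD (ex l) (etaC Z) z * a k := by
  obtain ⟨i, j, h⟩ := Distinct4.exists_of_ne h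
  replace h := h.swap23.swap34.swap12.swap23
  have h0 := (fibreCoeff_single ha hU hb hS h hz).1
  obtain ⟨s, hs, e1, -⟩ := dualForm_eq a h
  unfold fibreCoeff at h0
  simp only [e1, map_zero, mul_zero, zero_mul, add_zero, Finset.sum_const_zero, sub_zero, zero_add,
    Pi.zero_apply, LinearMap.smul_apply, minorForm_apply, smul_eq_mul] at h0
  have := (mul_eq_zero.1 ((mul_eq_zero.1 h0).resolve_left
    (sub_ne_zero_of_mem hb hz h.1))).resolve_left hs
  linear_combination this

/-- The factor m_ij(e_k) is split off so that ratios of coefficients can be compared. Off-diagonal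
derivatives of ξ have been expressed through the b_n. -/
lemma fibreCoeff_four {i j k l : Fin 4} (h : Distinct4 i j k l) (hz : z ∈ U) :
    fibreCoeff (dualForm a) Z z i j (Pi.single k 1) = dualForm a i j (Pi.single k 1) *
      ((xiC Z i z - xiC Z j z) + (z.1 i - z.1 j) * (dirD eu (etaC Z) z - dirD (ex k) (xiC Z k) z
        + bC a Z k z / (z.1 k - z.1 l) - dirD (ex i) (xiC Z i) z - dirD (ex j) (xiC Z j) z)
        + (z.1 i - z.1 l) * bC a Z j z / (z.1 j - z.1 l)
        - (z.1 j - z.1 l) * bC a Z i z / (z.1 i - z.1 l)) := by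
  obtain ⟨s, hs, e1, e2, e3, e4, e5, e6⟩ := dualForm_eq a h
  have e1' : ∀ p, dualForm a j i p = - (s * minorForm a l k p) := fun p => by
    rw [dualForm_antisymm, e1]; rfl
  have hη := etaC_four ha hU hb hS h.2.2.2.2.2 hz
  have hx := fun {i j : Fin 4} (hij : i ≠ j) => sub_ne_zero_of_mem hb hz hij
  have hD := fun {i j : Fin 4} (hij : i ≠ j) => dirD_xiC ha hU hb hS hij hz
  obtain ⟨h1, h2, h3, h4, h5, h6⟩ := h
  have hal := ha l
  have hak := ha k
  have haj := ha j
  have hai := ha i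
  have x1 := hx h3
  have x2 := hx h5
  have x3 := hx h6
  unfold fibreCoeff
  rw [Distinct4.sum_eq (⟨h1, h2, h3, h4, h5, h6⟩ : Distinct4 i j k l)]
  simp only [e1, e1', e2, e3, e4, e5, LinearMap.smul_apply, minorForm_apply, smul_eq_mul]
  rw [hD h3, hD h5]
  simp [h2, h4, h6.symm, Pi.single_apply]
  rw [hD h6]
  field_simp
  linear_combination (z.1 i - z.1 j) * (z.1 i - z.1 l) * (z.1 j - z.1 l) * (z.1 k - z.1 l) * hη

/-- The pairs (i, j) and (k, l) are compared at e_i + e_k and e_i + e_l. The ratio for (k, l) is the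
same at both points, so the ratio for (i, j) at e_k equals the one at e_l. -/
lemma sum_four {i j k l : Fin 4} (h : Distinct4 i j k l) (hz : z ∈ U) :
    dirD (ex k) (xiC Z k) z + bC a Z i z / (z.1 i - z.1 k) + bC a Z j z / (z.1 j - z.1 k)
      + bC a Z l z / (z.1 l - z.1 k) = dirD (ex l) (xiC Z l) z + bC a Z i z / (z.1 i - z.1 l)
      + bC a Z j z / (z.1 j - z.1 l) + bC a Z k z / (z.1 k - z.1 l) := by
  have key := hS.fibreCoeff_mul (isQuasilinear_veronese4 a) hU hb (by norm_num)
    (fun z hz i => by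
      obtain ⟨l, k, m, hl⟩ := (by decide : ∀ i : Fin 4, ∃ j k l, Distinct4 i j k l) i
      exact (xiC_four ha hU hb hS hl hz).1) hz i j k l
  have hx := fun {i j : Fin 4} (hij : i ≠ j) => sub_ne_zero_of_mem hb hz hij
  obtain ⟨f0, f1, f2⟩ := fibreCoeff_single ha hU hb hS h hz
  obtain ⟨g0, g1, g2⟩ := fibreCoeff_single ha hU hb hS h.swap23.swap34.swap12.swap23 hz
  obtain ⟨d1, d2, d3⟩ := dualForm_single h ha
  have d4 := (dualForm_single h.swap34 ha).2.2
  obtain ⟨c1, c2, c3⟩ := dualForm_single h.swap23.swap34.swap12.swap23 ha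
  have k1 := key (Pi.single i 1 + Pi.single k 1)
  have k2 := key (Pi.single i 1 + Pi.single l 1)
  rw [fibreCoeff_add, fibreCoeff_add, map_add, map_add, f0, f1, g0, g1, d1, c1] at k1
  rw [fibreCoeff_add, fibreCoeff_add, map_add, map_add, f0, f1, g0, g2, d1, c2] at k2
  rw [fibreCoeff_four ha hU hb hS h hz] at k1
  rw [fibreCoeff_four ha hU hb hS h.swap34 hz] at k2
  have x1 := hx h.1
  have x2 := hx h.2.1
  have x3 := hx h.2.2.1
  have x4 := hx h.2.2.2.1
  have x5 := hx h.2.2.2.2.1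
  have x6 := hx h.2.2.2.2.2
  have x7 := hx h.2.2.2.2.2.symm
  have x8 := hx h.2.1.symm
  have x9 := hx h.2.2.1.symm
  have x10 := hx h.2.2.2.1.symm
  have x11 := hx h.2.2.2.2.1.symm
  have e := mul_left_cancel₀ (mul_ne_zero (mul_ne_zero d3 d4) (mul_ne_zero x6 c3))
    (b := (xiC Z i z - xiC Z j z) + (z.1 i - z.1 j) * (dirD eu (etaC Z) z - dirD (ex k) (xiC Z k) z
        + bC a Z k z / (z.1 k - z.1 l) - dirD (ex i) (xiC Z i) z - dirD (ex j) (xiC Z j) z)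
        + (z.1 i - z.1 l) * bC a Z j z / (z.1 j - z.1 l)
        - (z.1 j - z.1 l) * bC a Z i z / (z.1 i - z.1 l))
    (c := (xiC Z i z - xiC Z j z) + (z.1 i - z.1 j) * (dirD eu (etaC Z) z - dirD (ex l) (xiC Z l) z
        + bC a Z l z / (z.1 l - z.1 k) - dirD (ex i) (xiC Z i) z - dirD (ex j) (xiC Z j) z)
        + (z.1 i - z.1 k) * bC a Z j z / (z.1 j - z.1 k)
        - (z.1 j - z.1 k) * bC a Z i z / (z.1 i - z.1 k)) (by
      generalize dualForm a i j (Pi.single k 1) = D at *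
      generalize dualForm a i j (Pi.single l 1) = E at *
      linear_combination E * k1 - D * k2)
  refine mul_left_cancel₀ x1 ?_
  have r1 : bC a Z i z * (z.1 j - z.1 l) / (z.1 i - z.1 l)
      = bC a Z i z - (z.1 i - z.1 j) * (bC a Z i z / (z.1 i - z.1 l)) := by field_simp; ring
  have r2 : bC a Z i z * (z.1 j - z.1 k) / (z.1 i - z.1 k)
      = bC a Z i z - (z.1 i - z.1 j) * (bC a Z i z / (z.1 i - z.1 k)) := by field_simp; ring
  have r3 : bC a Z j z * (z.1 i - z.1 l) / (z.1 j - z.1 l)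
      = bC a Z j z + (z.1 i - z.1 j) * (bC a Z j z / (z.1 j - z.1 l)) := by field_simp; ring
  have r4 : bC a Z j z * (z.1 i - z.1 k) / (z.1 j - z.1 k)
      = bC a Z j z + (z.1 i - z.1 j) * (bC a Z j z / (z.1 j - z.1 k)) := by field_simp; ring
  rw [mul_comm _ (bC a Z i z), mul_comm _ (bC a Z j z), mul_comm _ (bC a Z i z),
    mul_comm _ (bC a Z j z), r1, r2, r3, r4] at e
  linear_combination -e

/-- The points (x_i, ξ_i - b_i) are collinear: the pairs (i, j) and (i, k) are compared at e_j +
e_k, and the diagonal derivatives are eliminated with `sum_four`. -/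
lemma xiC_sub_bC {i j k l : Fin 4} (h : Distinct4 i j k l) (hz : z ∈ U) :
    ((xiC Z i z - bC a Z i z) - (xiC Z j z - bC a Z j z)) * (z.1 i - z.1 k)
      = ((xiC Z i z - bC a Z i z) - (xiC Z k z - bC a Z k z)) * (z.1 i - z.1 j) := by
  have key := hS.fibreCoeff_mul (isQuasilinear_veronese4 a) hU hb (by norm_num)
    (fun z hz i => by
      obtain ⟨l, k, m, hl⟩ := (by decide : ∀ i : Fin 4, ∃ j k l, Distinct4 i j k l) i
      exact (xiC_four ha hU hb hS hl hz).1) hz i j i k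
  have hx := fun {i j : Fin 4} (hij : i ≠ j) => sub_ne_zero_of_mem hb hz hij
  obtain ⟨f0, f1, f2⟩ := fibreCoeff_single ha hU hb hS h hz
  obtain ⟨g0, g1, g2⟩ := fibreCoeff_single ha hU hb hS h.swap23 hz
  obtain ⟨d1, d2, d3⟩ := dualForm_single h ha
  obtain ⟨c1, c2, c3⟩ := dualForm_single h.swap23 ha
  have k1 := key (Pi.single k 1 + Pi.single j 1)
  rw [fibreCoeff_add, fibreCoeff_add, map_add, map_add, f0, f2, g0, g2, d2, c2,
    fibreCoeff_four ha hU hb hS h hz, fibreCoeff_four ha hU hb hS h.swap23 hz] at k1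
  have hs := sum_four ha hU hb hS h.swap23.swap34.swap12.swap23.swap34.swap23.swap34 hz
  have x1 := hx h.1
  have x2 := hx h.2.1
  have x3 := hx h.2.2.1
  have x4 := hx h.2.2.2.1
  have x5 := hx h.2.2.2.2.1
  have x6 := hx h.2.2.2.2.2
  have x10 := hx h.2.2.2.1.symm
  generalize dualForm a i j (Pi.single k 1) = D at *
  generalize dualForm a i k (Pi.single j 1) = E at *
  have e := mul_left_cancel₀ (mul_ne_zero d3 c3)
    (b := ((xiC Z i z - xiC Z j z) + (z.1 i - z.1 j) * (dirD eu (etaC Z) z - dirD (ex k) (xiC Z k) z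
        + bC a Z k z / (z.1 k - z.1 l) - dirD (ex i) (xiC Z i) z - dirD (ex j) (xiC Z j) z)
        + (z.1 i - z.1 l) * bC a Z j z / (z.1 j - z.1 l)
        - (z.1 j - z.1 l) * bC a Z i z / (z.1 i - z.1 l)) * (z.1 i - z.1 k))
    (c := ((xiC Z i z - xiC Z k z) + (z.1 i - z.1 k) * (dirD eu (etaC Z) z - dirD (ex j) (xiC Z j) z
        + bC a Z j z / (z.1 j - z.1 l) - dirD (ex i) (xiC Z i) z - dirD (ex k) (xiC Z k) z)
        + (z.1 i - z.1 l) * bC a Z k z / (z.1 k - z.1 l)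
        - (z.1 k - z.1 l) * bC a Z i z / (z.1 i - z.1 l)) * (z.1 i - z.1 j))
    (by linear_combination k1)
  have r1 : bC a Z i z * (z.1 j - z.1 l) / (z.1 i - z.1 l)
      = bC a Z i z - (z.1 i - z.1 j) * (bC a Z i z / (z.1 i - z.1 l)) := by field_simp; ring
  have r2 : bC a Z i z * (z.1 k - z.1 l) / (z.1 i - z.1 l)
      = bC a Z i z - (z.1 i - z.1 k) * (bC a Z i z / (z.1 i - z.1 l)) := by field_simp; ring
  have r3 : bC a Z j z * (z.1 i - z.1 l) / (z.1 j - z.1 l)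
      = bC a Z j z + (z.1 i - z.1 j) * (bC a Z j z / (z.1 j - z.1 l)) := by field_simp; ring
  have r4 : bC a Z k z * (z.1 i - z.1 l) / (z.1 k - z.1 l)
      = bC a Z k z + (z.1 i - z.1 k) * (bC a Z k z / (z.1 k - z.1 l)) := by field_simp; ring
  rw [mul_comm _ (bC a Z i z), mul_comm _ (bC a Z j z), mul_comm _ (bC a Z i z),
    mul_comm _ (bC a Z k z), r1, r2, r3, r4] at e
  linear_combination e

end FourDim

section Quotient

variable {E : Type*} [NormedAddCommGroup E] [NormedSpace ℝ E] {z v : E} {f g : E → ℝ} {a b : ℝ}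

lemma HasDirD.div (hf : HasDirD f a v z) (hg : HasDirD g b v z) (h : g z ≠ 0) :
    HasDirD (fun z => f z / g z) (a / g z - f z * b / g z ^ 2) v z := by
  have hi : HasDirD (fun z => (g z)⁻¹) (-b / g z ^ 2) v z := by
    have := HasFDerivAt.hasDirD (v := v) ((hasDerivAt_inv h).comp_hasFDerivAt z hg.hasFDerivAt)
    rw [smul_apply, show fderiv ℝ g z v = b from hg.2, smul_eq_mul] at this
    exact (by ring : -(g z ^ 2)⁻¹ * b = -b / g z ^ 2) ▸ this
  have := hf.mul hi
  rw [show a * (g z)⁻¹ + f z * (-b / g z ^ 2) = a / g z - f z * b / g z ^ 2 by ring] at this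
  simpa only [div_eq_mul_inv] using this

end Quotient

/-! ### Dimension four: the normal form ξ_i = b_i + α x_i + β. -/

section FourDim

variable {a : Fin 4 → ℝ}

/-- This will be applied to the x-derivatives of α and β. The hypothesis makes the affine function
α_k x + β_k equal to w_j a_k (x_j - x_n)(x_j - x_m) at x = x_j, for all orderings j, k, n, m. Its
second divided difference at the three nodes other than x_k vanishes, so any three of the w_j sum to
zero; hence all w_j = 0, and an affine function with two zeros is zero. -/
lemma slopes_eq_zero {x α β : Fin 4 → ℝ} (hx : ∀ i j, i ≠ j → x i - x j ≠ 0) (ha : ∀ i, a i ≠ 0)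
    (h : ∀ i j k l, Distinct4 i j k l → (α i * x j + β i) * a k * (x j - x i)
      = (α k * x j + β k) * a i * (x j - x k)) (k : Fin 4) : α k = 0 ∧ β k = 0 := by
  have key : ∀ j, ∃ w, ∀ k n m, Distinct4 j k n m →
      α k * x j + β k = w * a k * (x j - x n) * (x j - x m) := by
    intro j
    obtain ⟨k, n, m, h0⟩ := (by decide : ∀ i : Fin 4, ∃ j k l, Distinct4 i j k l) j
    have n1 := hx _ _ h0.1
    have n2 := hx _ _ h0.2.1
    have n3 := hx _ _ h0.2.2.1
    have n4 := ha k
    refine ⟨(α k * x j + β k) / (a k * (x j - x n) * (x j - x m)), fun k' n' m' h' => ?_⟩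
    have hk : k' = k ∨ k' = n ∨ k' = m := by
      clear h n1 n2 n3 n4
      revert j k n m k' n' m'
      decide
    rcases hk with rfl | rfl | rfl
    · have : n' = n ∧ m' = m ∨ n' = m ∧ m' = n := by
        clear h n1 n2 n3 n4
        revert j k' n m n' m'
        decide
      rcases this with ⟨rfl, rfl⟩ | ⟨rfl, rfl⟩ <;> field_simp
    · have := h _ _ _ _ h0.swap12
      have e : n' = k ∧ m' = m ∨ n' = m ∧ m' = k := by
        clear h this n1 n2 n3 n4
        revert j k' k m n' m'
        decide
      rcases e with ⟨rfl, rfl⟩ | ⟨rfl, rfl⟩ <;> field_simp <;> linear_combination -this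
    · have := h _ _ _ _ h0.swap12.swap34
      have e : n' = k ∧ m' = n ∨ n' = n ∧ m' = k := by
        clear h this n1 n2 n3 n4
        revert j k' k n n' m'
        decide
      rcases e with ⟨rfl, rfl⟩ | ⟨rfl, rfl⟩ <;> field_simp <;> linear_combination -this
  choose w hw using key
  have hsum : ∀ k i j l, Distinct4 k i j l → w i + w j + w l = 0 := by
    intro k i j l h0
    have e1 := hw i k j l h0.swap12
    have e2 := hw j k i l h0.swap23.swap12
    have e3 := hw l k i j h0.swap34.swap23.swap12
    have : (a k * ((x i - x j) * (x i - x l) * (x j - x l))) * (w i + w j + w l) = 0 := by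
      linear_combination -(x j - x l) * e1 - (x l - x i) * e2 - (x i - x j) * e3
    exact (mul_eq_zero.1 this).resolve_left (mul_ne_zero (ha k) (mul_ne_zero (mul_ne_zero
      (hx _ _ h0.2.2.2.1) (hx _ _ h0.2.2.2.2.1)) (hx _ _ h0.2.2.2.2.2)))
  have hw0 : ∀ i, w i = 0 := by
    have h0 := hsum 0 1 2 3 (by decide)
    have h1 := hsum 1 0 2 3 (by decide)
    have h2 := hsum 2 0 1 3 (by decide)
    have h3 := hsum 3 0 1 2 (by decide)
    intro i
    fin_cases i <;> simp only [Fin.zero_eta, Fin.mk_one, Fin.reduceFinMk] <;> linarith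
  obtain ⟨i, j, l, h0⟩ := (by decide : ∀ i : Fin 4, ∃ j k l, Distinct4 i j k l) k
  have e1 := hw i k j l h0.swap12
  have e2 := hw j k i l h0.swap23.swap12
  rw [hw0] at e1 e2
  have : (x i - x j) * α k = 0 := by linear_combination e1 - e2
  have hα := (mul_eq_zero.1 this).resolve_left (hx _ _ h0.2.2.2.1)
  refine ⟨hα, ?_⟩
  rw [hα] at e1
  linarith

variable {U : Set (J1 4)} {Z : J1 4 → J1 4} {z : J1 4}

/-- The coefficient `α` in `ξ_i = b_i + α x_i + β`. -/
def slopeC (a : Fin 4 → ℝ) (Z : J1 4 → J1 4) (z : J1 4) : ℝ :=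
  ((xiC Z 0 z - bC a Z 0 z) - (xiC Z 1 z - bC a Z 1 z)) / (z.1 0 - z.1 1)
/-- The coefficient `β` in `ξ_i = b_i + α x_i + β`. -/
def shiftC (a : Fin 4 → ℝ) (Z : J1 4 → J1 4) (z : J1 4) : ℝ :=
  xiC Z 0 z - bC a Z 0 z - slopeC a Z z * z.1 0

/-- The function `S = ∂_l ξ_l + ∑_{n ≠ l} b_n / (x_n - x_l)`, which does not depend on `l`. -/
def traceC (a : Fin 4 → ℝ) (Z : J1 4 → J1 4) (z : J1 4) : ℝ :=
  dirD (ex 0) (xiC Z 0) z + ∑ n, bC a Z n z / (z.1 n - z.1 0)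

variable (ha : ∀ i, a i ≠ 0) (hU : IsOpen U)
  (hb : ∀ z ∈ U, ∀ i j, i ≠ j → webCoeff (dualForm a) i j z ≠ 0)
  (hS : (veronese4 a).IsLocalSymmetry U Z)

section smooth
include hU hS

lemma bC_contDiffOn (i : Fin 4) : ContDiffOn ℝ ∞ (bC a Z i) U := by
  have h := dirD_contDiffOn hU (xiC_contDiffOn hS.field.smooth i) (ex (i + 1))
  unfold bC
  have hx : ContDiffOn ℝ ∞ (fun z : J1 4 => a i * (z.1 i - z.1 (i + 1))) U := by fun_prop
  exact (hx.mul h).mul contDiffOn_const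

include hb

lemma slopeC_contDiffOn : ContDiffOn ℝ ∞ (slopeC a Z) U := by
  have h := fun i => xiC_contDiffOn hS.field.smooth i
  have h' := fun i => bC_contDiffOn hU hS i
  exact (((h 0).sub (h' 0)).sub ((h 1).sub (h' 1))).div (by fun_prop)
    fun z hz => sub_ne_zero_of_mem hb hz (by decide)

lemma shiftC_contDiffOn : ContDiffOn ℝ ∞ (shiftC a Z) U := by
  have h := fun i => xiC_contDiffOn hS.field.smooth i
  have h' := fun i => bC_contDiffOn hU hS i
  exact ((h 0).sub (h' 0)).sub ((slopeC_contDiffOn hU hb hS).mul (by fun_prop))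

lemma traceC_contDiffOn : ContDiffOn ℝ ∞ (traceC a Z) U := by
  have h := dirD_contDiffOn hU (xiC_contDiffOn hS.field.smooth 0) (ex 0)
  have h' := fun i => bC_contDiffOn hU hS i
  refine h.add (ContDiffOn.sum fun n _ => ?_)
  rcases eq_or_ne n 0 with rfl | hn
  · simp [contDiffOn_const]
  · exact (h' n).div (by fun_prop) fun z hz => sub_ne_zero_of_mem hb hz hn

end smooth

include ha hU hb hS

/-- By `xiC_sub_bC` the points (x_i, ξ_i - b_i) lie on the line through the first two of them. -/
lemma xiC_eq (i : Fin 4) (hz : z ∈ U) :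
    xiC Z i z = bC a Z i z + slopeC a Z z * z.1 i + shiftC a Z z := by
  have h01 := sub_ne_zero_of_mem hb hz (by decide : (0 : Fin 4) ≠ 1)
  unfold shiftC slopeC
  have e2 := xiC_sub_bC ha hU hb hS (by decide : Distinct4 0 1 2 3) hz
  have e3 := xiC_sub_bC ha hU hb hS (by decide : Distinct4 0 1 3 2) hz
  fin_cases i <;> simp only [Fin.zero_eta, Fin.mk_one, Fin.reduceFinMk] <;> field_simp
  · ring
  · ring
  · linear_combination e2
  · linear_combination e3

lemma traceC_eq (l : Fin 4) (hz : z ∈ U) :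
    traceC a Z z = dirD (ex l) (xiC Z l) z + ∑ n, bC a Z n z / (z.1 n - z.1 l) := by
  unfold traceC
  rcases eq_or_ne l 0 with rfl | hl
  · rfl
  · obtain ⟨i, j, h⟩ := Distinct4.exists_of_ne hl.symm
    have := sum_four ha hU hb hS h.swap23.swap34.swap12.swap23 hz
    rw [h.sum_eq, h.sum_eq]
    -- The term n = l has denominator 0 and counts as 0, so the sum really runs over n ≠ l.
    simp only [sub_self, div_zero]
    linear_combination this

omit ha in
lemma dirD_xiC_ep (i l : Fin 4) (hz : z ∈ U) : dirD (ep l) (xiC Z i) z = 0 :=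
  hS.xiC_ep (isQuasilinear_veronese4 a) hU hb (by norm_num) hz i l

lemma dirD_xiC_eu (i : Fin 4) (hz : z ∈ U) : dirD eu (xiC Z i) z = 0 := by
  obtain ⟨l, k, m, hl⟩ := (by decide : ∀ i : Fin 4, ∃ j k l, Distinct4 i j k l) i
  exact (xiC_four ha hU hb hS hl hz).1


lemma dirD_xiC_eq (i : Fin 4) (v : J1 4) (hz : z ∈ U) :
    dirD v (xiC Z i) z = dirD v (bC a Z i) z + (dirD v (slopeC a Z) z * z.1 i
      + slopeC a Z z * v.1 i) + dirD v (shiftC a Z) z :=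
  HasDirD.eq_of_eqOn hU hz (fun _ hz => xiC_eq ha hU hb hS i hz)
    (HasDirD.of_contDiffOn hU (xiC_contDiffOn hS.field.smooth i) hz)
    (((HasDirD.of_contDiffOn hU (bC_contDiffOn hU hS i) hz).add
      ((HasDirD.of_contDiffOn hU (slopeC_contDiffOn hU hb hS) hz).mul (hasDirD_x i v z))).add
      (HasDirD.of_contDiffOn hU (shiftC_contDiffOn hU hb hS) hz))

lemma dirD_dirD_xiC {i j : Fin 4} (hij : i ≠ j) (v : J1 4) (hz : z ∈ U) :
    a i * (v.1 i - v.1 j) * dirD (ex j) (xiC Z i) z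
      + a i * (z.1 i - z.1 j) * dirD (ex j) (dirD v (xiC Z i)) z = dirD v (bC a Z i) z * a j := by
  have hξ := xiC_contDiffOn hS.field.smooth i
  have h := HasDirD.eq_of_eqOn (v := v) hU hz (fun z hz => bC_eq ha hU hb hS hij hz)
    (((HasDirD.const (a i)).mul ((hasDirD_x i v z).sub (hasDirD_x j v z))).mul
      (HasDirD.of_contDiffOn hU (dirD_contDiffOn hU hξ (ex j)) hz))
    ((HasDirD.of_contDiffOn hU (bC_contDiffOn hU hS i) hz).mul (HasDirD.const (a j)))
  rw [dirD_comm hU hξ hz] at h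
  linear_combination h

/-- Vertical directions do not move x, so b_i inherits the independence of ξ_i through its defining
relation. -/
lemma dirD_bC_vertical {i : Fin 4} {v : J1 4} (hv : v.1 = 0)
    (h : ∀ z ∈ U, dirD v (xiC Z i) z = 0) (hz : z ∈ U) : dirD v (bC a Z i) z = 0 := by
  have hij := (by decide : ∀ i : Fin 4, i ≠ i + 1) i
  have := dirD_dirD_xiC ha hU hb hS hij v hz
  rw [dirD_eq_zero_of_eqOn hU hz h, hv] at this
  simp only [Pi.zero_apply, sub_self, mul_zero, zero_mul, zero_add] at this
  exact (mul_eq_zero.1 this.symm).resolve_right (ha _)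

/-- Vertical derivatives vanish because those of ξ and b do. For horizontal ones, the two defining
relations of b_j with indices i and k are differentiated crosswise; symmetry of ∂_i ∂_k ξ_j gives
the hypothesis of `slopes_eq_zero`. -/
lemma dirD_slopeC (v : J1 4) (hz : z ∈ U) :
    dirD v (slopeC a Z) z = 0 ∧ dirD v (shiftC a Z) z = 0 := by
  have hx := fun {i j : Fin 4} (hij : i ≠ j) => sub_ne_zero_of_mem hb hz hij
  have hvert : ∀ v : J1 4, v.1 = 0 → (∀ i, ∀ z ∈ U, dirD v (xiC Z i) z = 0) →
      dirD v (slopeC a Z) z = 0 ∧ dirD v (shiftC a Z) z = 0 := by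
    intro v hv h
    have e := fun i => dirD_xiC_eq ha hU hb hS i v hz
    have e0 := e 0
    have e1 := e 1
    rw [h _ z hz, dirD_bC_vertical ha hU hb hS hv (h _) hz, hv] at e0 e1
    simp only [Pi.zero_apply, mul_zero, add_zero, zero_add] at e0 e1
    have e2 : dirD v (slopeC a Z) z * (z.1 0 - z.1 1) = 0 := by linear_combination e1 - e0
    have e3 := (mul_eq_zero.1 e2).resolve_right (hx (by decide))
    refine ⟨e3, ?_⟩
    rw [e3] at e0
    linarith
  have hu := hvert eu rfl fun i _ hz => dirD_xiC_eu ha hU hb hS i hz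
  have hp := fun l => hvert (ep l) rfl fun i _ hz => dirD_xiC_ep hU hb hS i l hz
  have hxx := slopes_eq_zero (x := z.1) (a := a) (α := fun k => dirD (ex k) (slopeC a Z) z)
    (β := fun k => dirD (ex k) (shiftC a Z) z) (fun i j hij => hx hij) ha (by
      intro i j k l h
      have hji := h.1.symm
      have hjk := h.2.2.2.1
      have hik := h.2.1
      have hξ := xiC_contDiffOn hS.field.smooth j
      have e1 := dirD_xiC_eq ha hU hb hS j (ex i) hz
      have e2 := dirD_xiC_eq ha hU hb hS j (ex k) hz
      have e3 := bC_eq ha hU hb hS hji hz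
      have e4 := bC_eq ha hU hb hS hjk hz
      have e5 := dirD_dirD_xiC ha hU hb hS hji (ex k) hz
      have e6 := dirD_dirD_xiC ha hU hb hS hjk (ex i) hz
      rw [dirD_comm hU hξ hz] at e5
      simp only [ex_fst, hji, hjk, hik, hik.symm, if_false, sub_self, mul_zero, zero_mul,
        add_zero, zero_add] at e1 e2 e5 e6
      refine mul_left_cancel₀ (ha j) ?_
      linear_combination (-a j * a k * (z.1 j - z.1 i)) * e1 + a j * a i * (z.1 j - z.1 k) * e2
        + a k * e3 - a i * e4 - a j * (z.1 j - z.1 k) * e5 + a j * (z.1 j - z.1 i) * e6)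
  rw [dirD_eq_sum v (slopeC a Z), dirD_eq_sum v (shiftC a Z)]
  simp only [hu.1, hu.2, (hp _).1, (hp _).2, (hxx _).1, (hxx _).2]
  simp

/-- With α and β constant, ∂_k b_j = ∂_k ξ_j. Together with `dirD_bC_self` this is a closed
first-order system for b in terms of b and S - α. -/
lemma dirD_bC {j k : Fin 4} (hjk : j ≠ k) (hz : z ∈ U) :
    dirD (ex k) (bC a Z j) z = bC a Z j z * a k / (a j * (z.1 j - z.1 k)) := by
  rw [← dirD_xiC ha hU hb hS hjk hz, dirD_xiC_eq ha hU hb hS j (ex k) hz,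
    (dirD_slopeC ha hU hb hS _ hz).1, (dirD_slopeC ha hU hb hS _ hz).2]
  simp [hjk]

lemma dirD_bC_self (j : Fin 4) (hz : z ∈ U) :
    dirD (ex j) (bC a Z j) z
      = traceC a Z z - slopeC a Z z - ∑ n, bC a Z n z / (z.1 n - z.1 j) := by
  have := dirD_xiC_eq ha hU hb hS j (ex j) hz
  rw [(dirD_slopeC ha hU hb hS _ hz).1, (dirD_slopeC ha hU hb hS _ hz).2] at this
  rw [traceC_eq ha hU hb hS j hz, this]
  simp only [ex_fst, if_true]
  ring

end FourDim

/-! ### The line conditions and the determinant that makes them independent. -/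

section FourDim

/-- The linear forms `(δ, b) ↦ s_k δ + ∑_n (s_n - s_k) / (x_n - x_k) b_n`. -/
def webV (x s : Fin 4 → ℝ) (k : Fin 4) : ℝ × (Fin 4 → ℝ) →ₗ[ℝ] ℝ :=
  s k • LinearMap.fst ℝ ℝ _
    + ∑ n, ((s n - s k) / (x n - x k)) • (LinearMap.proj n ∘ₗ LinearMap.snd ℝ ℝ (Fin 4 → ℝ))

lemma webV_apply (x s : Fin 4 → ℝ) (k : Fin 4) (w : ℝ × (Fin 4 → ℝ)) :
    webV x s k w = s k * w.1 + ∑ n, ((s n - s k) / (x n - x k)) * w.2 n := by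
  simp [webV]

/-- The divided differences `(V_k - V_l) / (x_k - x_l)` of the forms `webV`, and their confluent
version at `k = l`. -/
def webLine (x s : Fin 4 → ℝ) (l k : Fin 4) : ℝ × (Fin 4 → ℝ) →ₗ[ℝ] ℝ :=
  if k = l then ∑ n, ((s n - s l) / (x n - x l) ^ 2) • (LinearMap.proj n ∘ₗ LinearMap.snd ℝ ℝ _)
  else (x k - x l)⁻¹ • (webV x s k - webV x s l)

lemma webLine_self (x s : Fin 4 → ℝ) (l : Fin 4) (w : ℝ × (Fin 4 → ℝ)) :
    webLine x s l l w = ∑ n, ((s n - s l) / (x n - x l) ^ 2) * w.2 n := by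
  simp [webLine]

lemma webLine_of_ne (x s : Fin 4 → ℝ) {l k : Fin 4} (h : k ≠ l) (w : ℝ × (Fin 4 → ℝ)) :
    webLine x s l k w = (webV x s k w - webV x s l w) / (x k - x l) := by
  simp [webLine, h, div_eq_inv_mul]

/-- The points `(x_k, webLine x s l k w)` lie on a line. -/
def OnLines (x s : Fin 4 → ℝ) (w : ℝ × (Fin 4 → ℝ)) : Prop :=
  ∀ l i j k, webLine x s l i w * (x j - x k) + webLine x s l j w * (x k - x i)
    + webLine x s l k w * (x i - x j) = 0

lemma OnLines.sum {x s : Fin 4 → ℝ} {n : ℕ} {w : Fin n → ℝ × (Fin 4 → ℝ)}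
    (h : ∀ a, OnLines x s (w a)) (c : Fin n → ℝ) : OnLines x s (∑ a, c a • w a) := by
  intro l i j k
  simp only [map_sum, map_smul, Finset.sum_mul, ← Finset.sum_add_distrib, smul_eq_mul]
  refine Finset.sum_eq_zero fun a _ => ?_
  linear_combination c a * h a l i j k

/-- The coefficients of three line conditions, after clearing denominators and scaling the first two
columns, together with a further row. -/
def lineMatrix (x s R : Fin 4 → ℝ) : Matrix (Fin 4) (Fin 4) ℝ :=
  let X : Fin 4 → Fin 4 → ℝ := fun i j => x i - x j
  let S : Fin 4 → Fin 4 → ℝ := fun i j => s i - s j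
  let y := X 0 1
  let m := X 2 0 * X 3 0 * X 2 1 * X 3 1 * X 2 3
  let n := X 0 2 * X 1 2 * X 3 2 * X 0 3 * X 1 3
  let W := X 1 2 * X 3 2 * X 1 3 + X 0 2 * X 3 2 * X 3 0 + X 0 2 * X 1 2 * X 0 1
  !![y ^ 2 * X 2 1 * X 3 1 * X 2 3 * (S 2 0 * X 3 0 ^ 3 - S 3 0 * X 2 0 ^ 3),
    y ^ 2 * (S 2 1 * X 2 0 * X 3 0 * X 3 1 * X 2 3 * X 3 0 ^ 2
        - S 3 1 * X 2 0 * X 3 0 * X 2 1 * X 2 3 * X 2 0 ^ 2)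
      + m * S 1 0 * X 1 0 * (X 2 0 ^ 2 - X 3 0 ^ 2) + m * S 1 0 * X 2 3 * X 2 0 * X 3 0,
    S 2 0 * X 3 0 * X 2 1 * X 3 1 * X 2 3 * (-X 3 0 ^ 2 + X 2 0 ^ 2 + X 2 3 * X 3 0)
      - S 2 3 * X 2 0 * X 3 0 * X 2 1 * X 3 1 * X 2 0 ^ 2,
    S 2 3 * X 2 0 * X 3 0 * X 2 1 * X 3 1 * X 3 0 ^ 2
      + S 3 0 * X 2 0 * X 2 1 * X 3 1 * X 2 3 * (-X 3 0 ^ 2 + X 2 0 ^ 2 + X 2 3 * X 2 0);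
    y ^ 2 * (S 2 0 * X 2 1 * X 3 1 * X 3 0 * X 2 3 * X 3 1 ^ 2
        - S 3 0 * X 2 1 * X 3 1 * X 2 0 * X 2 3 * X 2 1 ^ 2)
      + m * S 0 1 * X 0 1 * (X 2 1 ^ 2 - X 3 1 ^ 2) + m * S 0 1 * X 2 3 * X 2 1 * X 3 1,
    y ^ 2 * X 2 0 * X 3 0 * X 2 3 * (S 2 1 * X 3 1 ^ 3 - S 3 1 * X 2 1 ^ 3),
    S 2 1 * X 3 1 * X 2 0 * X 3 0 * X 2 3 * (-X 3 1 ^ 2 + X 2 1 ^ 2 + X 2 3 * X 3 1)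
      - S 2 3 * X 2 1 * X 3 1 * X 2 0 * X 3 0 * X 2 1 ^ 2,
    S 2 3 * X 2 1 * X 3 1 * X 2 0 * X 3 0 * X 3 1 ^ 2
      + S 3 1 * X 2 1 * X 2 0 * X 3 0 * X 2 3 * (-X 3 1 ^ 2 + X 2 1 ^ 2 + X 2 3 * X 2 1);
    -y ^ 2 * (S 0 2 * X 1 2 * X 3 2 * X 0 3 * X 1 3) * W + n * S 0 1 * y * X 0 2 * X 3 2 * X 3 0
      + y ^ 2 * (S 0 3 * X 0 2 * X 1 2 * X 3 2 * X 1 3) * X 0 2 * X 1 2 * X 0 1,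
    n * S 0 1 * y * X 1 2 * X 3 2 * X 1 3 - y ^ 2 * (S 1 2 * X 0 2 * X 3 2 * X 0 3 * X 1 3) * W
      + y ^ 2 * (S 1 3 * X 0 2 * X 1 2 * X 3 2 * X 0 3) * X 0 2 * X 1 2 * X 0 1,
    S 0 2 * X 1 2 * X 3 2 * X 0 3 * X 1 3 * (X 1 2 * X 3 2 * X 1 3)
      + S 1 2 * X 0 2 * X 3 2 * X 0 3 * X 1 3 * (X 0 2 * X 3 2 * X 3 0)
      + S 3 2 * X 0 2 * X 1 2 * X 0 3 * X 1 3 * (X 0 2 * X 1 2 * X 0 1),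
    S 0 3 * X 0 2 * X 1 2 * X 3 2 * X 1 3 * (X 1 2 * X 3 2 * X 1 3)
      + S 1 3 * X 0 2 * X 1 2 * X 3 2 * X 0 3 * (X 0 2 * X 3 2 * X 3 0)
      - S 3 2 * X 0 2 * X 1 2 * X 0 3 * X 1 3 * W;
    R 0, R 1, R 2, R 3]

/-- The coefficients of a further line condition. -/
def lineRow (x s : Fin 4 → ℝ) : Fin 4 → ℝ :=
  let X : Fin 4 → Fin 4 → ℝ := fun i j => x i - x j
  let S : Fin 4 → Fin 4 → ℝ := fun i j => s i - s j
  let y := X 0 1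
  ![y ^ 2 * (S 0 2 * X 3 2 * X 0 3 * X 1 3 * X 1 2 ^ 2 * (-X 3 2 ^ 2 + X 0 2 ^ 2 + X 3 2 * X 0 3)
      - S 0 3 * X 0 2 * X 3 2 * X 1 3 * X 1 2 ^ 2 * X 0 2 ^ 2),
    X 0 2 * X 3 2 * X 0 3 * X 1 3 * X 1 2 ^ 2 * S 0 1 * y * X 3 2 ^ 2
      - y ^ 2 * (S 1 2 * X 0 2 * X 3 2 * X 0 3 * X 1 3 * X 1 2 * (X 3 2 ^ 2 - X 0 2 ^ 2))
      - y ^ 2 * (S 1 3 * X 0 2 * X 3 2 * X 0 3 * X 1 2 ^ 2 * X 0 2 ^ 2)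
      + y ^ 2 * (S 1 2 * X 0 2 * X 3 2 * X 0 3 * X 1 3 * X 0 2 * X 3 2 * X 0 3),
    S 0 2 * X 3 2 * X 0 3 * X 1 3 * X 1 2 ^ 2 * X 3 2 ^ 2
      - S 3 2 * X 0 2 * X 0 3 * X 1 3 * X 1 2 ^ 2 * X 0 2 ^ 2,
    S 0 3 * X 0 2 * X 3 2 * X 1 3 * X 1 2 ^ 2 * X 3 2 ^ 2
      + S 3 2 * X 0 2 * X 0 3 * X 1 3 * X 1 2 ^ 2 * (-X 3 2 ^ 2 + X 0 2 ^ 2 + X 0 2 * X 0 3)]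

/-- The coefficients of the linear form `r`, with scaled columns. -/
def scaledRow (r x : Fin 4 → ℝ) : Fin 4 → ℝ :=
  ![r 0 * (x 0 - x 1) ^ 2, r 1 * (x 0 - x 1) ^ 2, r 2, r 3]

/-- The test point has x_0 = x_1. The scaling of the first two columns by (x_0 - x_1)² removes the
poles there, so a polynomial determinant can be evaluated at this confluent point, where it factors.
-/
lemma lineMatrix_det_lineRow (s : Fin 4 → ℝ) :
    (lineMatrix ![0, 0, 1, -1] s (lineRow ![0, 0, 1, -1] s)).det
      = 192 * (s 0 - s 1) ^ 3 * (s 2 - s 3) := by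
  simp [lineMatrix, lineRow, Matrix.det_succ_row_zero, Fin.sum_univ_succ, Fin.succAbove]
  ring

/-- Companion evaluation with the relation Σ r_n b_n = 0 in the last row; it serves when s_2 = s_3.
-/
lemma lineMatrix_det_scaledRow (s r : Fin 4 → ℝ) :
    (lineMatrix ![0, 0, 1, -1] s (scaledRow r ![0, 0, 1, -1])).det
      = 64 * (s 0 - s 1) ^ 3 * (r 2 + r 3) := by
  simp [lineMatrix, scaledRow, Matrix.det_succ_row_zero, Fin.sum_univ_succ, Fin.succAbove]
  ring

lemma mulVec_lineMatrix {x s R b : Fin 4 → ℝ} (hx : ∀ i j, i ≠ j → x i - x j ≠ 0)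
    (h : OnLines x s (0, b)) :
    let c := ![b 0 / (x 0 - x 1) ^ 2, b 1 / (x 0 - x 1) ^ 2, b 2, b 3]
    (lineMatrix x s R).mulVec c = ![0, 0, 0, ∑ n, R n * c n] := by
  intro c
  -- The first three rows are the line conditions for l = 0, 1, 2 at the nodes (2, 3, 0), (2, 3, 1)
  -- and (0, 1, 3), multiplied by a common denominator.
  have h0 := h 0 2 3 0
  have h1 := h 1 2 3 1
  have h2 := h 2 0 1 3
  rw [webLine_self, webLine_of_ne x s (by decide), webLine_of_ne x s (by decide)] at h0 h1
  rw [webLine_of_ne x s (by decide), webLine_of_ne x s (by decide),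
    webLine_of_ne x s (by decide)] at h2
  simp only [webV_apply, Fin.sum_univ_four, sub_self, zero_div, zero_mul, mul_zero, add_zero,
    zero_add] at h0 h1 h2
  have x10 := hx 1 0 (by decide)
  have x20 := hx 2 0 (by decide)
  have x21 := hx 2 1 (by decide)
  have x30 := hx 3 0 (by decide)
  have x31 := hx 3 1 (by decide)
  have x32 := hx 3 2 (by decide)
  funext i
  fin_cases i
  · simp only [lineMatrix, Matrix.mulVec, dotProduct, Fin.sum_univ_four, c, Matrix.of_apply,
      Matrix.cons_val, Fin.zero_eta]
    simp only [← neg_sub (x 1) (x 0), ← neg_sub (x 2) (x 0), ← neg_sub (x 2) (x 1),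
      ← neg_sub (x 3) (x 0), ← neg_sub (x 3) (x 1), ← neg_sub (x 3) (x 2),
      ← neg_sub (s 2) (s 0), ← neg_sub (s 2) (s 1),
      ← neg_sub (s 3) (s 0), ← neg_sub (s 3) (s 1), ← neg_sub (s 3) (s 2)] at h0 ⊢
    -- After clearing denominators the identity is formal in the differences of the x_i and of the
    -- s_i; their linear relations are not needed.
    generalize x 1 - x 0 = X10 at *
    generalize x 2 - x 0 = X20 at *
    generalize x 2 - x 1 = X21 at *
    generalize x 3 - x 0 = X30 at *
    generalize x 3 - x 1 = X31 at *
    generalize x 3 - x 2 = X32 at *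
    generalize s 1 - s 0 = S10 at *
    generalize s 2 - s 0 = S20 at *
    generalize s 2 - s 1 = S21 at *
    generalize s 3 - s 0 = S30 at *
    generalize s 3 - s 1 = S31 at *
    generalize s 3 - s 2 = S32 at *
    rw [← mul_zero (X20 * X30 * (X20 * X30 * X21 * X31 * -X32)), ← h0]
    field_simp
    ring
  · simp only [lineMatrix, Matrix.mulVec, dotProduct, Fin.sum_univ_four, c, Matrix.of_apply,
      Matrix.cons_val, Fin.mk_one]
    simp only [← neg_sub (x 1) (x 0), ← neg_sub (x 2) (x 0), ← neg_sub (x 2) (x 1),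
      ← neg_sub (x 3) (x 0), ← neg_sub (x 3) (x 1), ← neg_sub (x 3) (x 2),
      ← neg_sub (s 1) (s 0), ← neg_sub (s 2) (s 0), ← neg_sub (s 2) (s 1),
      ← neg_sub (s 3) (s 0), ← neg_sub (s 3) (s 1), ← neg_sub (s 3) (s 2)] at h1 ⊢
    generalize x 1 - x 0 = X10 at *
    generalize x 2 - x 0 = X20 at *
    generalize x 2 - x 1 = X21 at *
    generalize x 3 - x 0 = X30 at *
    generalize x 3 - x 1 = X31 at *
    generalize x 3 - x 2 = X32 at *
    generalize s 1 - s 0 = S10 at *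
    generalize s 2 - s 0 = S20 at *
    generalize s 2 - s 1 = S21 at *
    generalize s 3 - s 0 = S30 at *
    generalize s 3 - s 1 = S31 at *
    generalize s 3 - s 2 = S32 at *
    rw [← mul_zero (X21 * X31 * (X20 * X30 * X21 * X31 * -X32)), ← h1]
    field_simp
    ring
  · simp only [lineMatrix, Matrix.mulVec, dotProduct, Fin.sum_univ_four, c, Matrix.of_apply,
      Matrix.cons_val, Fin.reduceFinMk]
    simp only [← neg_sub (x 1) (x 0), ← neg_sub (x 2) (x 0), ← neg_sub (x 2) (x 1),
      ← neg_sub (x 3) (x 0), ← neg_sub (x 3) (x 1), ← neg_sub (x 3) (x 2),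
      ← neg_sub (s 1) (s 0), ← neg_sub (s 2) (s 0), ← neg_sub (s 2) (s 1),
      ← neg_sub (s 3) (s 0), ← neg_sub (s 3) (s 1), ← neg_sub (s 3) (s 2)] at h2 ⊢
    generalize x 1 - x 0 = X10 at *
    generalize x 2 - x 0 = X20 at *
    generalize x 2 - x 1 = X21 at *
    generalize x 3 - x 0 = X30 at *
    generalize x 3 - x 1 = X31 at *
    generalize x 3 - x 2 = X32 at *
    generalize s 1 - s 0 = S10 at *
    generalize s 2 - s 0 = S20 at *
    generalize s 2 - s 1 = S21 at *
    generalize s 3 - s 0 = S30 at *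
    generalize s 3 - s 1 = S31 at *
    generalize s 3 - s 2 = S32 at *
    rw [← mul_zero (-X20 * -X21 * X32 * (-X20 * -X21 * X32 * -X30 * -X31)), ← h2]
    field_simp
    ring
  · simp [lineMatrix, Matrix.mulVec, dotProduct, Fin.sum_univ_four, c]

/-- The fourth row is the line condition for l = 2 at the nodes (0, 3, 2). -/
lemma lineRow_sum {x s b : Fin 4 → ℝ} (hx : ∀ i j, i ≠ j → x i - x j ≠ 0)
    (h : OnLines x s (0, b)) :
    ∑ n, lineRow x s n * ![b 0 / (x 0 - x 1) ^ 2, b 1 / (x 0 - x 1) ^ 2, b 2, b 3] n = 0 := by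
  have h0 := h 2 0 3 2
  rw [webLine_self, webLine_of_ne x s (by decide), webLine_of_ne x s (by decide)] at h0
  simp only [webV_apply, Fin.sum_univ_four, sub_self, zero_div, zero_mul, mul_zero, add_zero,
    zero_add] at h0
  have x10 := hx 1 0 (by decide)
  have x20 := hx 2 0 (by decide)
  have x21 := hx 2 1 (by decide)
  have x30 := hx 3 0 (by decide)
  have x31 := hx 3 1 (by decide)
  have x32 := hx 3 2 (by decide)
  simp only [lineRow, Fin.sum_univ_four, Matrix.cons_val]
  simp only [← neg_sub (x 1) (x 0), ← neg_sub (x 2) (x 0), ← neg_sub (x 2) (x 1),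
    ← neg_sub (x 3) (x 0), ← neg_sub (x 3) (x 1), ← neg_sub (x 3) (x 2),
    ← neg_sub (s 1) (s 0), ← neg_sub (s 2) (s 0), ← neg_sub (s 2) (s 1),
    ← neg_sub (s 3) (s 0), ← neg_sub (s 3) (s 1), ← neg_sub (s 3) (s 2)] at h0 ⊢
  generalize x 1 - x 0 = X10 at *
  generalize x 2 - x 0 = X20 at *
  generalize x 2 - x 1 = X21 at *
  generalize x 3 - x 0 = X30 at *
  generalize x 3 - x 1 = X31 at *
  generalize x 3 - x 2 = X32 at *
  generalize s 1 - s 0 = S10 at *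
  generalize s 2 - s 0 = S20 at *
  generalize s 2 - s 1 = S21 at *
  generalize s 3 - s 0 = S30 at *
  generalize s 3 - s 1 = S31 at *
  generalize s 3 - s 2 = S32 at *
  rw [← mul_zero (-X20 * X32 * (-X20 * X32 * -X30 * -X31 * (-X21) ^ 2)), ← h0]
  field_simp
  ring

lemma scaledRow_sum {x r b : Fin 4 → ℝ} (hx : x 0 - x 1 ≠ 0) (h : ∑ n, r n * b n = 0) :
    ∑ n, scaledRow r x n * ![b 0 / (x 0 - x 1) ^ 2, b 1 / (x 0 - x 1) ^ 2, b 2, b 3] n = 0 := by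
  rw [← h]
  simp only [scaledRow, Fin.sum_univ_four, Matrix.cons_val]
  field_simp

lemma eq_zero_of_lineMatrix {x s R b : Fin 4 → ℝ} (hx : ∀ i j, i ≠ j → x i - x j ≠ 0)
    (h : OnLines x s (0, b)) (hd : (lineMatrix x s R).det ≠ 0)
    (hR : ∑ n, R n * ![b 0 / (x 0 - x 1) ^ 2, b 1 / (x 0 - x 1) ^ 2, b 2, b 3] n = 0) : b = 0 := by
  have h1 := mulVec_lineMatrix (R := R) hx h
  simp only [hR] at h1
  have h2 := Matrix.eq_zero_of_mulVec_eq_zero hd (h1.trans (by ext i; fin_cases i <;> rfl))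
  have x01 := hx 0 1 (by decide)
  have e := fun i => congrFun h2 i
  have e0 := e 0
  have e1 := e 1
  have e2 := e 2
  have e3 := e 3
  simp [x01] at e0 e1 e2 e3
  ext i
  fin_cases i <;> assumption

/-- The line conditions are equivariant under relabelling, so the two distinguished nodes 0 and 1
may be any pair. -/
lemma OnLines.comp {x s b : Fin 4 → ℝ} {δ : ℝ} (h : OnLines x s (δ, b)) (π : Equiv.Perm (Fin 4)) :
    OnLines (x ∘ π) (s ∘ π) (δ, b ∘ π) := by
  have hV : ∀ k, webV (x ∘ π) (s ∘ π) k (δ, b ∘ π) = webV x s (π k) (δ, b) := fun k => by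
    simp only [webV_apply, Function.comp_apply]
    rw [Equiv.sum_comp π fun n => (s n - s (π k)) / (x n - x (π k)) * b n]
  have hL : ∀ l k, webLine (x ∘ π) (s ∘ π) l k (δ, b ∘ π) = webLine x s (π l) (π k) (δ, b) := by
    intro l k
    rcases eq_or_ne k l with rfl | hkl
    · simp only [webLine_self, Function.comp_apply]
      rw [Equiv.sum_comp π fun n => (s n - s (π k)) / (x n - x (π k)) ^ 2 * b n]
    · rw [webLine_of_ne _ _ hkl, webLine_of_ne _ _ (π.injective.ne hkl), hV, hV]
      rfl
  intro l i j k
  rw [hL, hL, hL]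
  exact h _ _ _ _

lemma contDiff_lineMatrix_det {s : Fin 4 → ℝ} {R : (Fin 4 → ℝ) → Fin 4 → ℝ}
    (hR : ∀ i, ContDiff ℝ ω fun x => R x i) :
    ContDiff ℝ ω fun x => (lineMatrix x s (R x)).det := by
  simp only [Matrix.det_apply]
  refine ContDiff.sum fun σ _ => ContDiff.const_smul _ (contDiff_prod fun i _ => ?_)
  have key : ∀ i j, ContDiff ℝ ω fun x => lineMatrix x s (R x) i j := by
    intro i j
    fin_cases i <;> fin_cases j <;> simp [lineMatrix] <;> first | exact hR _ | fun_prop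
  exact key _ _

/-- Identity theorem for real analytic functions: vanishing on a non-empty open set would force
vanishing at x₀. -/
lemma exists_ne_zero_of_contDiff {f : (Fin 4 → ℝ) → ℝ} (hf : ContDiff ℝ ω f) {x₀ : Fin 4 → ℝ}
    (h0 : f x₀ ≠ 0) {V : Set (Fin 4 → ℝ)} (hV : IsOpen V) (hne : V.Nonempty) :
    ∃ x ∈ V, f x ≠ 0 := by
  by_contra hc
  push Not at hc
  obtain ⟨x, hx⟩ := hne
  have ha : AnalyticOnNhd ℝ f Set.univ := contDiff_omega_iff_analyticOnNhd.1 hf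
  have := ha.eqOn_zero_of_preconnected_of_eventuallyEq_zero isPreconnected_univ (Set.mem_univ x)
    (Filter.eventuallyEq_of_mem (hV.mem_nhds hx) hc)
  exact h0 (this (Set.mem_univ x₀))

/-- With such a labelling one of the two determinants is non-zero at the test point. The only bad
case for the complementary pair is a_2 = -a_3, and then another choice of pairs works. -/
lemma exists_perm {a : Fin 4 → ℝ} (h : ∃ i j, |a i| ≠ |a j|) :
    ∃ π : Equiv.Perm (Fin 4), |a (π 0)| ≠ |a (π 1)| ∧
      (|a (π 2)| ≠ |a (π 3)| ∨ a (π 2) = a (π 3)) := by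
  have key : ∀ i j k l, Distinct4 i j k l → |a i| ≠ |a j| →
      (|a k| ≠ |a l| ∨ a k = a l) → ∃ π : Equiv.Perm (Fin 4), |a (π 0)| ≠ |a (π 1)| ∧
      (|a (π 2)| ≠ |a (π 3)| ∨ a (π 2) = a (π 3)) := by
    intro i j k l h h1 h2
    have hi : Function.Injective ![i, j, k, l] := by
      clear h1 h2
      revert i j k l
      decide
    exact ⟨Equiv.ofBijective _ (Finite.injective_iff_bijective.1 hi), h1, h2⟩
  have key2 : ∀ i j k l, Distinct4 i j k l → |a k| = |a l| → a k ≠ a l → |a i| ≠ |a k| →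
      ∃ π : Equiv.Perm (Fin 4), |a (π 0)| ≠ |a (π 1)| ∧
      (|a (π 2)| ≠ |a (π 3)| ∨ a (π 2) = a (π 3)) := by
    intro i j k l h h1 h2 h3
    by_cases h4 : |a j| = |a k|
    · rcases abs_eq_abs.1 h4 with h5 | h5
      · exact key i l j k h.swap34.swap23 (by rwa [← h1]) (Or.inr h5)
      · refine key i k j l h.swap23 h3 (Or.inr ?_)
        rcases abs_eq_abs.1 h1 with h6 | h6
        · exact absurd h6 h2
        · rw [h5, h6, neg_neg]
    · exact key i k j l h.swap23 h3 (Or.inl (by rwa [← h1]))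
  obtain ⟨i, j, hij⟩ := h
  obtain ⟨k, l, h4⟩ := Distinct4.exists_of_ne (fun e => hij (by rw [e]) : i ≠ j)
  by_cases h1 : |a k| = |a l|
  · by_cases h2 : a k = a l
    · exact key i j k l h4 hij (Or.inr h2)
    · by_cases h3 : |a i| = |a k|
      · exact key2 j i k l h4.swap12 h1 h2 (by rw [← h3]; exact hij.symm)
      · exact key2 i j k l h4 h1 h2 h3
  · exact key i j k l h4 hij (Or.inl h1)

/-- If the `|a_i|` are not all equal, then the line conditions together with `∑ a_i b_i = 0`
have only the trivial solution, on a dense open set of points `x`. -/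
theorem exists_onLines_det {a : Fin 4 → ℝ} (ha : ∀ i, a i ≠ 0) (h : ∃ i j, |a i| ≠ |a j|) :
    ∃ D : (Fin 4 → ℝ) → ℝ, Continuous D ∧
      (∀ V : Set (Fin 4 → ℝ), IsOpen V → V.Nonempty → ∃ x ∈ V, D x ≠ 0) ∧
      ∀ x, D x ≠ 0 → (∀ i j, i ≠ j → x i - x j ≠ 0) → ∀ b : Fin 4 → ℝ,
        OnLines x (fun i => (a i)⁻¹ ^ 2) (0, b) → ∑ n, a n * b n = 0 → b = 0 := by
  obtain ⟨π, h1, h2⟩ := exists_perm h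
  set s : Fin 4 → ℝ := fun i => (a i)⁻¹ ^ 2 with hs
  have hsne : ∀ i j, |a i| ≠ |a j| → s i - s j ≠ 0 := by
    intro i j hij h0
    apply hij
    have : (a i)⁻¹ ^ 2 = (a j)⁻¹ ^ 2 := sub_eq_zero.1 h0
    rw [sq_eq_sq_iff_abs_eq_abs, abs_inv, abs_inv] at this
    exact inv_injective this
  have hcomp : Continuous fun x : Fin 4 → ℝ => x ∘ π := by fun_prop
  have main : ∀ R : (Fin 4 → ℝ) → Fin 4 → ℝ, (∀ i, ContDiff ℝ ω fun x => R x i) →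
      (lineMatrix ![0, 0, 1, -1] (s ∘ π) (R ![0, 0, 1, -1])).det ≠ 0 →
      (∀ x b : Fin 4 → ℝ, (∀ i j, i ≠ j → x i - x j ≠ 0) → OnLines x (s ∘ π) (0, b) →
        ∑ n, a (π n) * b n = 0 →
        ∑ n, R x n * ![b 0 / (x 0 - x 1) ^ 2, b 1 / (x 0 - x 1) ^ 2, b 2, b 3] n = 0) →
      ∃ D : (Fin 4 → ℝ) → ℝ, Continuous D ∧
      (∀ V : Set (Fin 4 → ℝ), IsOpen V → V.Nonempty → ∃ x ∈ V, D x ≠ 0) ∧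
      ∀ x, D x ≠ 0 → (∀ i j, i ≠ j → x i - x j ≠ 0) → ∀ b : Fin 4 → ℝ,
        OnLines x s (0, b) → ∑ n, a n * b n = 0 → b = 0 := by
    intro R hR hdet hRb
    have hc : ContDiff ℝ ω fun x : Fin 4 → ℝ => (lineMatrix (x ∘ π) (s ∘ π) (R (x ∘ π))).det :=
      (contDiff_lineMatrix_det hR).comp (g := fun x => (lineMatrix x (s ∘ π) (R x)).det)
        (contDiff_pi.2 fun i => contDiff_apply ℝ ℝ (π i))
    refine ⟨_, hc.continuous, fun V hV hne => ?_, fun x hD hx b hb hσ => ?_⟩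
    -- The test point is permuted back so that its image under the relabelling is the confluent
    -- point.
    · refine exists_ne_zero_of_contDiff hc (x₀ := ![0, 0, 1, -1] ∘ π.symm) ?_ hV hne
      have : (![0, 0, 1, -1] ∘ π.symm) ∘ π = (![0, 0, 1, -1] : Fin 4 → ℝ) := by
        ext i; simp
      simp only [this]
      exact hdet
    · have hx' : ∀ i j, i ≠ j → (x ∘ π) i - (x ∘ π) j ≠ 0 := fun i j hij =>
        hx _ _ (π.injective.ne hij)
      have := eq_zero_of_lineMatrix hx' (hb.comp π) hD (hRb _ _ hx' (hb.comp π) (by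
        rw [← hσ]
        exact Equiv.sum_comp π fun n => a n * b n))
      ext i
      simpa using congrFun this (π.symm i)
  -- If |a_2| ≠ |a_3| in the new labelling, a fourth line condition suffices. If a_2 = a_3, the
  -- relation Σ a_n b_n = 0 is used instead, with r_2 + r_3 = 2 a_2 ≠ 0.
  rcases h2 with h2 | h2
  · refine main (fun x => lineRow x (s ∘ π)) (fun i => ?_) ?_ fun x b hx hb _ => lineRow_sum hx hb
    · fin_cases i <;> simp [lineRow] <;> fun_prop
    · rw [lineMatrix_det_lineRow]
      exact mul_ne_zero (mul_ne_zero (by norm_num) (pow_ne_zero _ (hsne _ _ h1))) (hsne _ _ h2)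
  · refine main (fun x => scaledRow (a ∘ π) x) (fun i => ?_) ?_
      fun x b hx _ hσ => scaledRow_sum (hx 0 1 (by decide)) hσ
    · fin_cases i <;> simp [scaledRow] <;> fun_prop
    · rw [lineMatrix_det_scaledRow]
      refine mul_ne_zero (mul_ne_zero (by norm_num) (pow_ne_zero _ (hsne _ _ h1))) ?_
      simp only [Function.comp_apply, h2]
      rw [← two_mul]
      exact mul_ne_zero two_ne_zero (ha _)

end FourDim

/-! ### Dimension four: compatibility conditions of the first-order system. -/

section FourDim

variable {a : Fin 4 → ℝ} {U : Set (J1 4)} {Z : J1 4 → J1 4} {z : J1 4}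

/-- The pair `(δ, b)` with `δ = S - α`. -/
def webPair (a : Fin 4 → ℝ) (Z : J1 4 → J1 4) (z : J1 4) : ℝ × (Fin 4 → ℝ) :=
  (traceC a Z z - slopeC a Z z, fun n => bC a Z n z)

variable (ha : ∀ i, a i ≠ 0) (hU : IsOpen U)
  (hb : ∀ z ∈ U, ∀ i j, i ≠ j → webCoeff (dualForm a) i j z ≠ 0)
  (hS : (veronese4 a).IsLocalSymmetry U Z)
include ha hU hb hS

/-- The compatibility condition ∂_k ∂_j b_j = ∂_j ∂_k b_j of the system for b, solved for ∂_k S. -/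
lemma dirD_trace {j k : Fin 4} (hjk : j ≠ k) (hz : z ∈ U) :
    dirD (ex k) (traceC a Z) z * (z.1 j - z.1 k)
      = a k * (webV z.1 (fun i => (a i)⁻¹) j (webPair a Z z)
        - webV z.1 (fun i => (a i)⁻¹) k (webPair a Z z)) := by
  obtain ⟨m, n, h⟩ := Distinct4.exists_of_ne hjk
  have hx := fun {i j : Fin 4} (hij : i ≠ j) => sub_ne_zero_of_mem hb hz hij
  have hbd := fun (i : Fin 4) (v : J1 4) =>
    HasDirD.of_contDiffOn (v := v) hU (bC_contDiffOn hU hS i) hz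
  have hsm := bC_contDiffOn hU hS j
  have hdiv := fun (i j : Fin 4) (v : J1 4) (hij : i ≠ j) =>
    (hbd i v).div ((hasDirD_x i v z).sub (hasDirD_x j v z)) (hx hij)
  have e1 := HasDirD.eq_of_eqOn (v := ex k) hU hz (g := fun z => traceC a Z z - slopeC a Z z
      - (bC a Z k z / (z.1 k - z.1 j) + bC a Z m z / (z.1 m - z.1 j)
        + bC a Z n z / (z.1 n - z.1 j)))
    (fun z hz => by
      rw [dirD_bC_self ha hU hb hS j hz, h.sum_eq, sub_self, div_zero, zero_add])
    (HasDirD.of_contDiffOn hU (dirD_contDiffOn hU hsm (ex j)) hz)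
    (((HasDirD.of_contDiffOn hU (traceC_contDiffOn hU hb hS) hz).sub
      (HasDirD.of_contDiffOn hU (slopeC_contDiffOn hU hb hS) hz)).sub
      (((hdiv k j _ h.1.symm).add (hdiv m j _ h.2.1.symm)).add (hdiv n j _ h.2.2.1.symm)))
  have e2 := HasDirD.eq_of_eqOn (v := ex j) hU hz
    (fun z hz => dirD_bC ha hU hb hS hjk hz)
    (HasDirD.of_contDiffOn hU (dirD_contDiffOn hU hsm (ex k)) hz)
    (((hbd j (ex j)).mul (HasDirD.const (a k))).div ((HasDirD.const (a j)).mul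
      ((hasDirD_x j (ex j) z).sub (hasDirD_x k (ex j) z))) (mul_ne_zero (ha j) (hx hjk)))
  rw [dirD_comm hU hsm hz, e1] at e2
  have hjm := h.2.1
  have hjn := h.2.2.1
  have hkm := h.2.2.2.1
  have hkn := h.2.2.2.2.1
  rw [dirD_bC ha hU hb hS hkm.symm hz, dirD_bC ha hU hb hS hkn.symm hz,
    dirD_bC_self ha hU hb hS k hz, dirD_bC_self ha hU hb hS j hz, h.sum_eq, h.sum_eq,
    (dirD_slopeC ha hU hb hS _ hz).1] at e2
  simp only [ex_fst, hjk, hjk.symm, hkm.symm, hkn.symm, if_false, if_true,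
    sub_zero, sub_self, div_zero, mul_zero, zero_mul, zero_add, add_zero, zero_div] at e2
  rw [webV_apply, webV_apply, h.sum_eq, h.sum_eq]
  simp only [webPair, sub_self, zero_div, zero_mul, zero_add, add_zero]
  have x1 := hx hjk
  have x2 := hx hjk.symm
  have x3 := hx hjm.symm
  have x4 := hx hjn.symm
  have x5 := hx hkm.symm
  have x6 := hx hkn.symm
  have aj := ha j
  have ak := ha k
  have am := ha m
  have an := ha n
  rw [sub_eq_iff_eq_add] at e2
  rw [e2]
  generalize traceC a Z z - slopeC a Z z = δ
  generalize bC a Z j z = bj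
  generalize bC a Z k z = bk
  generalize bC a Z m z = bm
  generalize bC a Z n z = bn
  rw [← neg_sub (z.1 j) (z.1 k)]
  have r1 : z.1 m - z.1 k = (z.1 m - z.1 j) + (z.1 j - z.1 k) := by ring
  have r2 : z.1 n - z.1 k = (z.1 n - z.1 j) + (z.1 j - z.1 k) := by ring
  rw [r1] at x5 ⊢
  rw [r2] at x6 ⊢
  generalize z.1 m - z.1 j = X at *
  generalize z.1 n - z.1 j = Y at *
  generalize z.1 j - z.1 k = W at *
  field_simp
  ring

/-- The function `A` with `∂_k S = a_k A`. -/
def accC (a : Fin 4 → ℝ) (Z : J1 4 → J1 4) (z : J1 4) : ℝ := (a 0)⁻¹ * dirD (ex 0) (traceC a Z) z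

lemma dirD_traceC (k : Fin 4) (hz : z ∈ U) : dirD (ex k) (traceC a Z) z = a k * accC a Z z := by
  have h0 := ha 0
  unfold accC
  rcases eq_or_ne k 0 with rfl | hk
  · field_simp
  · have e1 := dirD_trace ha hU hb hS hk hz
    have e2 := dirD_trace ha hU hb hS hk.symm hz
    field_simp
    refine mul_right_cancel₀ (sub_ne_zero_of_mem hb hz hk) ?_
    linear_combination -a k * e1 - a 0 * e2

/-- The points (x_k, V_k) lie on a line of slope A; this is the form of the compatibility condition
that is differentiated once more. -/
lemma webV_sub (j k : Fin 4) (hz : z ∈ U) :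
    webV z.1 (fun i => (a i)⁻¹) j (webPair a Z z) - webV z.1 (fun i => (a i)⁻¹) k (webPair a Z z)
      = accC a Z z * (z.1 j - z.1 k) := by
  rcases eq_or_ne j k with rfl | hjk
  · simp
  · refine mul_left_cancel₀ (ha k) ?_
    rw [← dirD_trace ha hU hb hS hjk hz, dirD_traceC ha hU hb hS k hz]
    ring

/-- The first-order system expresses ∂_l V_k again through (δ, b): the result is a_l times a divided
difference of forms of the same kind, with the squares a_n⁻² in place of a_n⁻¹. -/
lemma hasDirD_webV (k l : Fin 4) (hz : z ∈ U) :
    ∃ D, HasDirD (fun z => webV z.1 (fun i => (a i)⁻¹) k (webPair a Z z)) D (ex l) z ∧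
      D = a l * (webLine z.1 (fun i => (a i)⁻¹ ^ 2) l k (webPair a Z z))
        + (if k = l then 1 else 0) * accC a Z z := by
  have hx := fun {i j : Fin 4} (hij : i ≠ j) => sub_ne_zero_of_mem hb hz hij
  have hbd := fun (i : Fin 4) (v : J1 4) =>
    HasDirD.of_contDiffOn (v := v) hU (bC_contDiffOn hU hS i) hz
  have hterm := fun (i j : Fin 4) (v : J1 4) (hij : i ≠ j) =>
    ((HasDirD.const (z := z) (v := v) ((a i)⁻¹ - (a j)⁻¹)).div
      ((hasDirD_x i v z).sub (hasDirD_x j v z)) (hx hij)).mul (hbd i v)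
  have hδ := (HasDirD.of_contDiffOn (v := ex l) hU (traceC_contDiffOn hU hb hS) hz).sub
      (HasDirD.of_contDiffOn (v := ex l) hU (slopeC_contDiffOn hU hb hS) hz)
  rcases eq_or_ne k l with rfl | hkl
  · obtain ⟨j, m, n, h⟩ := (by decide : ∀ i : Fin 4, ∃ j k l, Distinct4 i j k l) k
    refine ⟨_, HasDirD.congr_of_eqOn hU hz (g := fun z =>
      (a k)⁻¹ * (traceC a Z z - slopeC a Z z)
        + ((a j)⁻¹ - (a k)⁻¹) / (z.1 j - z.1 k) * bC a Z j z
        + ((a m)⁻¹ - (a k)⁻¹) / (z.1 m - z.1 k) * bC a Z m z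
        + ((a n)⁻¹ - (a k)⁻¹) / (z.1 n - z.1 k) * bC a Z n z) (fun z _ => by
        rw [webV_apply, h.sum_eq]
        simp only [webPair, sub_self, zero_div, zero_mul]
        ring) (((((HasDirD.const _).mul hδ).add (hterm j k _ h.1.symm)).add
          (hterm m k _ h.2.1.symm)).add (hterm n k _ h.2.2.1.symm)), ?_⟩
    rw [webLine_self, h.sum_eq, if_pos rfl, one_mul, dirD_bC ha hU hb hS h.1.symm hz,
      dirD_bC ha hU hb hS h.2.1.symm hz, dirD_bC ha hU hb hS h.2.2.1.symm hz,
      dirD_traceC ha hU hb hS k hz, (dirD_slopeC ha hU hb hS _ hz).1]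
    simp only [webPair, ex_fst, h.1.symm, h.2.1.symm, h.2.2.1.symm, if_true, if_false]
    have x1 := hx h.1.symm
    have x2 := hx h.2.1.symm
    have x3 := hx h.2.2.1.symm
    have ak := ha k
    have aj := ha j
    have am := ha m
    have an := ha n
    generalize z.1 j - z.1 k = X at *
    generalize z.1 m - z.1 k = Y at *
    generalize z.1 n - z.1 k = W at *
    field_simp
    ring
  · obtain ⟨m, n, h⟩ := Distinct4.exists_of_ne hkl
    refine ⟨_, HasDirD.congr_of_eqOn hU hz (g := fun z =>
      (a k)⁻¹ * (traceC a Z z - slopeC a Z z)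
        + ((a l)⁻¹ - (a k)⁻¹) / (z.1 l - z.1 k) * bC a Z l z
        + ((a m)⁻¹ - (a k)⁻¹) / (z.1 m - z.1 k) * bC a Z m z
        + ((a n)⁻¹ - (a k)⁻¹) / (z.1 n - z.1 k) * bC a Z n z) (fun z _ => by
        rw [webV_apply, h.sum_eq]
        simp only [webPair, sub_self, zero_div, zero_mul]
        ring) (((((HasDirD.const _).mul hδ).add (hterm l k _ h.1.symm)).add
          (hterm m k _ h.2.1.symm)).add (hterm n k _ h.2.2.1.symm)), ?_⟩
    -- For k ≠ l the slope A coming from ∂_l S is replaced by the divided difference of V_k and V_l.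
    have hA := webV_sub ha hU hb hS k l hz
    have hkm := h.2.1
    have hkn := h.2.2.1
    have hlm := h.2.2.2.1
    have hln := h.2.2.2.2.1
    rw [webLine_of_ne _ _ hkl, if_neg hkl, zero_mul, dirD_bC ha hU hb hS hlm.symm hz,
      dirD_bC ha hU hb hS hln.symm hz, dirD_bC_self ha hU hb hS l hz,
      dirD_traceC ha hU hb hS l hz, (dirD_slopeC ha hU hb hS _ hz).1, webV_apply, webV_apply,
      h.sum_eq, h.sum_eq, h.sum_eq]
    rw [webV_apply, webV_apply, h.sum_eq, h.sum_eq] at hA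
    simp only [webPair, ex_fst, hkl, hlm.symm, hln.symm, if_true, if_false, sub_self,
      zero_div, zero_mul, zero_add, add_zero, sub_zero, mul_zero] at hA ⊢
    have x1 := hx hkl
    have x3 := hx hkm.symm
    have x4 := hx hkn.symm
    have x5 := hx hlm.symm
    have x6 := hx hln.symm
    have ak := ha k
    have al := ha l
    have am := ha m
    have an := ha n
    have x7 := hx hkl.symm
    rw [← div_eq_iff x1] at hA
    rw [← hA, div_zero]
    generalize traceC a Z z - slopeC a Z z = δ
    generalize bC a Z k z = bk
    generalize bC a Z l z = bl
    generalize bC a Z m z = bm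
    generalize bC a Z n z = bn
    rw [← neg_sub (z.1 k) (z.1 l)]
    have r1 : z.1 m - z.1 l = (z.1 m - z.1 k) + (z.1 k - z.1 l) := by ring
    have r2 : z.1 n - z.1 l = (z.1 n - z.1 k) + (z.1 k - z.1 l) := by ring
    rw [r1] at x5 ⊢
    rw [r2] at x6 ⊢
    clear hA hterm hδ hbd hx r1 r2 x7
    generalize z.1 m - z.1 k = X at *
    generalize z.1 n - z.1 k = Y at *
    generalize z.1 k - z.1 l = W at *
    field_simp
    ring

/-- The collinearity of the points (x_i, V_i) is differentiated along x_l. Moving the node x_l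
itself contributes multiples of A, which cancel the A-terms of `hasDirD_webV`. -/
theorem onLines (hz : z ∈ U) : OnLines z.1 (fun i => (a i)⁻¹ ^ 2) (webPair a Z z) := by
  intro l i j k
  obtain ⟨Di, hi, ei⟩ := hasDirD_webV ha hU hb hS i l hz
  obtain ⟨Dj, hj, ej⟩ := hasDirD_webV ha hU hb hS j l hz
  obtain ⟨Dk, hk, ek⟩ := hasDirD_webV ha hU hb hS k l hz
  have e := HasDirD.eq_of_eqOn hU hz (fun z hz => by
      have h1 := webV_sub ha hU hb hS i j hz
      have h2 := webV_sub ha hU hb hS j k hz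
      linear_combination (z.1 j - z.1 k) * h1 - (z.1 i - z.1 j) * h2)
    (((hi.mul ((hasDirD_x j _ z).sub (hasDirD_x k _ z))).add
      (hj.mul ((hasDirD_x k _ z).sub (hasDirD_x i _ z)))).add
      (hk.mul ((hasDirD_x i _ z).sub (hasDirD_x j _ z)))) (HasDirD.const 0)
  have h1 := webV_sub ha hU hb hS i j hz
  have h2 := webV_sub ha hU hb hS j k hz
  rw [ei, ej, ek] at e
  simp only [ex_fst] at e
  refine (mul_eq_zero.1 (?_ : a l * _ = 0)).resolve_left (ha l)
  generalize (if i = l then (1 : ℝ) else 0) = di at *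
  generalize (if j = l then (1 : ℝ) else 0) = dj at *
  generalize (if k = l then (1 : ℝ) else 0) = dk at *
  linear_combination e + di * h2 - dj * (h1 + h2) + dk * h1

end FourDim

/-! ### Dimension four: bracket relations for commuting symmetries. -/

section FourDim

variable {a : Fin 4 → ℝ} {U : Set (J1 4)} {Z Z' : J1 4 → J1 4} {z : J1 4}

variable (ha : ∀ i, a i ≠ 0) (hU : IsOpen U)
  (hb : ∀ z ∈ U, ∀ i j, i ≠ j → webCoeff (dualForm a) i j z ≠ 0)
  (hS : (veronese4 a).IsLocalSymmetry U Z) (hS' : (veronese4 a).IsLocalSymmetry U Z')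
  (hcomm : ∀ z ∈ U, VectorField.lieBracket ℝ Z Z' z = 0)

section
include ha hU hb hS

lemma dirD_xiC_self (j : Fin 4) (hz : z ∈ U) :
    dirD (ex j) (xiC Z j) z = traceC a Z z - ∑ n, bC a Z n z / (z.1 n - z.1 j) := by
  rw [traceC_eq ha hU hb hS j hz]
  ring

lemma dirD_xiC_eq_sum (i : Fin 4) (w : J1 4) (hz : z ∈ U) :
    dirD w (xiC Z i) z = ∑ n, w.1 n * dirD (ex n) (xiC Z i) z := by
  rw [dirD_eq_sum]
  simp [dirD_xiC_eu ha hU hb hS i hz, dirD_xiC_ep hU hb hS i _ hz]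

/-- The coefficient `τ` in `∂_k η = τ a_k`. -/
def tauC (a : Fin 4 → ℝ) (Z : J1 4 → J1 4) (z : J1 4) : ℝ := dirD (ex 0) (etaC Z) z / a 0

lemma dirD_etaC (k : Fin 4) (hz : z ∈ U) : dirD (ex k) (etaC Z) z = tauC a Z z * a k := by
  have h0 := ha 0
  unfold tauC
  rcases eq_or_ne k 0 with rfl | hk
  · field_simp
  · have := etaC_four ha hU hb hS hk hz
    field_simp
    linear_combination this

/-- The function `∑ a_j ξ_j`. -/
def kappaC (a : Fin 4 → ℝ) (Z : J1 4 → J1 4) (z : J1 4) : ℝ := ∑ j, a j * xiC Z j z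

/-- For n ≠ k, a_n ∂_k ξ_n = a_k b_n / (x_n - x_k), which cancels term by term the sum subtracted
from S in ∂_k ξ_k. -/
lemma hasDirD_kappaC (k : Fin 4) (hz : z ∈ U) :
    HasDirD (kappaC a Z) (a k * traceC a Z z) (ex k) z := by
  have hd := fun (i : Fin 4) =>
    HasDirD.of_contDiffOn (v := ex k) hU (xiC_contDiffOn hS.field.smooth i) hz
  have := HasDirD.sum (s := Finset.univ) fun j _ => (HasDirD.const (a j)).mul (hd j)
  obtain ⟨l, m, n, h⟩ := (by decide : ∀ i : Fin 4, ∃ j k l, Distinct4 i j k l) k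
  have hx := fun {i j : Fin 4} (hij : i ≠ j) => sub_ne_zero_of_mem hb hz hij
  have e : ∑ j, (0 * xiC Z j z + a j * dirD (ex k) (xiC Z j) z) = a k * traceC a Z z := by
    rw [h.sum_eq, dirD_xiC ha hU hb hS h.1.symm hz, dirD_xiC ha hU hb hS h.2.1.symm hz,
      dirD_xiC ha hU hb hS h.2.2.1.symm hz, dirD_xiC_self ha hU hb hS k hz, h.sum_eq]
    have := hx h.1.symm
    have := hx h.2.1.symm
    have := hx h.2.2.1.symm
    have := ha l
    have := ha m
    have := ha n
    rw [sub_self, div_zero]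
    field_simp
    ring
  rw [← e]
  exact this

end

include ha hU hb hS hS' hcomm

lemma bracket_xiC (j : Fin 4) (hz : z ∈ U) :
    ∑ n, xiC Z n z * dirD (ex n) (xiC Z' j) z = ∑ n, xiC Z' n z * dirD (ex n) (xiC Z j) z := by
  have h := (dirD_eq_of_lieBracket hU hS.field.smooth hS'.field.smooth hz (hcomm z hz)).1 j
  rwa [dirD_xiC_eq_sum ha hU hb hS' j _ hz, dirD_xiC_eq_sum ha hU hb hS j _ hz] at h

/-- The ξ-components of the bracket are contracted with a_j; by `hasDirD_kappaC` the derivative of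
κ' along ξ is κ S'. -/
lemma wedge_trace (hz : z ∈ U) :
    kappaC a Z z * traceC a Z' z = kappaC a Z' z * traceC a Z z := by
  have h := Finset.sum_congr rfl fun j (_ : j ∈ Finset.univ) =>
    congrArg (a j * ·) (bracket_xiC ha hU hb hS hS' hcomm j hz)
  simp only [Finset.mul_sum] at h
  rw [Finset.sum_comm, Finset.sum_comm (f := fun j n => a j * (xiC Z' n z * _))] at h
  have e : ∀ {Z Z' : J1 4 → J1 4}, (veronese4 a).IsLocalSymmetry U Z' →
      ∑ n, ∑ j, a j * (xiC Z n z * dirD (ex n) (xiC Z' j) z) = kappaC a Z z * traceC a Z' z := by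
    intro Z Z' hS'
    rw [kappaC, Finset.sum_mul]
    refine Finset.sum_congr rfl fun n _ => ?_
    have h1 := (hasDirD_kappaC ha hU hb hS' n hz).2
    have hd := fun (i : Fin 4) =>
      HasDirD.of_contDiffOn (v := ex n) hU (xiC_contDiffOn hS'.field.smooth i) hz
    have h2 := (HasDirD.sum (s := Finset.univ) fun j _ => (HasDirD.const (a j)).mul (hd j)).2
    have h3 : ∑ j, (0 * xiC Z' j z + a j * dirD (ex n) (xiC Z' j) z) = a n * traceC a Z' z :=
      h2.symm.trans h1
    simp only [zero_mul, zero_add] at h3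
    calc _ = xiC Z n z * ∑ j, a j * dirD (ex n) (xiC Z' j) z := by
          rw [Finset.mul_sum]
          exact Finset.sum_congr rfl fun j _ => by ring
      _ = _ := by rw [h3]; ring
  rwa [e hS', e hS] at h

/-- The η-component of the bracket: since ∂_k η' = τ' a_k, the horizontal part of the derivative of
η' along Z is κ τ'. -/
lemma wedge_eta (hz : z ∈ U) :
    kappaC a Z z * tauC a Z' z - kappaC a Z' z * tauC a Z z
      + (etaC Z z * dirD eu (etaC Z') z - etaC Z' z * dirD eu (etaC Z) z) = 0 := by
  have h := (dirD_eq_of_lieBracket hU hS.field.smooth hS'.field.smooth hz (hcomm z hz)).2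
  have hp : ∀ {Z : J1 4 → J1 4}, (veronese4 a).IsLocalSymmetry U Z → ∀ k,
      dirD (ep k) (etaC Z) z = 0 := fun hS k =>
    hS.etaC_ep (isQuasilinear_veronese4 a) hU hb (by norm_num) hz k
  rw [dirD_eq_sum, dirD_eq_sum (Z' z)] at h
  simp only [hp hS, hp hS', dirD_etaC ha hU hb hS _ hz, dirD_etaC ha hU hb hS' _ hz, mul_zero,
    Finset.sum_const_zero, add_zero] at h
  have e : ∀ (Z : J1 4 → J1 4) (t : ℝ), ∑ i, (Z z).1 i * (t * a i) = kappaC a Z z * t := by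
    intro Z t
    rw [kappaC, Finset.sum_mul]
    exact Finset.sum_congr rfl fun i _ => by rw [xiC]; ring
  rw [e, e] at h
  simp only [etaC] at h ⊢
  linear_combination h

/-- Applied to the component ξ_0 of a symmetry, the operator (a_0/a_1)(x_0 - x_1) ∂_1 - 1 gives b_0
- ξ_0 = -(α x_0 + β). Applied to the vanishing ξ_0-component of the bracket it extracts the bracket
of the affine parts, which is α ∧ β up to sign. -/
lemma wedge_slope (hz : z ∈ U) :
    slopeC a Z z * shiftC a Z' z = slopeC a Z' z * shiftC a Z z := by
  have hx := fun {i j : Fin 4} (hij : i ≠ j) => sub_ne_zero_of_mem hb hz hij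
  have hd : ∀ {Z : J1 4 → J1 4}, (veronese4 a).IsLocalSymmetry U Z → ∀ i,
      HasDirD (xiC Z i) (dirD (ex 1) (xiC Z i) z) (ex 1) z := fun hS i =>
    HasDirD.of_contDiffOn hU (xiC_contDiffOn hS.field.smooth i) hz
  have hdd : ∀ {Z : J1 4 → J1 4}, (veronese4 a).IsLocalSymmetry U Z → ∀ n,
      HasDirD (dirD (ex n) (xiC Z 0)) (dirD (ex 1) (dirD (ex n) (xiC Z 0)) z) (ex 1) z :=
    fun hS n => HasDirD.of_contDiffOn hU (dirD_contDiffOn hU (xiC_contDiffOn hS.field.smooth 0) _) hz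
  have hs := fun z hz => bracket_xiC ha hU hb hS hS' hcomm 0 hz (z := z)
  have e := HasDirD.eq_of_eqOn (v := ex 1) hU hz hs
    (HasDirD.sum (s := Finset.univ) fun n _ => (hd hS n).mul (hdd hS' n))
    (HasDirD.sum (s := Finset.univ) fun n _ => (hd hS' n).mul (hdd hS n))
  have e0 := hs z hz
  have h2 : ∀ {Z : J1 4 → J1 4}, (veronese4 a).IsLocalSymmetry U Z → ∀ n,
      dirD (ex 1) (dirD (ex n) (xiC Z 0)) z = (dirD (ex n) (bC a Z 0) z * a 1
        - a 0 * ((ex n).1 0 - (ex n).1 1) * dirD (ex 1) (xiC Z 0) z)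
          / (a 0 * (z.1 0 - z.1 1)) := by
    intro Z hS n
    rw [eq_div_iff (mul_ne_zero (ha 0) (hx (by decide)))]
    linear_combination dirD_dirD_xiC ha hU hb hS (i := 0) (j := 1) (by decide) (ex n) hz
  simp only [Fin.sum_univ_four, h2 hS, h2 hS', ex_fst] at e e0
  simp (decide := true) only [dirD_bC ha hU hb hS (j := 0) (k := 1) (by decide) hz,
    dirD_bC ha hU hb hS (j := 0) (k := 2) (by decide) hz,
    dirD_bC ha hU hb hS (j := 0) (k := 3) (by decide) hz,
    dirD_bC_self ha hU hb hS 0 hz, dirD_xiC_self ha hU hb hS 0 hz, dirD_xiC_self ha hU hb hS 1 hz,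
    dirD_xiC ha hU hb hS (i := 0) (j := 1) (by decide) hz,
    dirD_xiC ha hU hb hS (i := 0) (j := 2) (by decide) hz,
    dirD_xiC ha hU hb hS (i := 0) (j := 3) (by decide) hz,
    dirD_xiC ha hU hb hS (i := 2) (j := 1) (by decide) hz,
    dirD_xiC ha hU hb hS (i := 3) (j := 1) (by decide) hz,
    dirD_bC ha hU hb hS' (j := 0) (k := 1) (by decide) hz,
    dirD_bC ha hU hb hS' (j := 0) (k := 2) (by decide) hz,
    dirD_bC ha hU hb hS' (j := 0) (k := 3) (by decide) hz,
    dirD_bC_self ha hU hb hS' 0 hz, dirD_xiC_self ha hU hb hS' 0 hz,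
    dirD_xiC_self ha hU hb hS' 1 hz,
    dirD_xiC ha hU hb hS' (i := 0) (j := 1) (by decide) hz,
    dirD_xiC ha hU hb hS' (i := 0) (j := 2) (by decide) hz,
    dirD_xiC ha hU hb hS' (i := 0) (j := 3) (by decide) hz,
    dirD_xiC ha hU hb hS' (i := 2) (j := 1) (by decide) hz,
    dirD_xiC ha hU hb hS' (i := 3) (j := 1) (by decide) hz, Fin.sum_univ_four,
    if_true, if_false, sub_self, div_zero, zero_add, add_zero, sub_zero, mul_one, mul_zero,
    zero_mul, zero_sub,
    xiC_eq ha hU hb hS _ hz, xiC_eq ha hU hb hS' _ hz] at e e0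
  have x01 := hx (by decide : (0 : Fin 4) ≠ 1)
  have x02 := hx (by decide : (0 : Fin 4) ≠ 2)
  have x03 := hx (by decide : (0 : Fin 4) ≠ 3)
  have x12 := hx (by decide : (1 : Fin 4) ≠ 2)
  have x13 := hx (by decide : (1 : Fin 4) ≠ 3)
  have a0 := ha 0
  have a1 := ha 1
  have a2 := ha 2
  have a3 := ha 3
  clear hx hd hdd hs h2
  rw [← neg_sub (z.1 0) (z.1 1), ← neg_sub (z.1 0) (z.1 2), ← neg_sub (z.1 0) (z.1 3)] at e e0
  rw [← neg_sub (z.1 1) (z.1 2), ← neg_sub (z.1 1) (z.1 3)] at e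
  generalize bC a Z 0 z = b0 at *
  generalize bC a Z 1 z = b1 at *
  generalize bC a Z 2 z = b2 at *
  generalize bC a Z 3 z = b3 at *
  generalize bC a Z' 0 z = c0 at *
  generalize bC a Z' 1 z = c1 at *
  generalize bC a Z' 2 z = c2 at *
  generalize bC a Z' 3 z = c3 at *
  -- This is the operator described above: the relation `e0` is subtracted from a multiple of its
  -- x_1-derivative `e`.
  linear_combination (norm := skip) -e0 + a 0 / a 1 * (z.1 0 - z.1 1) * e
  field_simp
  ring

end FourDim

lemma PDE.IsLocalSymmetry.mono {d : ℕ} {A : PDE d} {U V : Set (J1 d)} {Z : J1 d → J1 d}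
    (h : A.IsLocalSymmetry U Z) (hVU : V ⊆ U) : A.IsLocalSymmetry V Z :=
  ⟨⟨h.field.smooth.mono hVU, fun z hz => h.field.contact z (hVU hz)⟩,
    fun z hz => h.tangent z (hVU hz)⟩

/-! ### Dimension four: no simply transitive abelian algebra. -/

section FourDim

variable {a : Fin 4 → ℝ} {U : Set (J1 4)} {Z : Fin 4 → J1 4 → J1 4} {z : J1 4}

variable (ha : ∀ i, a i ≠ 0) (hU : IsOpen U)
  (hb : ∀ z ∈ U, ∀ i j, i ≠ j → webCoeff (dualForm a) i j z ≠ 0)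
  (hS : ∀ c, (veronese4 a).IsLocalSymmetry U (Z c))

include ha hU hb hS

/-- If α, β and S vanish, then ξ = b and the pair is (0, b); κ = 0 supplies Σ a_n b_n = 0, so `hL`
gives b = 0. Then ξ and its first derivatives vanish, and ζ vanishes because τ and η_u do. -/
lemma eq_zero_of_combo_four (hz : z ∈ U)
    (hL : ∀ b : Fin 4 → ℝ, OnLines z.1 (fun i => (a i)⁻¹ ^ 2) (0, b) →
      ∑ n, a n * b n = 0 → b = 0)
    (hli : LinearIndependent ℝ fun c => Z c z) {w : Fin 4 → ℝ}
    (h1 : combo (fun c => slopeC a (Z c) z) w = 0) (h2 : combo (fun c => shiftC a (Z c) z) w = 0)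
    (h3 : combo (fun c => traceC a (Z c) z) w = 0) (h4 : combo (fun c => kappaC a (Z c) z) w = 0)
    (h5 : combo (fun c => etaC (Z c) z) w = 0) (h6 : combo (fun c => dirD eu (etaC (Z c)) z) w = 0)
    (h7 : combo (fun c => tauC a (Z c) z) w = 0) : w = 0 := by
  simp only [combo_apply] at h1 h2 h3 h4 h6 h7
  have hlin := OnLines.sum (fun c => onLines ha hU hb (hS c) hz) w
  have hξ : ∀ i, ∑ c, xiC (Z c) i z * w c = ∑ c, w c * bC a (Z c) i z := fun i => by
    have : ∀ c, xiC (Z c) i z * w c = w c * bC a (Z c) i z + z.1 i * (slopeC a (Z c) z * w c)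
        + shiftC a (Z c) z * w c := fun c => by
      rw [xiC_eq ha hU hb (hS c) i hz]
      ring
    simp only [this, Finset.sum_add_distrib, ← Finset.mul_sum, h1, h2, mul_zero, add_zero]
  have hpair : ∑ c, w c • webPair a (Z c) z = (0, fun n => ∑ c, w c * bC a (Z c) n z) := by
    refine Prod.ext ?_ (funext fun n => ?_)
    · have : ∑ c, (traceC a (Z c) z * w c - slopeC a (Z c) z * w c) = 0 := by
        rw [Finset.sum_sub_distrib, h1, h3, sub_zero]
      simp only [Prod.fst_sum, Prod.smul_fst, webPair, smul_eq_mul]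
      rw [← this]
      exact Finset.sum_congr rfl fun c _ => by ring
    · simp [Prod.snd_sum, webPair]
  rw [hpair] at hlin
  have hb0 := hL _ hlin (by
    rw [← h4]
    simp only [← hξ, kappaC, Finset.mul_sum, Finset.sum_mul]
    rw [Finset.sum_comm]
    exact Finset.sum_congr rfl fun c _ => Finset.sum_congr rfl fun n _ => by ring)
  have hb1 : ∀ n, ∑ c, w c * bC a (Z c) n z = 0 := fun n => congrFun hb0 n
  have hξd : ∀ i j, ∑ c, w c * dirD (ex j) (xiC (Z c) i) z = 0 := by
    intro i j
    rcases eq_or_ne i j with rfl | hij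
    · have : ∀ c, w c * dirD (ex i) (xiC (Z c) i) z = traceC a (Z c) z * w c
          - ∑ n, (z.1 n - z.1 i)⁻¹ * (w c * bC a (Z c) n z) := fun c => by
        rw [dirD_xiC_self ha hU hb (hS c) i hz, mul_sub, Finset.mul_sum]
        congr 1
        · ring
        · exact Finset.sum_congr rfl fun n _ => by ring
      simp only [this, Finset.sum_sub_distrib, h3]
      rw [Finset.sum_comm]
      simp only [← Finset.mul_sum, hb1, mul_zero, Finset.sum_const_zero, sub_zero]
    · have : ∀ c, w c * dirD (ex j) (xiC (Z c) i) z
          = (a j / (a i * (z.1 i - z.1 j))) * (w c * bC a (Z c) i z) := fun c => by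
        rw [dirD_xiC ha hU hb (hS c) hij hz]
        ring
      simp only [this, ← Finset.mul_sum, hb1, mul_zero]
  refine eq_zero_of_combo hli (fun k => ?_) h5 fun k => ?_
  · rw [combo_apply, hξ, hb1]
  · rw [combo_apply]
    have : ∀ c, zetaC (Z c) k z * w c = a k * (tauC a (Z c) z * w c)
        + z.2.2 k * (dirD eu (etaC (Z c)) z * w c)
        - ∑ i, z.2.2 i * (w c * dirD (ex k) (xiC (Z c) i) z) := fun c => by
      rw [(hS c).field.zetaC_eq hU hz, sub_mul, Finset.sum_mul]
      simp only [totD, dirD_etaC ha hU hb (hS c) _ hz, dirD_xiC_eu ha hU hb (hS c) _ hz]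
      congr 1
      · ring
      · exact Finset.sum_congr rfl fun n _ => by ring
    simp only [this, Finset.sum_sub_distrib, Finset.sum_add_distrib, ← Finset.mul_sum, h6, h7]
    rw [Finset.sum_comm]
    simp only [← Finset.mul_sum, hξd, mul_zero, Finset.sum_const_zero, sub_zero, add_zero]

/-- Constancy lets the subspace where α = β = 0 be chosen at one point and used at every other
point. -/
lemma slopeC_const (hconv : Convex ℝ U) (c : Fin 4) {z z' : J1 4} (hz : z ∈ U) (hz' : z' ∈ U) :
    slopeC a (Z c) z = slopeC a (Z c) z' ∧ shiftC a (Z c) z = shiftC a (Z c) z' := by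
  have key : ∀ f : J1 4 → ℝ, ContDiffOn ℝ ∞ f U → (∀ v, ∀ z ∈ U, dirD v f z = 0) → f z = f z' := by
    intro f hf h
    refine hU.is_const_of_fderiv_eq_zero (𝕜 := ℝ) hconv.isPreconnected
      (hf.differentiableOn (by simp)) (fun y hy => ?_) hz hz'
    exact ContinuousLinearMap.ext fun v => h v y hy
  exact ⟨key _ (slopeC_contDiffOn hU hb (hS c)) fun v z hz => (dirD_slopeC ha hU hb (hS c) v hz).1,
    key _ (shiftC_contDiffOn hU hb (hS c)) fun v z hz => (dirD_slopeC ha hU hb (hS c) v hz).2⟩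

omit ha hU hb hS in
lemma combo_wedge_add {n : ℕ} {f g f' g' : Fin n → ℝ}
    (h : ∀ a b, f a * g b - f b * g a + (f' a * g' b - f' b * g' a) = 0) (v w : Fin n → ℝ) :
    combo f v * combo g w - combo f w * combo g v
      + (combo f' v * combo g' w - combo f' w * combo g' v) = 0 := by
  have e : ∀ (f g : Fin n → ℝ) (v w : Fin n → ℝ), combo f v * combo g w
      = ∑ a, ∑ b, f a * g b * (v a * w b) := fun f g v w => by
    simp only [combo_apply, Finset.sum_mul_sum]
    exact Finset.sum_congr rfl fun a _ => Finset.sum_congr rfl fun b _ => by ring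
  rw [e f g v, e f' g' v, mul_comm (combo f w), mul_comm (combo f' w), e g f v, e g' f' v]
  simp only [← Finset.sum_sub_distrib, ← Finset.sum_add_distrib]
  refine Finset.sum_eq_zero fun a _ => Finset.sum_eq_zero fun b _ => ?_
  linear_combination (v a * w b) * h a b

/-- On the subspace where α = β = 0, of dimension at least three, two cases arise. If κ is non-zero
somewhere, the relation for η makes τ redundant at that point. If κ vanishes identically, so does
its derivative a_0 S, and S is redundant. Either way at most two further dimensions are lost. -/
lemma not_simplyTransitive_four_of_convex (hconv : Convex ℝ U) (hne : U.Nonempty)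
    (hL : ∀ z ∈ U, ∀ b : Fin 4 → ℝ, OnLines z.1 (fun i => (a i)⁻¹ ^ 2) (0, b) →
      ∑ n, a n * b n = 0 → b = 0)
    (hcomm : ∀ c e, ∀ z ∈ U, VectorField.lieBracket ℝ (Z c) (Z e) z = 0) :
    ¬ ∀ z ∈ U, LinearIndependent ℝ fun c => Z c z := by
  intro hli
  obtain ⟨z₀, hz₀⟩ := hne
  obtain ⟨S, -, hS1, hS2⟩ := exists_le_of_wedge_eq_zero (⊤ : Submodule ℝ (Fin 4 → ℝ)) _ _
    (fun v _ w _ => combo_wedge (fun c e => wedge_slope ha hU hb (hS c) (hS e) (hcomm c e) hz₀) v w)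
  rw [finrank_top, Module.finrank_fin_fun] at hS1
  have hS2' : ∀ z ∈ U, ∀ w ∈ S, combo (fun c => slopeC a (Z c) z) w = 0 ∧
      combo (fun c => shiftC a (Z c) z) w = 0 := by
    intro z hz w hw
    have := fun c => slopeC_const ha hU hb hS hconv c hz hz₀
    simpa only [this] using hS2 w hw
  have hfin := fun {z} (hz : z ∈ U) {w} => eq_zero_of_combo_four ha hU hb hS hz (hL z hz)
    (hli z hz) (w := w)
  have hwη := fun {z} (hz : z ∈ U) v w => combo_wedge_add (fun c e =>
    wedge_eta ha hU hb (hS c) (hS e) (hcomm c e) hz) v w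
  have hwκ := fun {z} (hz : z ∈ U) v w => combo_wedge (fun c e =>
    wedge_trace ha hU hb (hS c) (hS e) (hcomm c e) hz) v w
  by_cases hκ : ∃ z ∈ U, ∃ w ∈ S, combo (fun c => kappaC a (Z c) z) w ≠ 0
  · obtain ⟨z, hz, w₁, hw₁, hκ⟩ := hκ
    obtain ⟨T, hTS, hT1, hT2⟩ := exists_le_of_wedge_eq_zero S _ _
      (fun v _ w _ => hwκ hz v w)
    obtain ⟨R, hRT, hR1, hR2⟩ := exists_le_of_wedge_eq_zero T
      (combo fun c => etaC (Z c) z) (combo fun c => dirD eu (etaC (Z c)) z)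
      (fun v hv w hw => by
        have := hwη hz v w
        rw [(hT2 v hv).1, (hT2 w hw).1] at this
        linarith)
    obtain ⟨w, hw, hw0⟩ := exists_ne_zero_of_finrank_pos R (by omega)
    obtain ⟨e1, e2⟩ := hS2' z hz w (hTS (hRT hw))
    obtain ⟨e3, e4⟩ := hT2 w (hRT hw)
    obtain ⟨e5, e6⟩ := hR2 w hw
    refine hw0 (hfin hz e1 e2 e4 e3 e5 e6 ?_)
    -- Pairing w with w₁ leaves κ(w₁) τ(w) = 0, which gives τ(w) = 0 without a further loss of
    -- dimension.
    have := hwη hz w₁ w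
    rw [e3, e5, e6] at this
    simp only [zero_mul, mul_zero, sub_zero, add_zero] at this
    exact (mul_eq_zero.1 this).resolve_left hκ
  · push Not at hκ
    -- Here κ vanishes on an open set for every w in the subspace, so its x_0-derivative a_0 S
    -- vanishes too.
    have hδ : ∀ w ∈ S, combo (fun c => traceC a (Z c) z₀) w = 0 := by
      intro w hw
      have h1 : HasDirD (fun z => ∑ c, kappaC a (Z c) z * w c)
          (∑ c, (a 0 * traceC a (Z c) z₀ * w c + kappaC a (Z c) z₀ * 0)) (ex 0) z₀ :=
        HasDirD.sum fun c _ => (hasDirD_kappaC ha hU hb (hS c) 0 hz₀).mul (HasDirD.const (w c))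
      have h2 := HasDirD.eq_of_eqOn hU hz₀ (fun z hz => by
        rw [← combo_apply]
        exact hκ z hz w hw) h1 (HasDirD.const 0)
      rw [combo_apply]
      refine mul_left_cancel₀ (ha 0) ?_
      rw [mul_zero, ← h2, Finset.mul_sum]
      exact Finset.sum_congr rfl fun c _ => by ring
    obtain ⟨R, hRT, hR1, hR2⟩ := exists_le_of_wedge_eq_zero S
      (combo fun c => etaC (Z c) z₀) (combo fun c => dirD eu (etaC (Z c)) z₀)
      (fun v hv w hw => by
        have := hwη hz₀ v w
        rw [hκ _ hz₀ v hv, hκ _ hz₀ w hw] at this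
        linarith)
    have hR3 := finrank_le_finrank_inf_ker R (combo fun c => tauC a (Z c) z₀)
    -- One dimension each is lost to (α, β), to (η, η_u) and to τ; a line remains.
    obtain ⟨w, hw, hw0⟩ := exists_ne_zero_of_finrank_pos
      (R ⊓ LinearMap.ker (combo fun c => tauC a (Z c) z₀)) (by omega)
    obtain ⟨e1, e2⟩ := hS2' z₀ hz₀ w (hRT hw.1)
    obtain ⟨e5, e6⟩ := hR2 w hw.1
    exact hw0 (hfin hz₀ e1 e2 (hδ w (hRT hw.1)) (hκ _ hz₀ w (hRT hw.1)) e5 e6 hw.2)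

theorem not_simplyTransitive_four (hne : U.Nonempty) (hneq : ∃ i j, |a i| ≠ |a j|)
    (hcomm : ∀ c e, ∀ z ∈ U, VectorField.lieBracket ℝ (Z c) (Z e) z = 0) :
    ¬ ∀ z ∈ U, LinearIndependent ℝ fun c => Z c z := by
  intro hli
  -- The open set is shrunk to a ball on which the line conditions are independent; balls are
  -- convex, as the constancy of α and β requires.
  obtain ⟨D, hD, hD1, hD2⟩ := exists_onLines_det ha hneq
  obtain ⟨z₀, hz₀⟩ := hne
  have hc : Continuous fun x : Fin 4 → ℝ => ((x, z₀.2) : J1 4) := by fun_prop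
  obtain ⟨x, hx, hDx⟩ := hD1 _ (hU.preimage hc) ⟨z₀.1, hz₀⟩
  have hopen : IsOpen (U ∩ {z : J1 4 | D z.1 ≠ 0}) :=
    hU.inter (isOpen_ne_fun (hD.comp continuous_fst) continuous_const)
  obtain ⟨ε, hε, hball⟩ := Metric.isOpen_iff.1 hopen (x, z₀.2) ⟨hx, hDx⟩
  have hsub : Metric.ball ((x, z₀.2) : J1 4) ε ⊆ U := fun z hz => (hball hz).1
  refine not_simplyTransitive_four_of_convex (U := Metric.ball ((x, z₀.2) : J1 4) ε) ha
    Metric.isOpen_ball (fun z hz => hb z (hsub hz)) (fun c => (hS c).mono hsub) (convex_ball _ _)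
    ⟨_, Metric.mem_ball_self hε⟩ (fun z hz => hD2 z.1 (hball hz).2 fun i j hij =>
      sub_ne_zero_of_mem hb (hsub hz) hij) (fun c e z hz => hcomm c e z (hsub hz))
    fun z hz => hli z (hsub hz)

end FourDim

section ContactMaps

variable {d : ℕ}

/-! ### Contact transformations -/

lemma contactForm_add (z u v : J1 d) : contactForm z (u + v) = contactForm z u + contactForm z v := by
  simp [contactForm, mul_add, Finset.sum_add_distrib]
  ring

lemma contactForm_smul (z v : J1 d) (c : ℝ) : contactForm z (c • v) = c * contactForm z v := by
  simp only [contactForm, Prod.smul_fst, Prod.smul_snd, Pi.smul_apply, smul_eq_mul, mul_sub,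
    Finset.mul_sum]
  congr 1
  exact Finset.sum_congr rfl fun i _ => by ring

lemma contactForm_eu (z : J1 d) : contactForm z eu = 1 := by
  simp [contactForm, eu]

lemma contactForm_sub_smul (z v : J1 d) : contactForm z (v + (-contactForm z v) • eu) = 0 := by
  rw [contactForm_add, contactForm_smul, contactForm_eu]
  ring

lemma HasDirD.contactForm {E : Type*} [NormedAddCommGroup E] [NormedSpace ℝ E] {φ ψ : E → J1 d}
    {φ' ψ' : E →L[ℝ] J1 d} {z : E} (hφ : HasFDerivAt φ φ' z) (hψ : HasFDerivAt ψ ψ' z) (v : E) :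
    HasDirD (fun y => contactForm (φ y) (ψ y))
      (JetPDE.contactForm (φ z) (ψ' v) - ∑ i, (φ' v).2.2 i * (ψ z).1 i) v z := by
  have h1 : ∀ i, HasDirD (fun y => (φ y).2.2 i) ((φ' v).2.2 i) v z := fun i =>
    HasFDerivAt.hasDirD (((ContinuousLinearMap.proj (R := ℝ) (φ := fun _ : Fin d => ℝ) i).comp
      ((ContinuousLinearMap.snd ℝ ℝ (Fin d → ℝ)).comp
      (ContinuousLinearMap.snd ℝ (Fin d → ℝ) (ℝ × (Fin d → ℝ))))).hasFDerivAt.comp z hφ)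
  have h2 : ∀ i, HasDirD (fun y => (ψ y).1 i) ((ψ' v).1 i) v z := fun i =>
    HasFDerivAt.hasDirD (((ContinuousLinearMap.proj (R := ℝ) (φ := fun _ : Fin d => ℝ) i).comp
      (ContinuousLinearMap.fst ℝ (Fin d → ℝ) (ℝ × (Fin d → ℝ)))).hasFDerivAt.comp z hψ)
  have h3 : HasDirD (fun y => (ψ y).2.1) ((ψ' v).2.1) v z :=
    HasFDerivAt.hasDirD (((ContinuousLinearMap.fst ℝ ℝ (Fin d → ℝ)).comp
      (ContinuousLinearMap.snd ℝ (Fin d → ℝ) (ℝ × (Fin d → ℝ)))).hasFDerivAt.comp z hψ)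
  have := h3.sub (HasDirD.sum (s := Finset.univ) fun i _ => (h1 i).mul (h2 i))
  have e : JetPDE.contactForm (φ z) (ψ' v) - ∑ i, (φ' v).2.2 i * (ψ z).1 i = (ψ' v).2.1
      - ∑ i, ((φ' v).2.2 i * (ψ z).1 i + (φ z).2.2 i * (ψ' v).1 i) := by
    simp only [JetPDE.contactForm, Finset.sum_add_distrib]
    ring
  rw [e]
  exact this

section ContactMap

variable {U : Set (J1 d)} {φ : J1 d → J1 d} (hU : IsOpen U) (hφ : ContDiffOn ℝ ∞ φ U)
  (hc : ∀ z ∈ U, ∀ v, contactForm z v = 0 → contactForm (φ z) (fderiv ℝ φ z v) = 0)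

include hc in
-- Preserving the kernel of the contact form means multiplying the form by a factor, which is read
-- off at ∂/∂u.
lemma contactForm_map {z : J1 d} (hz : z ∈ U) (v : J1 d) :
    contactForm (φ z) (fderiv ℝ φ z v)
      = contactForm (φ z) (fderiv ℝ φ z eu) * contactForm z v := by
  have := hc z hz _ (contactForm_sub_smul z v)
  rw [map_add, map_smul, contactForm_add, contactForm_smul] at this
  linarith

include hU hφ hc

/-- A contact map sends isotropic pairs of contact vectors to isotropic pairs. -/
lemma isotropic_map {z : J1 d} (hz : z ∈ U) {u v : J1 d} (hu : contactForm z u = 0)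
    (hv : contactForm z v = 0) (h : ∑ i, u.2.2 i * v.1 i = ∑ i, v.2.2 i * u.1 i) :
    ∑ i, (fderiv ℝ φ z u).2.2 i * (fderiv ℝ φ z v).1 i
      = ∑ i, (fderiv ℝ φ z v).2.2 i * (fderiv ℝ φ z u).1 i := by
  have hd : HasFDerivAt φ (fderiv ℝ φ z) z :=
    ((hφ.contDiffAt (hU.mem_nhds hz)).differentiableAt (by simp)).hasFDerivAt
  have hd2 : HasFDerivAt (fderiv ℝ φ) (fderiv ℝ (fderiv ℝ φ) z) z :=
    (((hφ.fderiv_of_isOpen hU (m := ∞) (by simp)).contDiffAt (hU.mem_nhds hz)).differentiableAt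
      (by simp)).hasFDerivAt
  have hs : IsSymmSndFDerivAt ℝ φ z :=
    (hφ.contDiffAt (hU.mem_nhds hz)).isSymmSndFDerivAt (by
      rw [minSmoothness_of_isRCLikeNormedField]
      exact WithTop.coe_le_coe.2 (le_top : (2 : ℕ∞) ≤ ⊤))
  have hap : ∀ w : J1 d, HasFDerivAt (fun y => fderiv ℝ φ y w)
      ((fderiv ℝ (fderiv ℝ φ) z).flip w) z := fun w => by
    refine (hd2.clm_apply (hasFDerivAt_const w z)).congr_fderiv ?_
    ext x <;> simp
  -- The pullback identity for the contact form is differentiated along u. Antisymmetrising in u and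
  -- v, where the second derivative of φ cancels, compares the exterior derivatives on the contact
  -- plane.
  have key : ∀ u v : J1 d, contactForm z v = 0 →
      contactForm (φ z) (fderiv ℝ (fderiv ℝ φ) z u v)
        - ∑ i, (fderiv ℝ φ z u).2.2 i * (fderiv ℝ φ z v).1 i
      = - (contactForm (φ z) (fderiv ℝ φ z eu) * ∑ i, u.2.2 i * v.1 i) := by
    intro u v hv
    have h1 := HasDirD.contactForm hd (hap v) u
    have h2 := HasDirD.contactForm hd (hap eu) u
    have h3 := HasDirD.contactForm (hasFDerivAt_id z) (hasFDerivAt_const v z) u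
    have := HasDirD.eq_of_eqOn hU hz (fun y hy => contactForm_map hc hy v) h1 (h2.mul h3)
    simp only [id, hv, mul_zero, zero_add] at this
    rw [ContinuousLinearMap.flip_apply] at this
    rw [this]
    simp [contactForm]
  have e1 := key u v hv
  have e2 := key v u hu
  rw [hs u v] at e1
  rw [h] at e1
  linarith

end ContactMap

variable {Φ : OpenPartialHomeomorph (J1 d) (J1 d)} (hΦ : IsContactTransformation Φ)
include hΦ

lemma IsContactTransformation.symm_fderiv {z : J1 d} (hz : z ∈ Φ.source) (v : J1 d) :
    fderiv ℝ Φ.symm (Φ z) (fderiv ℝ Φ z v) = v := by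
  have h1 : HasFDerivAt Φ (fderiv ℝ Φ z) z :=
    ((hΦ.smooth.contDiffAt (Φ.open_source.mem_nhds hz)).differentiableAt (by simp)).hasFDerivAt
  have h2 : HasFDerivAt Φ.symm (fderiv ℝ Φ.symm (Φ z)) (Φ z) :=
    ((hΦ.smooth_symm.contDiffAt (Φ.open_target.mem_nhds (Φ.map_source hz))).differentiableAt
      (by simp)).hasFDerivAt
  have h3 := (h2.comp z h1).congr_of_eventuallyEq (f₁ := id)
    (Filter.eventuallyEq_of_mem (Φ.open_source.mem_nhds hz) fun y hy => (Φ.left_inv hy).symm)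
  have := h3.unique (hasFDerivAt_id z)
  exact DFunLike.congr_fun this v

lemma IsContactTransformation.fderiv_symm {w : J1 d} (hw : w ∈ Φ.target) (v : J1 d) :
    fderiv ℝ Φ (Φ.symm w) (fderiv ℝ Φ.symm w v) = v := by
  have h1 : HasFDerivAt Φ (fderiv ℝ Φ (Φ.symm w)) (Φ.symm w) :=
    ((hΦ.smooth.contDiffAt (Φ.open_source.mem_nhds (Φ.map_target hw))).differentiableAt
      (by simp)).hasFDerivAt
  have h2 : HasFDerivAt Φ.symm (fderiv ℝ Φ.symm w) w :=
    ((hΦ.smooth_symm.contDiffAt (Φ.open_target.mem_nhds hw)).differentiableAt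
      (by simp)).hasFDerivAt
  have h3 := (h1.comp w h2).congr_of_eventuallyEq (f₁ := id)
    (Filter.eventuallyEq_of_mem (Φ.open_target.mem_nhds hw) fun y hy => (Φ.right_inv hy).symm)
  have := h3.unique (hasFDerivAt_id w)
  exact DFunLike.congr_fun this v

/-- The conformal factor of Φ cannot vanish, since some vector is mapped to ∂/∂u. -/
lemma IsContactTransformation.contact_symm {w : J1 d} (hw : w ∈ Φ.target) (v : J1 d)
    (hv : contactForm w v = 0) : contactForm (Φ.symm w) (fderiv ℝ Φ.symm w v) = 0 := by
  have hz := Φ.map_target hw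
  have h1 := contactForm_map hΦ.contact hz (fderiv ℝ Φ.symm w v)
  have h2 := contactForm_map hΦ.contact hz (fderiv ℝ Φ.symm w eu)
  rw [hΦ.fderiv_symm hw, Φ.right_inv hw] at h1 h2
  rw [hv] at h1
  rw [contactForm_eu] at h2
  exact (mul_eq_zero.1 h1.symm).resolve_left fun h0 => by rw [h0, zero_mul] at h2; norm_num at h2

/-- The vector field which `Φ` maps to the constant field `e`. -/
def pullConst (Φ : OpenPartialHomeomorph (J1 d) (J1 d)) (e : J1 d) (z : J1 d) : J1 d :=
  fderiv ℝ Φ.symm (Φ z) e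

lemma pullConst_contDiffOn (e : J1 d) : ContDiffOn ℝ ∞ (pullConst Φ e) Φ.source := by
  have h := (hΦ.smooth_symm.fderiv_of_isOpen Φ.open_target (m := ∞) (by simp)).comp hΦ.smooth
    fun z hz => Φ.map_source hz
  exact h.clm_apply contDiffOn_const

lemma hasFDerivAt_fderiv_symm {w : J1 d} (hw : w ∈ Φ.target) :
    HasFDerivAt (fderiv ℝ Φ.symm) (fderiv ℝ (fderiv ℝ Φ.symm) w) w :=
  (((hΦ.smooth_symm.fderiv_of_isOpen Φ.open_target (m := ∞) (by simp)).contDiffAt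
    (Φ.open_target.mem_nhds hw)).differentiableAt (by simp)).hasFDerivAt

/-- The second derivative of Φ⁻¹ is written with e as first argument; its symmetry then yields both
the vanishing of brackets and the derivative of the flow. -/
lemma fderiv_pullConst (e : J1 d) {z : J1 d} (hz : z ∈ Φ.source) (v : J1 d) :
    fderiv ℝ (pullConst Φ e) z v
      = fderiv ℝ (fderiv ℝ Φ.symm) (Φ z) e (fderiv ℝ Φ z v) := by
  have hw := Φ.map_source hz
  have h1 : HasFDerivAt Φ (fderiv ℝ Φ z) z :=
    ((hΦ.smooth.contDiffAt (Φ.open_source.mem_nhds hz)).differentiableAt (by simp)).hasFDerivAt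
  have hs : IsSymmSndFDerivAt ℝ Φ.symm (Φ z) :=
    (hΦ.smooth_symm.contDiffAt (Φ.open_target.mem_nhds hw)).isSymmSndFDerivAt (by
      rw [minSmoothness_of_isRCLikeNormedField]
      exact WithTop.coe_le_coe.2 (le_top : (2 : ℕ∞) ≤ ⊤))
  have h2 := ((hasFDerivAt_fderiv_symm hΦ hw).comp z h1).clm_apply (hasFDerivAt_const e z)
  have h3 : fderiv ℝ (pullConst Φ e) z = _ := h2.fderiv
  rw [h3, hs e]
  simp

lemma lieBracket_pullConst (e e' : J1 d) {z : J1 d} (hz : z ∈ Φ.source) :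
    VectorField.lieBracket ℝ (pullConst Φ e) (pullConst Φ e') z = 0 := by
  have h : ∀ e, fderiv ℝ Φ z (pullConst Φ e z) = e := fun e => by
    have := hΦ.fderiv_symm (Φ.map_source hz) e
    rwa [Φ.left_inv hz] at this
  have hs : IsSymmSndFDerivAt ℝ Φ.symm (Φ z) :=
    (hΦ.smooth_symm.contDiffAt (Φ.open_target.mem_nhds (Φ.map_source hz))).isSymmSndFDerivAt (by
      rw [minSmoothness_of_isRCLikeNormedField]
      exact WithTop.coe_le_coe.2 (le_top : (2 : ℕ∞) ≤ ⊤))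
  rw [VectorField.lieBracket, fderiv_pullConst hΦ e' hz, fderiv_pullConst hΦ e hz, h, h, hs e e',
    sub_self]

lemma linearIndependent_pullConst {n : ℕ} {e : Fin n → J1 d} (he : LinearIndependent ℝ e)
    {z : J1 d} (hz : z ∈ Φ.source) : LinearIndependent ℝ fun i => pullConst Φ (e i) z := by
  refine he.map' (fderiv ℝ Φ.symm (Φ z) : J1 d →ₗ[ℝ] J1 d) (LinearMap.ker_eq_bot.2 ?_)
  intro u v huv
  have := congrArg (fderiv ℝ Φ (Φ.symm (Φ z))) huv
  simpa [hΦ.fderiv_symm (Φ.map_source hz)] using this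

end ContactMaps

/-! ### Flows of pulled-back translations acting on 2-jets. -/

section Equivalence

variable {d : ℕ}

/-- `lift θ` as a linear map. -/
def liftL (θ : J2 d) : (Fin d → ℝ) →L[ℝ] J1 d :=
  LinearMap.toContinuousLinearMap
    { toFun := lift θ
      map_add' := fun u v => by
        refine Prod.ext rfl (Prod.ext ?_ (funext fun k => ?_)) <;>
          simp [lift, mul_add, Finset.sum_add_distrib]
      map_smul' := fun c v => by
        refine Prod.ext rfl (Prod.ext ?_ (funext fun k => ?_)) <;>
          simp only [lift, Pi.smul_apply, smul_eq_mul, RingHom.id_apply, Prod.smul_snd,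
            Prod.smul_fst, Finset.mul_sum] <;>
          exact Finset.sum_congr rfl fun i _ => by ring }

@[simp] lemma liftL_apply (θ : J2 d) (v : Fin d → ℝ) : liftL θ v = lift θ v := rfl

lemma mem_jetPlane {θ : J2 d} {w : J1 d} : w ∈ jetPlane θ ↔ w = lift θ w.1 := by
  have h : jetPlane θ = LinearMap.range (liftL θ : (Fin d → ℝ) →ₗ[ℝ] J1 d) := by
    refine le_antisymm (Submodule.span_le.2 ?_) ?_
    · rintro _ ⟨v, rfl⟩
      exact ⟨v, rfl⟩
    · rintro _ ⟨v, rfl⟩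
      exact Submodule.subset_span ⟨v, rfl⟩
  rw [h]
  constructor
  · rintro ⟨v, rfl⟩
    rfl
  · intro hw
    exact ⟨w.1, hw.symm⟩

lemma lift_mem_jetPlane (θ : J2 d) (v : Fin d → ℝ) : lift θ v ∈ jetPlane θ :=
  Submodule.subset_span ⟨v, rfl⟩

lemma contactForm_lift (θ : J2 d) (v : Fin d → ℝ) : contactForm θ.1 (lift θ v) = 0 := by
  simp [contactForm, lift]

lemma isotropic_lift (θ : J2 d) (u v : Fin d → ℝ) :
    ∑ i, (lift θ u).2.2 i * (lift θ v).1 i = ∑ i, (lift θ v).2.2 i * (lift θ u).1 i := by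
  simp only [lift, Finset.sum_mul]
  rw [Finset.sum_comm]
  refine Finset.sum_congr rfl fun i _ => Finset.sum_congr rfl fun j _ => ?_
  have : θ.2.1 i j = θ.2.1 j i := θ.2.2 i j
  rw [this]
  ring

lemma eq_of_lift_eq {θ θ' : J2 d} (h1 : θ.1 = θ'.1) (h2 : ∀ v, lift θ v = lift θ' v) : θ = θ' := by
  refine Prod.ext h1 (Subtype.ext (funext fun i => funext fun j => ?_))
  have := congrFun (congrArg (fun w : J1 d => w.2.2) (h2 (Pi.single i 1))) j
  simpa [lift, Pi.single_apply] using this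

/-- The matrix of `N ∘ M⁻¹`. -/
def quotMatrix (M N : (Fin d → ℝ) →L[ℝ] (Fin d → ℝ)) : Fin d → Fin d → ℝ :=
  fun i j => N (Ring.inverse M (Pi.single j 1)) i

/-- A plane that is a graph over x and isotropic for the symplectic form is the graph of a symmetric
matrix. -/
lemma quotMatrix_symm {M N : (Fin d → ℝ) →L[ℝ] (Fin d → ℝ)} (hM : IsUnit M)
    (h : ∀ u v, ∑ i, N u i * M v i = ∑ i, N v i * M u i) (i j : Fin d) :
    quotMatrix M N i j = quotMatrix M N j i := by
  have hinv : ∀ v, M (Ring.inverse M v) = v := fun v =>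
    DFunLike.congr_fun (Ring.mul_inverse_cancel M hM) v
  have := h (Ring.inverse M (Pi.single j 1)) (Ring.inverse M (Pi.single i 1))
  simp only [hinv] at this
  simpa [quotMatrix, Pi.single_apply] using this

lemma quotMatrix_mulVec {M N : (Fin d → ℝ) →L[ℝ] (Fin d → ℝ)} (hM : IsUnit M) (v : Fin d → ℝ)
    (k : Fin d) : ∑ i, quotMatrix M N k i * M v i = N v k := by
  have hinv : ∀ v, Ring.inverse M (M v) = v := fun v =>
    DFunLike.congr_fun (Ring.inverse_mul_cancel M hM) v
  conv_rhs => rw [← hinv v]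
  have h2 : ∀ w : Fin d → ℝ, N (Ring.inverse M w) k = ∑ i, w i * N (Ring.inverse M (Pi.single i 1)) k := by
    intro w
    conv_lhs => rw [pi_eq_sum_univ' w]
    simp
  rw [h2]
  exact Finset.sum_congr rfl fun i _ => by rw [quotMatrix]; ring

/-- Symmetrization as a linear map. -/
def symmL : (Fin d → Fin d → ℝ) →L[ℝ] Sym d :=
  LinearMap.toContinuousLinearMap
    { toFun := symm
      map_add' := fun A B => Subtype.ext (funext fun i => funext fun j => by
        change (A i j + B i j + (A j i + B j i)) / 2 = (A i j + A j i) / 2 + (B i j + B j i) / 2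
        ring)
      map_smul' := fun c A => Subtype.ext (funext fun i => funext fun j => by
        change (c * A i j + c * A j i) / 2 = c * ((A i j + A j i) / 2)
        ring) }

lemma symm_apply (H : Fin d → Fin d → ℝ) (i j : Fin d) : (symm H).1 i j = (H i j + H j i) / 2 := rfl

lemma symm_of_symmetric {H : Fin d → Fin d → ℝ} (h : ∀ i j, H i j = H j i) (i j : Fin d) :
    (symm H).1 i j = H i j := by
  rw [symm_apply, ← h i j]
  ring

lemma symm_coe (H : Sym d) : symm H.1 = H :=
  Subtype.ext (funext fun i => funext fun j => symm_of_symmetric H.2 i j)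

lemma hasDerivAt_quotMatrix {M N : ℝ → (Fin d → ℝ) →L[ℝ] (Fin d → ℝ)}
    {M' N' : (Fin d → ℝ) →L[ℝ] (Fin d → ℝ)} (hM : HasDerivAt M M' 0) (hN : HasDerivAt N N' 0)
    (hM0 : M 0 = 1) :
    HasDerivAt (fun t => quotMatrix (M t) (N t))
      (fun i j => N' (Pi.single j 1) i - N 0 (M' (Pi.single j 1)) i) 0 := by
  have h1 : HasFDerivAt Ring.inverse (-ContinuousLinearMap.mulLeftRight ℝ
      ((Fin d → ℝ) →L[ℝ] (Fin d → ℝ)) 1 1) (M 0) := by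
    rw [hM0]
    simpa using hasFDerivAt_ringInverse (𝕜 := ℝ) (1 : ((Fin d → ℝ) →L[ℝ] (Fin d → ℝ))ˣ)
  have h2 : HasDerivAt (fun t => Ring.inverse (M t)) (-M') 0 := by
    have e : (-ContinuousLinearMap.mulLeftRight ℝ
      ((Fin d → ℝ) →L[ℝ] (Fin d → ℝ)) 1 1) M' = -M' := by simp
    exact e ▸ h1.comp_hasDerivAt 0 hM
  rw [hasDerivAt_pi]
  intro i
  rw [hasDerivAt_pi]
  intro j
  have h3 := hN.clm_apply (h2.clm_apply (hasDerivAt_const (0 : ℝ) (Pi.single j (1 : ℝ) : Fin d → ℝ)))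
  have h4 := (hasDerivAt_pi.1 h3) i
  refine h4.congr_deriv ?_
  simp [hM0]
  ring

lemma hasDerivAt_add_smul {E : Type*} [NormedAddCommGroup E] [NormedSpace ℝ E] (w e : E) :
    HasDerivAt (fun t : ℝ => w + t • e) e 0 := by
  have := ((hasDerivAt_id (0 : ℝ)).smul_const e).const_add w
  simpa only [one_smul] using! this

lemma hasDerivAt_comp_line {E F G : Type*} [NormedAddCommGroup E] [NormedSpace ℝ E]
    [NormedAddCommGroup F] [NormedSpace ℝ F] [NormedAddCommGroup G] [NormedSpace ℝ G]
    {g : E → F →L[ℝ] G} {g' : E →L[ℝ] F →L[ℝ] G} {w : E} (h : HasFDerivAt g g' w) (e : E)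
    (A : G →L[ℝ] F) : HasDerivAt (fun t : ℝ => (g (w + t • e)).comp A) ((g' e).comp A) 0 := by
  have h2 : HasFDerivAt g g' (w + (0 : ℝ) • e) := by rwa [zero_smul, add_zero]
  have h3 : HasDerivAt (fun t : ℝ => g (w + t • e)) (g' e) 0 :=
    h2.comp_hasDerivAt 0 (hasDerivAt_add_smul w e)
  have h4 := h3.clm_comp (hasDerivAt_const (0 : ℝ) A)
  refine h4.congr_deriv ?_
  simp

lemma hasDerivAt_comp_comp {E F G : Type*} [NormedAddCommGroup E] [NormedSpace ℝ E]
    [NormedAddCommGroup F] [NormedSpace ℝ F] [NormedAddCommGroup G] [NormedSpace ℝ G]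
    {L : ℝ → F →L[ℝ] F} {L' : F →L[ℝ] F} (h : HasDerivAt L L' 0) (p : F →L[ℝ] G) (q : E →L[ℝ] F) :
    HasDerivAt (fun t : ℝ => p.comp ((L t).comp q)) (p.comp (L'.comp q)) 0 := by
  have := (hasDerivAt_const (0 : ℝ) p).clm_comp (h.clm_comp (hasDerivAt_const (0 : ℝ) q))
  refine this.congr_deriv ?_
  simp

section Flow

variable {Φ : OpenPartialHomeomorph (J1 d) (J1 d)} (hΦ : IsContactTransformation Φ) {e : J1 d}
  {z : J1 d} (hz : z ∈ Φ.source)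

/-- The derivative at `z` of the flow `Φ⁻¹ ∘ (translation by t e) ∘ Φ`. -/
def flowD (Φ : OpenPartialHomeomorph (J1 d) (J1 d)) (e z : J1 d) (t : ℝ) : J1 d →L[ℝ] J1 d :=
  (fderiv ℝ Φ.symm (Φ z + t • e)).comp (fderiv ℝ Φ z)

include hz

lemma eventually_mem_target (e : J1 d) : ∀ᶠ t in nhds (0 : ℝ), Φ z + t • e ∈ Φ.target := by
  refine (hasDerivAt_add_smul (Φ z) e).continuousAt.eventually_mem ?_
  rw [zero_smul, add_zero]
  exact Φ.open_target.mem_nhds (Φ.map_source hz)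

include hΦ

lemma hasDerivAt_flow (e : J1 d) :
    HasDerivAt (fun t : ℝ => Φ.symm (Φ z + t • e)) (pullConst Φ e z) 0 := by
  have h2 : HasFDerivAt Φ.symm (fderiv ℝ Φ.symm (Φ z)) (Φ z + (0 : ℝ) • e) := by
    rw [zero_smul, add_zero]
    exact ((hΦ.smooth_symm.contDiffAt (Φ.open_target.mem_nhds (Φ.map_source hz))).differentiableAt
      (by simp)).hasFDerivAt
  exact h2.comp_hasDerivAt 0 (hasDerivAt_add_smul (Φ z) e)

lemma hasDerivAt_flowD (e : J1 d) :
    HasDerivAt (flowD Φ e z) (fderiv ℝ (pullConst Φ e) z) 0 := by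
  have h3 := hasDerivAt_comp_line (hasFDerivAt_fderiv_symm hΦ (Φ.map_source hz)) e (fderiv ℝ Φ z)
  have e2 : fderiv ℝ (pullConst Φ e) z
      = (fderiv ℝ (fderiv ℝ Φ.symm) (Φ z) e).comp (fderiv ℝ Φ z) :=
    ContinuousLinearMap.ext fun v => fderiv_pullConst hΦ e hz v
  rw [e2]
  exact h3

lemma flowD_zero (e v : J1 d) : flowD Φ e z 0 v = v := by
  rw [flowD, zero_smul, add_zero]
  exact hΦ.symm_fderiv hz v

/-- A translation by e with vanishing p-component preserves the contact form, so its conjugate by Φ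
preserves the contact distribution. -/
lemma contactForm_flowD (he : e.2.2 = 0) {v : J1 d} (hv : contactForm z v = 0) {t : ℝ}
    (ht : Φ z + t • e ∈ Φ.target) :
    contactForm (Φ.symm (Φ z + t • e)) (flowD Φ e z t v) = 0 := by
  refine hΦ.contact_symm ht _ ?_
  have := hΦ.contact z hz v hv
  simpa [contactForm, he] using this

/-- Derivative at t = 0 of the preservation of the contact distribution by the flow. -/
lemma isContactField_pullConst (he : e.2.2 = 0) {v : J1 d} (hv : contactForm z v = 0) :
    contactForm z (fderiv ℝ (pullConst Φ e) z v) - ∑ i, (pullConst Φ e z).2.2 i * v.1 i = 0 := by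
  have h1 := HasDirD.contactForm (hasDerivAt_flow hΦ hz e).hasFDerivAt
    ((hasDerivAt_flowD hΦ hz e).clm_apply (hasDerivAt_const (0 : ℝ) v)).hasFDerivAt 1
  have h2 : (fun t : ℝ => contactForm (Φ.symm (Φ z + t • e)) (flowD Φ e z t v))
      =ᶠ[nhds 0] fun _ => 0 := by
    filter_upwards [eventually_mem_target hz e] with t ht
    exact contactForm_flowD hΦ hz he hv ht
  have h3 := h1.2
  rw [dirD, h2.fderiv_eq] at h3
  simp only [zero_smul, add_zero, Φ.left_inv hz, flowD_zero hΦ hz] at h3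
  simpa using h3.symm

lemma isotropic_flowD (he : e.2.2 = 0) {u v : J1 d} (hu : contactForm z u = 0)
    (hv : contactForm z v = 0) (h : ∑ i, u.2.2 i * v.1 i = ∑ i, v.2.2 i * u.1 i) {t : ℝ}
    (ht : Φ z + t • e ∈ Φ.target) :
    ∑ i, (flowD Φ e z t u).2.2 i * (flowD Φ e z t v).1 i
      = ∑ i, (flowD Φ e z t v).2.2 i * (flowD Φ e z t u).1 i := by
  have htrans : ∀ w v, contactForm (w + t • e) v = contactForm w v := fun w v => by
    simp [contactForm, he]
  have i1 := isotropic_map Φ.open_source hΦ.smooth hΦ.contact hz hu hv h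
  exact isotropic_map Φ.open_target hΦ.smooth_symm (fun w hw => hΦ.contact_symm hw) ht
    (by rw [htrans]; exact hΦ.contact z hz _ hu) (by rw [htrans]; exact hΦ.contact z hz _ hv) i1

omit hz in
lemma fderiv_flowD {t : ℝ} (ht : Φ z + t • e ∈ Φ.target) (v : J1 d) :
    fderiv ℝ Φ (Φ.symm (Φ z + t • e)) (flowD Φ e z t v) = fderiv ℝ Φ z v :=
  hΦ.fderiv_symm ht _

end Flow

/-- The `x`-components of the image under `L` of the plane determined by `θ`. -/
def planeM (L : J1 d →L[ℝ] J1 d) (θ : J2 d) : (Fin d → ℝ) →L[ℝ] (Fin d → ℝ) :=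
  (ContinuousLinearMap.fst ℝ (Fin d → ℝ) (ℝ × (Fin d → ℝ))).comp (L.comp (liftL θ))

/-- The `p`-components of the image under `L` of the plane determined by `θ`. -/
def planeN (L : J1 d →L[ℝ] J1 d) (θ : J2 d) : (Fin d → ℝ) →L[ℝ] (Fin d → ℝ) :=
  ((ContinuousLinearMap.snd ℝ ℝ (Fin d → ℝ)).comp
    (ContinuousLinearMap.snd ℝ (Fin d → ℝ) (ℝ × (Fin d → ℝ)))).comp (L.comp (liftL θ))

lemma planeM_apply (L : J1 d →L[ℝ] J1 d) (θ : J2 d) (v : Fin d → ℝ) :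
    planeM L θ v = (L (lift θ v)).1 := rfl

lemma planeN_apply (L : J1 d →L[ℝ] J1 d) (θ : J2 d) (v : Fin d → ℝ) :
    planeN L θ v = (L (lift θ v)).2.2 := rfl

lemma hasDerivAt_planeM {L : ℝ → J1 d →L[ℝ] J1 d} {L' : J1 d →L[ℝ] J1 d} {θ : J2 d}
    (h : HasDerivAt L L' 0) : HasDerivAt (fun t => planeM (L t) θ) (planeM L' θ) 0 :=
  hasDerivAt_comp_comp h _ _

lemma hasDerivAt_planeN {L : ℝ → J1 d →L[ℝ] J1 d} {L' : J1 d →L[ℝ] J1 d} {θ : J2 d}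
    (h : HasDerivAt L L' 0) : HasDerivAt (fun t => planeN (L t) θ) (planeN L' θ) 0 :=
  hasDerivAt_comp_comp h _ _

/-- The 2-jet over `w` whose plane is the image under `L` of the plane determined by `θ`. -/
def imageJet (L : J1 d →L[ℝ] J1 d) (θ : J2 d) (w : J1 d) : J2 d :=
  (w, symm (quotMatrix (planeM L θ) (planeN L θ)))

/-- The image plane consists of contact vectors, is isotropic, and projects isomorphically to x;
hence it is the plane of a 2-jet. -/
lemma lift_imageJet {L : J1 d →L[ℝ] J1 d} {θ : J2 d} {w : J1 d} (hM : IsUnit (planeM L θ))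
    (hiso : ∀ u v, ∑ i, (L (lift θ u)).2.2 i * (L (lift θ v)).1 i
      = ∑ i, (L (lift θ v)).2.2 i * (L (lift θ u)).1 i)
    (hc : ∀ v, contactForm w (L (lift θ v)) = 0) (v : Fin d → ℝ) :
    lift (imageJet L θ w) (planeM L θ v) = L (lift θ v) := by
  have hsym := quotMatrix_symm (N := planeN L θ) hM hiso
  refine Prod.ext rfl (Prod.ext ?_ (funext fun k => ?_))
  · have := hc v
    rw [contactForm, sub_eq_zero] at this
    exact this.symm
  · change _ = planeN L θ v k
    rw [← quotMatrix_mulVec hM]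
    change ∑ i, (symm (quotMatrix (planeM L θ) (planeN L θ))).1 i k * planeM L θ v i = _
    refine Finset.sum_congr rfl fun i _ => ?_
    rw [symm_of_symmetric hsym, hsym]

section Image

variable {L : ℝ → J1 d →L[ℝ] J1 d} {θ : J2 d} (hL0 : ∀ v, L 0 v = v)
include hL0

lemma planeM_of_id : planeM (L 0) θ = 1 :=
  ContinuousLinearMap.ext fun v => by rw [planeM_apply, hL0]; rfl

lemma imageJet_of_id : imageJet (L 0) θ θ.1 = θ := by
  refine Prod.ext rfl ?_
  have : quotMatrix (planeM (L 0) θ) (planeN (L 0) θ) = θ.2.1 := by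
    funext i j
    rw [quotMatrix, planeM_of_id hL0, Ring.inverse_one, one_apply_eq_self,
      planeN_apply, hL0]
    simpa [lift, Pi.single_apply] using θ.2.2 j i
  change symm (quotMatrix (planeM (L 0) θ) (planeN (L 0) θ)) = θ.2
  rw [this]
  exact symm_coe θ.2

/-- The moving Hessian is N M⁻¹ with M = 1 at t = 0. Its derivative N' - N M' is the formula
defining `prolongField`. -/
lemma hasDerivAt_imageJet {Z : J1 d → J1 d} {w : ℝ → J1 d} (hw : HasDerivAt w (Z θ.1) 0)
    (hL : HasDerivAt L (fderiv ℝ Z θ.1) 0) :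
    HasDerivAt (fun t => imageJet (L t) θ (w t)) (prolongField Z θ) 0 := by
  have hK := hasDerivAt_quotMatrix (hasDerivAt_planeM (θ := θ) hL) (hasDerivAt_planeN (θ := θ) hL)
    (planeM_of_id hL0)
  have h2 : HasFDerivAt (symmL (d := d)) (symmL (d := d))
    (quotMatrix (planeM (L 0) θ) (planeN (L 0) θ)) := ContinuousLinearMap.hasFDerivAt _
  have h5 : HasDerivAt (fun t => imageJet (L t) θ (w t)) (Z θ.1, symmL fun i j =>
      planeN (fderiv ℝ Z θ.1) θ (Pi.single j 1) i
        - planeN (L 0) θ (planeM (fderiv ℝ Z θ.1) θ (Pi.single j 1)) i) 0 :=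
    hw.prodMk (h2.comp_hasDerivAt (0 : ℝ) hK :
      HasDerivAt (symmL (d := d) ∘ fun t => quotMatrix (planeM (L t) θ) (planeN (L t) θ)) _ 0)
  refine h5.congr_deriv (Prod.ext rfl ?_)
  change symm _ = symm _
  congr 1
  funext i j
  have : ∀ v : Fin d → ℝ, planeN (L 0) θ v i = ∑ k, θ.2.1 i k * v k := by
    intro v
    rw [planeN_apply, hL0]
    change ∑ k, θ.2.1 k i * v k = _
    refine Finset.sum_congr rfl fun k _ => ?_
    have : θ.2.1 k i = θ.2.1 i k := θ.2.2 k i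
    rw [← this]
  rw [this]
  rfl

end Image

/-- A contact transformation to a translation-invariant equation carries the translations to
symmetries, over the points of the equation. -/
theorem isLocalSymmetry_pullConst {A B : PDE d} (hB : B.IsTranslationInvariant)
    {Φ : OpenPartialHomeomorph (J1 d) (J1 d)} (hΦ : IsContactTransformation Φ)
    {W : Set (J2 d)} (hW : IsOpen W) (hWA : W ⊆ A.dom)
    (h : ∀ θ ∈ W, θ.1 ∈ Φ.source ∧
        ∃ θ' ∈ B.dom, Prolongs Φ θ θ' ∧ (A.F θ = 0 ↔ B.F θ' = 0))
    {U : Set (J1 d)} (hU : U ⊆ Φ.source) (hUW : ∀ z ∈ U, ∃ H, (z, H) ∈ W ∧ A.F (z, H) = 0)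
    (c : Fin d → ℝ) : A.IsLocalSymmetry U (pullConst Φ (c, 0, 0)) := by
  refine ⟨⟨(pullConst_contDiffOn hΦ _).mono hU, fun z hzU v hv =>
    isContactField_pullConst hΦ (hU hzU) rfl hv⟩, fun z hzU => ?_⟩
  obtain ⟨H₀, hH₀, hF⟩ := hUW z hzU
  have hz := hU hzU
  have hWc : Continuous fun H : Sym d => ((z, H) : J2 d) := by fun_prop
  refine ⟨H₀, hF, ?_⟩
  filter_upwards [(hW.preimage hWc).mem_nhds hH₀] with H hH hFH
  replace hH : (z, H) ∈ W := hH
  obtain ⟨-, θ', hθ'B, ⟨hθ'1, hθ'2⟩, hiff⟩ := h _ hH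
  obtain ⟨θ, hθ⟩ : ∃ θ : J2 d, θ = (z, H) := ⟨_, rfl⟩
  obtain ⟨e, he⟩ : ∃ e : J1 d, e = (c, 0, 0) := ⟨_, rfl⟩
  have he2 : e.2.2 = 0 := by rw [he]
  have hθ1 : θ.1 = z := by rw [hθ]
  rw [← he, ← hθ]
  rw [← hθ] at hθ'1 hθ'2 hiff hH hFH
  rw [← hθ1] at hz
  have hd := hasDerivAt_imageJet (Z := pullConst Φ e) (flowD_zero hΦ hz e)
    (hasDerivAt_flow hΦ hz e) (hasDerivAt_flowD hΦ hz e)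
  have h0 : imageJet (flowD Φ e θ.1 0) θ (Φ.symm (Φ θ.1 + (0 : ℝ) • e)) = θ := by
    rw [zero_smul, add_zero, Φ.left_inv hz]
    exact imageJet_of_id (flowD_zero hΦ hz e)
  have hunit : ∀ᶠ t in nhds (0 : ℝ), IsUnit (planeM (flowD Φ e θ.1 t) θ) := by
    refine (hasDerivAt_planeM (hasDerivAt_flowD hΦ hz e)).continuousAt.eventually_mem
      (Units.isOpen.mem_nhds ?_)
    change IsUnit (planeM (flowD Φ e θ.1 0) θ)
    rw [planeM_of_id (flowD_zero hΦ hz e)]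
    exact isUnit_one
  have htr : ∀ᶠ t in nhds (0 : ℝ), translate (t • c) θ' ∈ B.dom := by
    have hc : Continuous fun t : ℝ => translate (t • c) θ' := by
      unfold translate
      fun_prop
    refine hc.continuousAt.eventually_mem (B.isOpen_dom.mem_nhds ?_)
    simpa [translate] using hθ'B
  have hWev := hd.continuousAt.eventually_mem (by rw [h0]; exact hW.mem_nhds hH)
  -- For small t the prolonged flow stays in W, and its image in the second equation is the
  -- translate of θ'; invariance of that equation gives the vanishing.
  have hzero : ∀ᶠ t in nhds (0 : ℝ),
      A.F (imageJet (flowD Φ e θ.1 t) θ (Φ.symm (Φ θ.1 + t • e))) = 0 := by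
    filter_upwards [hWev, hunit, htr, eventually_mem_target hz e] with t htW htu htB htt
    obtain ⟨-, θ'', hθ''B, ⟨h1, h2⟩, hiff'⟩ := h _ htW
    refine hiff'.2 ?_
    have hlift := lift_imageJet htu
      (fun u v => isotropic_flowD hΦ hz he2 (contactForm_lift θ u) (contactForm_lift θ v)
        (isotropic_lift θ u v) htt)
      (fun v => contactForm_flowD hΦ hz he2 (contactForm_lift θ v) htt)
    have hpt1 : θ''.1 = (translate (t • c) θ').1 := by
      rw [h1]
      change Φ (Φ.symm (Φ θ.1 + t • e)) = _
      rw [Φ.right_inv htt, ← hθ'1, he]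
      simp [translate, Prod.ext_iff]
    -- A 2-jet is determined by its base point and its plane, so it is enough to compare planes.
    have hle : jetPlane θ' ≤ jetPlane θ'' := by
      rw [← hθ'2, ← h2]
      rintro _ ⟨w, hw, rfl⟩
      refine ⟨flowD Φ e θ.1 t w, ?_, fderiv_flowD hΦ htt w⟩
      rw [mem_jetPlane.1 hw, ← hlift]
      exact lift_mem_jetPlane _ _
    have : θ'' = translate (t • c) θ' :=
      (eq_of_lift_eq hpt1.symm fun v => mem_jetPlane.1 (hle (lift_mem_jetPlane θ' v))).symm
    rw [this] at hθ''B ⊢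
    exact hB θ' hθ'B _ htB (hiff.1 hFH)
  have hAd : HasFDerivAt A.F (fderiv ℝ A.F θ)
      (imageJet (flowD Φ e θ.1 0) θ (Φ.symm (Φ θ.1 + (0 : ℝ) • e))) := by
    rw [h0]
    exact ((A.smooth.contDiffAt (A.isOpen_dom.mem_nhds (hWA hH))).differentiableAt
      (by simp)).hasFDerivAt
  have h1 := hAd.comp_hasDerivAt 0 hd
  have h2 : A.F ∘ (fun t => imageJet (flowD Φ e θ.1 t) θ (Φ.symm (Φ θ.1 + t • e)))
    =ᶠ[nhds 0] fun _ => 0 := hzero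
  exact (h2.hasDerivAt_iff.1 h1).unique (hasDerivAt_const _ _)

end Equivalence

/-! ### Symbols of quasilinear equations; symmetries obtained from contact equivalence. -/

section Symbol

variable {d : ℕ} {A B : PDE d} {c : Fin d → Fin d → J1 d → ℝ}

lemma PDE.IsQuasilinear.fderiv_vertical (hA : A.IsQuasilinear c) (θ : J2 d) (K : Sym d) :
    fderiv ℝ A.F θ (0, K) = A.F (θ.1, K) := by
  have h := (hA.hasFDerivAt θ (0, K)).2
  rw [hA.eq]
  rw [dirD] at h
  rw [h]
  simp [dirD]

lemma PDE.IsQuasilinear.symbol_eq (hA : A.IsQuasilinear c) (θ : J2 d) (p q : Fin d → ℝ) :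
    A.symbol θ p q = 2⁻¹ * ∑ i, ∑ j, c i j θ.1 * (p i * q j) := by
  rw [PDE.symbol, hA.fderiv_vertical, hA.eq]
  rw [sum_symm_eq fun i j => by rw [hA.symmetric]]

lemma PDE.IsQuasilinear.isNondegenerate (hA : A.IsQuasilinear c)
    (h : ∀ θ ∈ A.locus, ∀ p : Fin d → ℝ, (∀ j, ∑ i, c i j θ.1 * p i = 0) → p = 0) :
    A.IsNondegenerate := by
  refine fun θ hθ p hp => h θ hθ p fun j => ?_
  have := hp (Pi.single j 1)
  rw [hA.symbol_eq] at this
  simpa [Pi.single_apply] using this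

lemma PDE.IsQuasilinear.apply_add_smul (hA : A.IsQuasilinear c) (z : J1 d) (H K : Sym d) (t : ℝ) :
    A.F (z, H + t • K) = A.F (z, H) + t * A.F (z, K) := by
  simp only [hA.eq]
  change 2⁻¹ * traceForm (fun i j => c i j z) (H + t • K)
    = 2⁻¹ * traceForm (fun i j => c i j z) H + t * (2⁻¹ * traceForm (fun i j => c i j z) K)
  rw [map_add, map_smul, smul_eq_mul]
  ring

lemma PDE.IsQuasilinear.continuous_apply (hA : A.IsQuasilinear c) (H : Sym d) :
    Continuous fun z => A.F (z, H) := by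
  simp only [hA.eq]
  exact continuous_const.mul (continuous_finsetSum _ fun i _ => continuous_finsetSum _ fun j _ =>
    (hA.smooth i j).continuous.mul continuous_const)

lemma PDE.IsContactSymmetry.isLocalSymmetry (hA : A.IsQuasilinear c) {U : Set (J1 d)}
    {Z : J1 d → J1 d} (h : A.IsContactSymmetry U Z) (hU : ∀ z ∈ U, ∀ H, (z, H) ∈ A.dom) :
    A.IsLocalSymmetry U Z :=
  ⟨h.1, fun z hz => ⟨0, by rw [hA.eq]; simp,
    Filter.Eventually.of_forall fun H hH => h.2 (z, H) ⟨hU z hz H, hH⟩ hz⟩⟩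

/-- A quasilinear equation contact-equivalent to a translation-invariant one has, somewhere,
a simply transitive abelian algebra of symmetries. -/
theorem ContactEquivalent.exists_isLocalSymmetry [NeZero d] (hA : A.IsQuasilinear c)
    (hnd : A.IsNondegenerate) (hB : B.IsTranslationInvariant) (h : ContactEquivalent A B) :
    ∃ U : Set (J1 d), IsOpen U ∧ U.Nonempty ∧ (∀ z ∈ U, ∃ H, (z, H) ∈ A.dom) ∧
      ∃ Z : Fin d → J1 d → J1 d, (∀ i, A.IsLocalSymmetry U (Z i)) ∧
        (∀ i j, ∀ z ∈ U, VectorField.lieBracket ℝ (Z i) (Z j) z = 0) ∧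
        ∀ z ∈ U, LinearIndependent ℝ fun i => Z i z := by
  obtain ⟨⟨z₀, H₀⟩, hθ₀, Φ, hΦ, W, hW, hWθ, hWA, hmap⟩ := h
  -- If F vanished on the whole fibre, the symbol would be zero, against non-degeneracy.
  obtain ⟨n, hn⟩ : ∃ n : Sym d, A.F (z₀, n) ≠ 0 := by
    by_contra! hcon
    have := hnd _ hθ₀ (Pi.single 0 1) fun q => by
      rw [PDE.symbol, hA.fderiv_vertical]
      exact hcon _
    simpa using congrFun this 0
  have hcn := hA.continuous_apply n
  have hcH := hA.continuous_apply H₀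
  -- Moving H₀ along n by the right amount solves the equation over every nearby point, continuously
  -- in z. The equation is thus met in W over a whole neighbourhood.
  have hK : ContinuousAt (fun z => ((z, H₀ + (-(A.F (z, H₀) / A.F (z, n))) • n) : J2 d)) z₀ :=
    continuousAt_id.prodMk (continuousAt_const.add
      ((hcH.continuousAt.div hcn.continuousAt hn).neg.smul continuousAt_const))
  have hev : ∀ᶠ z in nhds z₀, z ∈ Φ.source ∧ (z, H₀ + (-(A.F (z, H₀) / A.F (z, n))) • n) ∈ W ∧
      A.F (z, n) ≠ 0 := by
    refine Filter.Eventually.and (Φ.open_source.mem_nhds (hmap _ hWθ).1)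
      ((hK.eventually_mem (hW.mem_nhds ?_)).and (hcn.continuousAt.eventually_ne hn))
    have : A.F (z₀, H₀) = 0 := hθ₀.2
    simpa [this] using hWθ
  obtain ⟨U, hUsub, hU, hz₀⟩ := eventually_nhds_iff.1 hev
  have hzero : ∀ z ∈ U, A.F (z, H₀ + (-(A.F (z, H₀) / A.F (z, n))) • n) = 0 := fun z hz => by
    rw [hA.apply_add_smul, neg_mul, div_mul_cancel₀ _ (hUsub z hz).2.2, add_neg_cancel]
  refine ⟨U, hU, ⟨z₀, hz₀⟩, fun z hz => ⟨_, hWA (hUsub z hz).2.1⟩,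
    fun i => pullConst Φ (Pi.single i 1, 0, 0), fun i => ?_, fun i j z hz => ?_, fun z hz => ?_⟩
  · exact isLocalSymmetry_pullConst hB hΦ hW hWA hmap (fun z hz => (hUsub z hz).1)
      (fun z hz => ⟨_, (hUsub z hz).2.1, hzero z hz⟩) _
  · exact lieBracket_pullConst hΦ _ _ (hUsub z hz).1
  · refine linearIndependent_pullConst hΦ ?_ (hUsub z hz).1
    have := (Pi.basisFun ℝ (Fin d)).linearIndependent.map'
      (LinearMap.inl ℝ (Fin d → ℝ) (ℝ × (Fin d → ℝ))) (LinearMap.ker_eq_bot.2 LinearMap.inl_injective)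
    have h2 : (fun i : Fin d => ((Pi.single i 1, 0, 0) : J1 d))
        = LinearMap.inl ℝ (Fin d → ℝ) (ℝ × (Fin d → ℝ)) ∘ Pi.basisFun ℝ (Fin d) := by
      funext i
      simp
    rw [h2]
    exact this

end Symbol

/-! ### Dimension three: non-degeneracy and the negative statements. -/

section ThreeDim

lemma veronese3_locus_nonempty : veronese3.locus.Nonempty := by
  refine ⟨((![0, 1, 2], 0, ![1, 1, 1]), 0), ?_, ?_⟩
  · change (_ ∧ _ ∧ _) ∧ _ ∧ _ ∧ _
    simp
  · rw [isQuasilinear_veronese3.eq]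
    simp

lemma veronese3_isNondegenerate : veronese3.IsNondegenerate := by
  refine isQuasilinear_veronese3.isNondegenerate fun θ hθ p hp => ?_
  have hc := webCoeff_crossForm_ne_zero (U := {θ.1}) (by rintro _ rfl; exact hθ.1) θ.1 rfl
  have hs : ∀ i j, webCoeff crossForm i j θ.1 = webCoeff crossForm j i θ.1 := fun i j => by
    rw [isQuasilinear_veronese3.symmetric]
  have hd : ∀ i, webCoeff crossForm i i θ.1 = 0 := fun i => by rw [isQuasilinear_veronese3.diag]; rfl
  have h0 := hp 0
  have h1 := hp 1
  have h2 := hp 2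
  simp only [Fin.sum_univ_three, hd, hs 1 0, hs 2 0, hs 2 1, zero_mul, zero_add, add_zero] at h0 h1 h2
  have c01 := hc 0 1 (by decide)
  have c02 := hc 0 2 (by decide)
  have c12 := hc 1 2 (by decide)
  -- The symmetric 3 × 3 matrix without diagonal has determinant 2 c_01 c_02 c_12; this is the
  -- elimination behind it.
  have e0 : p 0 = 0 := by
    have : 2 * (webCoeff crossForm 0 1 θ.1 * webCoeff crossForm 0 2 θ.1) * p 0 = 0 := by
      linear_combination webCoeff crossForm 0 2 θ.1 * h1 + webCoeff crossForm 0 1 θ.1 * h2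
        - webCoeff crossForm 1 2 θ.1 * h0
    exact (mul_eq_zero.1 this).resolve_left (mul_ne_zero two_ne_zero (mul_ne_zero c01 c02))
  rw [e0, mul_zero, zero_add] at h1 h2
  funext i
  fin_cases i
  · exact e0
  · exact (mul_eq_zero.1 h2).resolve_left c12
  · exact (mul_eq_zero.1 h1).resolve_left c12

lemma veronese3_not_contactEquivalent (B : PDE 3) (hB : B.IsTranslationInvariant) :
    ¬ ContactEquivalent veronese3 B := by
  intro h
  obtain ⟨U, hU, ⟨z, hz⟩, hdom, Z, hS, hcomm, hli⟩ :=
    h.exists_isLocalSymmetry isQuasilinear_veronese3 veronese3_isNondegenerate hB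
  exact not_simplyTransitive_three hU (fun z hz => (hdom z hz).choose_spec) hS hz
    (fun i j => hcomm i j z hz) (hli z hz)

lemma veronese3_not_hasSimplyTransitiveAbelianSymmetry {U : Set (J1 3)} (hU : IsOpen U)
    (hne : U.Nonempty) (hb : U ⊆ veronese3.base) :
    ¬ veronese3.HasSimplyTransitiveAbelianSymmetry U := by
  rintro ⟨Z, hS, hcomm, hli⟩
  obtain ⟨z, hz⟩ := hne
  have hdom : ∀ z ∈ U, ∀ H, (z, H) ∈ veronese3.dom := by
    intro z hz H
    obtain ⟨θ, hθ, rfl⟩ := hb hz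
    exact hθ.1
  exact not_simplyTransitive_three hU (fun z hz => hdom z hz 0)
    (fun i => (hS i).isLocalSymmetry isQuasilinear_veronese3 hdom) hz
    (fun i j => hcomm i j z hz) (hli z hz)

end ThreeDim

/-! ### Dimension four: non-degeneracy and the negative statements. -/

section FourDim

variable {a : Fin 4 → ℝ}

lemma veronese4_locus_nonempty (ha : ∀ i, a i ≠ 0) : (veronese4 a).locus.Nonempty := by
  -- At this point x_0 = x_3, so one side of the condition is 0 and the other is -a_2 a_3.
  refine ⟨((![0, 1, 1, 0], 0, ![1, 1, 0, 0]), 0), ?_, ?_⟩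
  · change _ ≠ _
    simp [minor, ha]
  · rw [(isQuasilinear_veronese4 a).eq]
    simp

lemma veronese4_isNondegenerate : (veronese4 a).IsNondegenerate := by
  refine (isQuasilinear_veronese4 a).isNondegenerate fun θ hθ p hp => ?_
  -- The determinant of the characteristic form is the square of the expression that defines the
  -- domain.
  have hdet : Matrix.det (Matrix.of fun j i => webCoeff (dualForm a) i j θ.1)
      = ((θ.1.1 0 - θ.1.1 1) * (θ.1.1 2 - θ.1.1 3) * (minor a 0 3 θ * minor a 1 2 θ) -
        (θ.1.1 0 - θ.1.1 3) * (θ.1.1 1 - θ.1.1 2) * (minor a 0 1 θ * minor a 2 3 θ)) ^ 2 := by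
    simp only [Matrix.det_succ_row_zero, Fin.sum_univ_succ, Matrix.of_apply, webCoeff, dualForm,
      minor]
    simp [Fin.succAbove, minorForm_apply]
    ring
  refine Matrix.eq_zero_of_mulVec_eq_zero (M := Matrix.of fun j i => webCoeff (dualForm a) i j θ.1)
    ?_ (funext fun j => hp j)
  rw [hdet]
  exact pow_ne_zero 2 (sub_ne_zero.2 hθ.1)

lemma dense_setOf_ne_zero {E : Type*} [NormedAddCommGroup E] [NormedSpace ℝ E] {l : E →L[ℝ] ℝ}
    {v : E} (hv : l v ≠ 0) : Dense {z | l z ≠ 0} := by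
  have h : interior ((LinearMap.ker (l : E →ₗ[ℝ] ℝ) : Submodule ℝ E) : Set E) = ∅ := by
    by_contra hne
    have := Submodule.eq_top_of_nonempty_interior' _ (Set.nonempty_iff_ne_empty.2 hne)
    exact hv (this ▸ Submodule.mem_top : v ∈ LinearMap.ker (l : E →ₗ[ℝ] ℝ))
  exact interior_eq_empty_iff_dense_compl.1 h

/-- The domain does not force the c_ij to be non-zero, but each c_ij is a product of two non-zero
linear forms, so the open set where none vanishes is dense. -/
lemma exists_webCoeff_dualForm_ne_zero (ha : ∀ i, a i ≠ 0) {U : Set (J1 4)} (hU : IsOpen U)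
    (hne : U.Nonempty) : ∃ V ⊆ U, IsOpen V ∧ V.Nonempty ∧
      ∀ z ∈ V, ∀ i j, i ≠ j → webCoeff (dualForm a) i j z ≠ 0 := by
  let S : {q : Fin 4 × Fin 4 // q.1 ≠ q.2} → Set (J1 4) :=
    fun q => {z | webCoeff (dualForm a) q.1.1 q.1.2 z ≠ 0}
  have hSo : ∀ q, IsOpen (S q) := fun q =>
    isOpen_ne_fun ((isQuasilinear_veronese4 a).smooth _ _).continuous continuous_const
  have hSd : ∀ q, Dense (S q) := by
    rintro ⟨⟨i, j⟩, hij⟩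
    obtain ⟨k, l, h⟩ := Distinct4.exists_of_ne hij
    let l₁ : J1 4 →L[ℝ] ℝ := ((ContinuousLinearMap.proj (R := ℝ) (φ := fun _ : Fin 4 => ℝ) i)
      - ContinuousLinearMap.proj (R := ℝ) (φ := fun _ : Fin 4 => ℝ) j).comp
      (ContinuousLinearMap.fst ℝ (Fin 4 → ℝ) (ℝ × (Fin 4 → ℝ)))
    let l₂ : J1 4 →L[ℝ] ℝ := (dualForm a i j).toContinuousLinearMap.comp
      ((ContinuousLinearMap.snd ℝ ℝ (Fin 4 → ℝ)).comp
        (ContinuousLinearMap.snd ℝ (Fin 4 → ℝ) (ℝ × (Fin 4 → ℝ))))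
    have h1 : Dense {z | l₁ z ≠ 0} := dense_setOf_ne_zero (v := (Pi.single i 1, 0, 0))
      (by simp [l₁, Ne.symm hij])
    have h2 : Dense {z | l₂ z ≠ 0} := dense_setOf_ne_zero (v := (0, 0, Pi.single k 1))
      (dualForm_single h ha).2.2
    refine (h1.inter_of_isOpen_left h2 (isOpen_ne_fun l₁.continuous continuous_const)).mono ?_
    rintro z ⟨hz1, hz2⟩
    exact mul_ne_zero hz1 hz2
  obtain ⟨z, hz, hzS⟩ := (dense_iInter_of_isOpen hSo hSd).inter_open_nonempty U hU hne
  exact ⟨U ∩ ⋂ q, S q, Set.inter_subset_left, hU.inter (isOpen_iInter_of_finite hSo), ⟨z, hz, hzS⟩,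
    fun z hz i j hij => Set.mem_iInter.1 hz.2 ⟨(i, j), hij⟩⟩

variable (ha : ∀ i, a i ≠ 0) (hneq : ∃ i j, |a i| ≠ |a j|)
include ha hneq

lemma veronese4_not_contactEquivalent (B : PDE 4) (hB : B.IsTranslationInvariant) :
    ¬ ContactEquivalent (veronese4 a) B := by
  intro h
  obtain ⟨U, hU, hne, hdom, Z, hS, hcomm, hli⟩ :=
    h.exists_isLocalSymmetry (isQuasilinear_veronese4 a) veronese4_isNondegenerate hB
  obtain ⟨V, hVU, hV, hVne, hVb⟩ := exists_webCoeff_dualForm_ne_zero ha hU hne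
  exact not_simplyTransitive_four ha hV hVb (fun i => (hS i).mono hVU) hVne hneq
    (fun i j z hz => hcomm i j z (hVU hz)) fun z hz => hli z (hVU hz)

lemma veronese4_not_hasSimplyTransitiveAbelianSymmetry {U : Set (J1 4)} (hU : IsOpen U)
    (hne : U.Nonempty) (hb : U ⊆ (veronese4 a).base) :
    ¬ (veronese4 a).HasSimplyTransitiveAbelianSymmetry U := by
  rintro ⟨Z, hS, hcomm, hli⟩
  have hdom : ∀ z ∈ U, ∀ H, (z, H) ∈ (veronese4 a).dom := by
    intro z hz H
    obtain ⟨θ, hθ, rfl⟩ := hb hz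
    exact hθ.1
  obtain ⟨V, hVU, hV, hVne, hVb⟩ := exists_webCoeff_dualForm_ne_zero ha hU hne
  exact not_simplyTransitive_four ha hV hVb
    (fun i => ((hS i).isLocalSymmetry (isQuasilinear_veronese4 a) hdom).mono hVU) hVne hneq
    (fun i j z hz => hcomm i j z (hVU hz)) fun z hz => hli z (hVU hz)

end FourDim

/-! ### Jets of functions -/

section Jets

variable {d : ℕ}

lemma pd_contDiffOn {V : Set (Fin d → ℝ)} {u : (Fin d → ℝ) → ℝ} (hV : IsOpen V)
    (hu : ContDiffOn ℝ ∞ u V) (i : Fin d) : ContDiffOn ℝ ∞ (pd i u) V :=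
  dirD_contDiffOn hV hu _

lemma fderiv_eq_sum_pd (f : (Fin d → ℝ) → ℝ) (x v : Fin d → ℝ) :
    fderiv ℝ f x v = ∑ i, pd i f x * v i := by
  conv_lhs => rw [pi_eq_sum_univ' v]
  simp only [map_sum, map_smul, smul_eq_mul, pd]
  refine Finset.sum_congr rfl fun i _ => ?_
  rw [mul_comm]

lemma jet2_contDiffOn {V : Set (Fin d → ℝ)} {u : (Fin d → ℝ) → ℝ} (hV : IsOpen V)
    (hu : ContDiffOn ℝ ∞ u V) : ContDiffOn ℝ ∞ (jet2 u) V := by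
  have h1 := fun i => pd_contDiffOn hV hu i
  have h2 : ContDiffOn ℝ ∞ (fun x => fun i j => pd i (pd j u) x) V :=
    contDiffOn_pi.2 fun i => contDiffOn_pi.2 fun j => pd_contDiffOn hV (h1 j) i
  exact (contDiffOn_id.prodMk (hu.prodMk (contDiffOn_pi.2 h1))).prodMk
    (symmL.contDiff.comp_contDiffOn h2)

/-- The derivative of the jet of a function is a lift. -/
lemma fderiv_jet2_fst {V : Set (Fin d → ℝ)} {u : (Fin d → ℝ) → ℝ} (hV : IsOpen V)
    (hu : ContDiffOn ℝ ∞ u V) {x : Fin d → ℝ} (hx : x ∈ V) (v : Fin d → ℝ) :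
    (fderiv ℝ (jet2 u) x v).1 = lift (jet2 u x) v := by
  have hd : ∀ {f : (Fin d → ℝ) → ℝ}, ContDiffOn ℝ ∞ f V → HasFDerivAt f (fderiv ℝ f x) x :=
    fun hf => ((hf.contDiffAt (hV.mem_nhds hx)).differentiableAt (by simp)).hasFDerivAt
  have h1 : HasFDerivAt (fun y => (jet2 u y).1)
      ((ContinuousLinearMap.fst ℝ (J1 d) (Sym d)).comp (fderiv ℝ (jet2 u) x)) x :=
    hasFDerivAt_fst.comp x ((((jet2_contDiffOn hV hu).contDiffAt (hV.mem_nhds hx)).differentiableAt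
      (by simp)).hasFDerivAt)
  have h2 : HasFDerivAt (fun y => (jet2 u y).1) ((ContinuousLinearMap.id ℝ (Fin d → ℝ)).prod
      ((fderiv ℝ u x).prod (ContinuousLinearMap.pi fun i => fderiv ℝ (pd i u) x))) x :=
    (hasFDerivAt_id x).prodMk ((hd hu).prodMk (hasFDerivAt_pi.2 fun i =>
      hd (pd_contDiffOn hV hu i)))
  have h3 := DFunLike.congr_fun (h1.unique h2) v
  change (fderiv ℝ (jet2 u) x v).1 = _ at h3
  rw [h3]
  refine Prod.ext rfl (Prod.ext ?_ (funext fun k => ?_))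
  · exact fderiv_eq_sum_pd u x v
  · change fderiv ℝ (pd k u) x v = ∑ i, (pd i (pd k u) x + pd k (pd i u) x) / 2 * v i
    rw [fderiv_eq_sum_pd]
    refine Finset.sum_congr rfl fun i _ => ?_
    have : pd k (pd i u) x = pd i (pd k u) x := dirD_comm hV hu hx _ _
    rw [this]
    ring

/-- The cubic polynomial with 2-jet `θ` whose third derivatives are `t` in the directions `aab`
and `s` in the directions `abb`. -/
def cubic (θ : J2 d) (a b : Fin d) (t s : ℝ) (y : Fin d → ℝ) : ℝ :=
  θ.1.2.1 + ∑ i, θ.1.2.2 i * (y i - θ.1.1 i)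
    + 2⁻¹ * ∑ i, ∑ j, θ.2.1 i j * ((y i - θ.1.1 i) * (y j - θ.1.1 j))
    + t / 2 * ((y a - θ.1.1 a) * ((y a - θ.1.1 a) * (y b - θ.1.1 b)))
    + s / 2 * ((y a - θ.1.1 a) * ((y b - θ.1.1 b) * (y b - θ.1.1 b)))

/-- The derivative of the second derivatives of `cubic θ a b t s`. -/
def cubicHess (a b : Fin d) (t s : ℝ) (v : Fin d → ℝ) : Sym d :=
  (t * v a + s * v b) • symUnit a b + (t / 2 * v b) • symUnit a a + (s / 2 * v a) • symUnit b b

variable (θ : J2 d) (a b : Fin d) (t s : ℝ)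

lemma cubicHess_apply (v : Fin d → ℝ) (i j : Fin d) : (cubicHess a b t s v).1 i j =
    (t * v a + s * v b) * (symUnit a b).1 i j + (t / 2 * v b) * (symUnit a a).1 i j
      + (s / 2 * v a) * (symUnit b b).1 i j := rfl

lemma hasDirD_coord (c : ℝ) (i : Fin d) (v y : Fin d → ℝ) :
    HasDirD (fun y : Fin d → ℝ => y i - c) (v i) v y := by
  have := (HasFDerivAt.hasDirD (v := v) (ContinuousLinearMap.proj (R := ℝ) (φ := fun _ : Fin d => ℝ)
    i).hasFDerivAt (z := y)).sub (HasDirD.const c)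
  simpa using this

lemma sum_mul_single (f : Fin d → ℝ) (i : Fin d) :
    ∑ j, f j * (Pi.single i 1 : Fin d → ℝ) j = f i := by
  simp [Pi.single_apply]

lemma symUnit_eq_single (i j : Fin d) : (symUnit a b).1 i j =
    (Pi.single i 1 : Fin d → ℝ) a * (Pi.single j 1 : Fin d → ℝ) b
      + (Pi.single i 1 : Fin d → ℝ) b * (Pi.single j 1 : Fin d → ℝ) a := by
  simp only [symUnit_apply, Pi.single_apply, eq_comm (a := a), eq_comm (a := b)]

lemma cubic_contDiff : ContDiff ℝ ∞ (cubic θ a b t s) := by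
  unfold cubic
  fun_prop

lemma pd_cubic (i : Fin d) (y : Fin d → ℝ) : pd i (cubic θ a b t s) y = θ.1.2.2 i
    + ∑ j, θ.2.1 i j * (y j - θ.1.1 j)
    + t / 2 * (2 * (Pi.single i 1 : Fin d → ℝ) a * ((y a - θ.1.1 a) * (y b - θ.1.1 b))
        + (Pi.single i 1 : Fin d → ℝ) b * ((y a - θ.1.1 a) * (y a - θ.1.1 a)))
    + s / 2 * ((Pi.single i 1 : Fin d → ℝ) a * ((y b - θ.1.1 b) * (y b - θ.1.1 b))
        + 2 * (Pi.single i 1 : Fin d → ℝ) b * ((y a - θ.1.1 a) * (y b - θ.1.1 b))) := by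
  have hc := fun j => hasDirD_coord (θ.1.1 j) j (Pi.single i 1) y
  have h := ((((HasDirD.const θ.1.2.1).add (HasDirD.sum (s := Finset.univ) fun j _ =>
    (HasDirD.const (θ.1.2.2 j)).mul (hc j))).add ((HasDirD.const 2⁻¹).mul
    (HasDirD.sum (s := Finset.univ) fun j _ => HasDirD.sum (s := Finset.univ) fun k _ =>
      (HasDirD.const (θ.2.1 j k)).mul ((hc j).mul (hc k))))).add
    ((HasDirD.const (t / 2)).mul ((hc a).mul ((hc a).mul (hc b))))).add
    ((HasDirD.const (s / 2)).mul ((hc a).mul ((hc b).mul (hc b))))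
  refine h.2.trans ?_
  have e : ∑ j, ∑ k, θ.2.1 j k * ((Pi.single i 1 : Fin d → ℝ) j * (y k - θ.1.1 k)
        + (y j - θ.1.1 j) * (Pi.single i 1 : Fin d → ℝ) k)
      = 2 * ∑ j, θ.2.1 i j * (y j - θ.1.1 j) := by
    have e1 : ∀ j, θ.2.1 j i = θ.2.1 i j := fun j => θ.2.2 j i
    simp [mul_add, Finset.sum_add_distrib, Pi.single_apply, e1]
    ring
  simp only [zero_mul, zero_add]
  rw [e, sum_mul_single]
  ring

lemma pd_pd_cubic (i j : Fin d) (y : Fin d → ℝ) : pd j (pd i (cubic θ a b t s)) y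
    = (θ.2 + cubicHess a b t s (y - θ.1.1)).1 i j := by
  have hc := fun k => hasDirD_coord (θ.1.1 k) k (Pi.single j 1) y
  have hf : pd i (cubic θ a b t s) = _ := funext fun y => pd_cubic θ a b t s i y
  have h := (((HasDirD.const (θ.1.2.2 i)).add (HasDirD.sum (s := Finset.univ) fun k _ =>
    (HasDirD.const (θ.2.1 i k)).mul (hc k))).add ((HasDirD.const (t / 2)).mul
    (((HasDirD.const (2 * (Pi.single i 1 : Fin d → ℝ) a)).mul ((hc a).mul (hc b))).add
    ((HasDirD.const ((Pi.single i 1 : Fin d → ℝ) b)).mul ((hc a).mul (hc a)))))).add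
    ((HasDirD.const (s / 2)).mul (((HasDirD.const ((Pi.single i 1 : Fin d → ℝ) a)).mul
      ((hc b).mul (hc b))).add ((HasDirD.const (2 * (Pi.single i 1 : Fin d → ℝ) b)).mul
      ((hc a).mul (hc b)))))
  rw [hf]
  refine h.2.trans ?_
  change _ = θ.2.1 i j + (cubicHess a b t s (y - θ.1.1)).1 i j
  simp only [cubicHess_apply, symUnit_eq_single, Pi.sub_apply, zero_mul, zero_add]
  rw [sum_mul_single]
  ring

lemma jet2_cubic (y : Fin d → ℝ) : (jet2 (cubic θ a b t s) y).2
    = θ.2 + cubicHess a b t s (y - θ.1.1) := by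
  change symm _ = _
  rw [← symm_coe (θ.2 + cubicHess a b t s (y - θ.1.1))]
  congr 1
  funext i j
  rw [pd_pd_cubic]
  exact (θ.2 + cubicHess a b t s (y - θ.1.1)).2 j i

lemma jet2_cubic_self : jet2 (cubic θ a b t s) θ.1.1 = θ := by
  refine Prod.ext (Prod.ext rfl (Prod.ext ?_ (funext fun i => ?_))) ?_
  · change cubic θ a b t s θ.1.1 = _
    simp [cubic]
  · change pd i (cubic θ a b t s) θ.1.1 = _
    simp [pd_cubic]
  · rw [jet2_cubic]
    simp [cubicHess]

lemma fderiv_jet2_cubic (v : Fin d → ℝ) : fderiv ℝ (jet2 (cubic θ a b t s)) θ.1.1 v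
    = (lift θ v, cubicHess a b t s v) := by
  refine Prod.ext ?_ ?_
  · rw [fderiv_jet2_fst isOpen_univ (cubic_contDiff θ a b t s).contDiffOn (Set.mem_univ _),
      jet2_cubic_self]
  · have h1 : HasFDerivAt (fun y => (jet2 (cubic θ a b t s) y).2)
        ((ContinuousLinearMap.snd ℝ (J1 d) (Sym d)).comp
          (fderiv ℝ (jet2 (cubic θ a b t s)) θ.1.1)) θ.1.1 :=
      hasFDerivAt_snd.comp _ ((((jet2_contDiffOn isOpen_univ
        (cubic_contDiff θ a b t s).contDiffOn).contDiffAt Filter.univ_mem).differentiableAt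
        (by simp)).hasFDerivAt)
    let T : (Fin d → ℝ) →L[ℝ] Sym d := LinearMap.toContinuousLinearMap
      { toFun := cubicHess a b t s
        map_add' := fun v w => by
          simp only [cubicHess, Pi.add_apply]
          module
        map_smul' := fun c v => by
          simp only [cubicHess, Pi.smul_apply, smul_eq_mul, RingHom.id_apply]
          module }
    have h2 : HasFDerivAt (fun y => (jet2 (cubic θ a b t s) y).2) T θ.1.1 := by
      have h3 : (fun y => (jet2 (cubic θ a b t s) y).2) = fun y => θ.2 + (T y - T θ.1.1) := by
        funext y
        rw [jet2_cubic, ← map_sub]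
        rfl
      rw [h3]
      exact (T.hasFDerivAt.sub_const _).const_add _
    exact DFunLike.congr_fun (h1.unique h2) v

/-- Every 2-jet in an open set is attained by a section whose third derivatives are prescribed. -/
lemma exists_isSection_cubic {W : Set (J2 d)} (hW : IsOpen W) (hθ : θ ∈ W) :
    ∃ V, θ.1.1 ∈ V ∧ IsSection W V (cubic θ a b t s) := by
  have hc : Continuous (jet2 (cubic θ a b t s)) :=
    (contDiffOn_univ.1 (jet2_contDiffOn isOpen_univ (cubic_contDiff θ a b t s).contDiffOn)).continuous
  refine ⟨jet2 (cubic θ a b t s) ⁻¹' W, ?_, hW.preimage hc,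
    (cubic_contDiff θ a b t s).contDiffOn, fun x hx => hx⟩
  change jet2 _ _ ∈ W
  rwa [jet2_cubic_self]

end Jets

/-! ### Rigidity of the Frobenius condition off the equation -/

section Rigidity

variable {N G : Type*} [NormedAddCommGroup N] [NormedSpace ℝ N] [NormedAddCommGroup G]
  [NormedSpace ℝ G] {Ω : Set N} {f g : N → ℝ} {ν q : N}

/-- A function vanishing on the hypersurface `f = 0` has derivative proportional to `df` there. -/
lemma fderiv_eq_smul_of_vanish {E : N → G} (hΩ : IsOpen Ω) (hq : q ∈ Ω) (hfq : f q = 0)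
    (hf : DifferentiableAt ℝ f q) (hg : DifferentiableAt ℝ g q) (hgq : g q ≠ 0)
    (hπ : ∀ p ∈ Ω, f (p - (f p / g p) • ν) = 0) (hE : DifferentiableAt ℝ E q)
    (hE0 : ∀ p ∈ Ω, f p = 0 → E p = 0) (w : N) :
    fderiv ℝ E q w = (fderiv ℝ f q w / g q) • fderiv ℝ E q ν := by
  have h1 : HasFDerivAt (fun p => f p / g p) ((g q)⁻¹ • fderiv ℝ f q) q := by
    have := hf.hasFDerivAt.fun_mul (((hasDerivAt_inv hgq).comp_hasFDerivAt q hg.hasFDerivAt))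
    simp only [hfq, zero_smul, zero_add, Function.comp] at this
    simpa only [div_eq_mul_inv] using this
  have h2 : HasFDerivAt (fun p => p - (f p / g p) • ν)
      (ContinuousLinearMap.id ℝ N - ((g q)⁻¹ • fderiv ℝ f q).smulRight ν) q :=
    (hasFDerivAt_id q).sub (h1.smul_const ν)
  have hq0 : q - (f q / g q) • ν = q := by rw [hfq, zero_div, zero_smul, sub_zero]
  have h3 : HasFDerivAt E (fderiv ℝ E q) (q - (f q / g q) • ν) := by
    rw [hq0]
    exact hE.hasFDerivAt
  have h4 : HasFDerivAt (fun p => E (p - (f p / g p) • ν)) _ q := h3.comp q h2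
  -- The map p ↦ p - (f/g) ν retracts onto f = 0, so E composed with it vanishes; the chain rule
  -- then gives the claim.
  have h5 : (fun p => E (p - (f p / g p) • ν)) =ᶠ[nhds q] fun _ => 0 := by
    have hc : ∀ᶠ p in nhds q, p - (f p / g p) • ν ∈ Ω :=
      h2.continuousAt.eventually_mem (by rw [hq0]; exact hΩ.mem_nhds hq)
    filter_upwards [hc, hΩ.mem_nhds hq] with p hp hp'
    exact hE0 _ hp (hπ p hp')
  have h6 := DFunLike.congr_fun (h4.unique ((hasFDerivAt_const (0 : G) q).congr_of_eventuallyEq h5)) w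
  simp only [ContinuousLinearMap.comp_apply, sub_apply, ContinuousLinearMap.id_apply,
    ContinuousLinearMap.smulRight_apply, smul_apply, map_sub, map_smul, zero_apply, sub_eq_zero] at h6
  rw [h6, smul_eq_mul, div_eq_inv_mul]

lemma hasFDerivAt_apply_apply {A : N → N →L[ℝ] G} {l : N → G →L[ℝ] N} {B : N → G}
    (hA : DifferentiableAt ℝ A q) (hl : DifferentiableAt ℝ l q) (hB : DifferentiableAt ℝ B q) :
    ∃ D : N →L[ℝ] G, HasFDerivAt (fun p => A p (l p (B p))) D q ∧
      ∀ w, D w = fderiv ℝ A q w (l q (B q)) + A q (fderiv ℝ l q w (B q))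
        + A q (l q (fderiv ℝ B q w)) := by
  refine ⟨_, hA.hasFDerivAt.clm_apply (hl.hasFDerivAt.clm_apply hB.hasFDerivAt), fun w => ?_⟩
  simp
  abel

variable {X Y E H C : N → G} {l : N → ℝ → ℝ → G →L[ℝ] N}

/-- Two fields whose bracket is `f • C` with `C ≠ 0` cannot be modified away from `f = 0` to
fields that commute for every choice of the jets `l`. -/
theorem false_of_commuting_modification (hΩ : IsOpen Ω) (hq : q ∈ Ω) (hfq : f q = 0)
    (hf : ∀ p ∈ Ω, DifferentiableAt ℝ f p) (hg : ∀ p ∈ Ω, DifferentiableAt ℝ g p)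
    (hg0 : ∀ p ∈ Ω, g p ≠ 0) (hπ : ∀ p ∈ Ω, f (p - (f p / g p) • ν) = 0)
    (hfν : ∀ τ : ℝ, f (q + τ • ν) = τ * g q)
    (hX : ContDiffOn ℝ ∞ X Ω) (hY : ContDiffOn ℝ ∞ Y Ω) (hE : ContDiffOn ℝ ∞ E Ω)
    (hH : ContDiffOn ℝ ∞ H Ω) (hE0 : ∀ p ∈ Ω, f p = 0 → E p = 0)
    (hH0 : ∀ p ∈ Ω, f p = 0 → H p = 0)
    (hl : ∀ p ∈ Ω, ∀ t s, DifferentiableAt ℝ (fun p => l p t s) p)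
    (hlf : ∀ p ∈ Ω, ∀ α β, ∃ t s, fderiv ℝ f p (l p t s (X p)) = α ∧
      fderiv ℝ f p (l p t s (Y p)) = β)
    (hR : ∀ p ∈ Ω, ∀ t s, fderiv ℝ Y p (l p t s (X p)) - fderiv ℝ X p (l p t s (Y p)) = f p • C p)
    (hC : ∀ τ : ℝ, C (q + τ • ν) = C q) (hCq : C q ≠ 0)
    (hS : ∀ p ∈ Ω, ∀ t s, fderiv ℝ (fun p => Y p + H p) p (l p t s (X p + E p))
      = fderiv ℝ (fun p => X p + E p) p (l p t s (Y p + H p))) : False := by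
  have hd : ∀ {Z : N → G}, ContDiffOn ℝ ∞ Z Ω → ∀ p ∈ Ω, DifferentiableAt ℝ Z p := fun hZ p hp =>
    (hZ.contDiffAt (hΩ.mem_nhds hp)).differentiableAt (by simp)
  have hd2 : ∀ {Z : N → G}, ContDiffOn ℝ ∞ Z Ω → ∀ p ∈ Ω, DifferentiableAt ℝ (fderiv ℝ Z) p :=
    fun hZ p hp => ((hZ.fderiv_of_isOpen hΩ (m := ∞) (by simp)).contDiffAt
      (hΩ.mem_nhds hp)).differentiableAt (by simp)
  have hadd : ∀ {Z Z' : N → G}, ContDiffOn ℝ ∞ Z Ω → ContDiffOn ℝ ∞ Z' Ω → ∀ p ∈ Ω,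
      fderiv ℝ (fun p => Z p + Z' p) p = fderiv ℝ Z p + fderiv ℝ Z' p :=
    fun h h' p hp => fderiv_fun_add (hd h p hp) (hd h' p hp)
  -- On f = 0 the commutation relation reduces to dH(lX) = dE(lY). Both differentials are multiples
  -- of df there, and free third derivatives allow df(lX) and df(lY) to be (0, g) or (g, 0); hence
  -- dE = dH = 0.
  have first : ∀ p ∈ Ω, f p = 0 → fderiv ℝ E p = 0 ∧ fderiv ℝ H p = 0 := by
    intro p hp hfp
    have hvE := fderiv_eq_smul_of_vanish hΩ hp hfp (hf p hp) (hg p hp) (hg0 p hp) hπ (hd hE p hp) hE0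
    have hvH := fderiv_eq_smul_of_vanish hΩ hp hfp (hf p hp) (hg p hp) (hg0 p hp) hπ (hd hH p hp) hH0
    have key : ∀ t s, fderiv ℝ H p (l p t s (X p)) = fderiv ℝ E p (l p t s (Y p)) := by
      intro t s
      have h1 := hS p hp t s
      have h2 := hR p hp t s
      rw [hadd hY hH p hp, hadd hX hE p hp, hE0 p hp hfp, hH0 p hp hfp, add_zero, add_zero,
        add_apply, add_apply] at h1
      rw [hfp, zero_smul, sub_eq_zero] at h2
      rw [h2] at h1
      exact add_left_cancel h1
    constructor
    · obtain ⟨t, s, h1, h2⟩ := hlf p hp 0 (g p)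
      have := key t s
      rw [hvH, hvE (l p t s (Y p)), h1, h2, zero_div, zero_smul, div_self (hg0 p hp), one_smul] at this
      ext w
      rw [hvE, ← this, smul_zero, zero_apply]
    · obtain ⟨t, s, h1, h2⟩ := hlf p hp (g p) 0
      have := key t s
      rw [hvH, hvE (l p t s (Y p)), h1, h2, zero_div, zero_smul, div_self (hg0 p hp), one_smul] at this
      ext w
      rw [hvH, this, smul_zero, zero_apply]
  obtain ⟨t, s, hw1, hw2⟩ := hlf q hq 0 0
  -- Now dZ itself vanishes on f = 0, so its derivative is proportional to df; symmetry of the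
  -- second derivative moves ν to the other slot.
  have second : ∀ {Z : N → G}, ContDiffOn ℝ ∞ Z Ω → (∀ p ∈ Ω, f p = 0 → fderiv ℝ Z p = 0) →
      ∀ w, fderiv ℝ f q w = 0 → fderiv ℝ (fderiv ℝ Z) q ν w = 0 := by
    intro Z hZ hZ0 w hw
    have hs : IsSymmSndFDerivAt ℝ Z q :=
      (hZ.contDiffAt (hΩ.mem_nhds hq)).isSymmSndFDerivAt (by
        rw [minSmoothness_of_isRCLikeNormedField]
        exact WithTop.coe_le_coe.2 (le_top : (2 : ℕ∞) ≤ ⊤))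
    rw [hs ν w, fderiv_eq_smul_of_vanish hΩ hq hfq (hf q hq) (hg q hq) (hg0 q hq) hπ (hd2 hZ q hq)
      hZ0 w, hw, zero_div, zero_smul, zero_apply]
  have hl' := hl q hq t s
  have hXE : ContDiffOn ℝ ∞ (fun p => X p + E p) Ω := hX.add hE
  have hYH : ContDiffOn ℝ ∞ (fun p => Y p + H p) Ω := hY.add hH
  obtain ⟨D1, hD1, hD1'⟩ := hasFDerivAt_apply_apply (hd2 hY q hq) hl' (hd hE q hq)
  obtain ⟨D2, hD2, hD2'⟩ := hasFDerivAt_apply_apply (hd2 hH q hq) hl' (hd hXE q hq)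
  obtain ⟨D3, hD3, hD3'⟩ := hasFDerivAt_apply_apply (hd2 hX q hq) hl' (hd hH q hq)
  obtain ⟨D4, hD4, hD4'⟩ := hasFDerivAt_apply_apply (hd2 hE q hq) hl' (hd hYH q hq)
  have hsum := (hD3.add hD4).sub (hD1.add hD2)
  have hT : HasFDerivAt (fun p => f p • C p) (D3 + D4 - (D1 + D2)) q := by
    refine hsum.congr_of_eventuallyEq ?_
    filter_upwards [hΩ.mem_nhds hq] with p hp
    have h1 := hS p hp t s
    rw [hadd hY hH p hp, hadd hX hE p hp] at h1
    rw [← hR p hp t s]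
    simp only [add_apply, map_add, Pi.add_apply, Pi.sub_apply] at h1 ⊢
    rw [← sub_eq_zero] at h1 ⊢
    rw [← h1]
    abel
  -- The parameters t, s make lX and lY tangent to f = 0 at q, so every term of the differentiated
  -- identity vanishes in the direction ν.
  have hν : (D3 + D4 - (D1 + D2)) ν = 0 := by
    obtain ⟨e1, e2⟩ := first q hq hfq
    simp only [sub_apply, add_apply, hD1', hD2', hD3', hD4', e1, e2, hE0 q hq hfq, hH0 q hq hfq,
      add_zero, map_zero, zero_apply, second hE (fun p hp h => (first p hp h).1) _ hw2,
      second hH (fun p hp h => (first p hp h).2) _ hw1, sub_self]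
  -- Along q + τν the function f C equals τ g(q) C(q), whose derivative g(q) C(q) is non-zero.
  have hline : HasDerivAt (fun τ : ℝ => (τ * g q) • C q) 0 0 := by
    have h0 : HasFDerivAt (fun p => f p • C p) (D3 + D4 - (D1 + D2)) (q + (0 : ℝ) • ν) := by
      rwa [zero_smul, add_zero]
    have h1 : HasDerivAt ((fun p => f p • C p) ∘ fun τ : ℝ => q + τ • ν)
      ((D3 + D4 - (D1 + D2)) ν) 0 := h0.comp_hasDerivAt 0 (hasDerivAt_add_smul q ν)
    simp only [Function.comp_def, hfν, hC, hν] at h1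
    exact h1
  have h2 := hline.unique ((((hasDerivAt_id (0 : ℝ)).mul_const (g q)).smul_const (C q)))
  rw [one_mul] at h2
  exact (smul_ne_zero (hg0 q hq) hCq) h2.symm

end Rigidity

/-! ### Normalised Lax pairs -/

section Frames

variable {N G : Type*} [NormedAddCommGroup N] [NormedSpace ℝ N] [NormedAddCommGroup G]
  [NormedSpace ℝ G] {X Y : N → G} {α β γ δ : N → ℝ} {q : N}

lemma fderiv_frame (hX : DifferentiableAt ℝ X q) (hY : DifferentiableAt ℝ Y q)
    (hα : DifferentiableAt ℝ α q) (hβ : DifferentiableAt ℝ β q) (w : N) :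
    fderiv ℝ (fun p => α p • X p + β p • Y p) q w
      = α q • fderiv ℝ X q w + fderiv ℝ α q w • X q
        + (β q • fderiv ℝ Y q w + fderiv ℝ β q w • Y q) := by
  have h := (hα.hasFDerivAt.smul hX.hasFDerivAt).add (hβ.hasFDerivAt.smul hY.hasFDerivAt)
  have h2 : fderiv ℝ (fun p => α p • X p + β p • Y p) q = _ := h.fderiv
  rw [h2]
  simp

/-- If the bracket of two fields is in their span and a change of frame gives them constant
components with respect to two linear forms, then the new fields commute. -/
lemma bracket_frame_eq (J : G →L[ℝ] N) (π₁ π₂ : G →L[ℝ] ℝ) (hX : DifferentiableAt ℝ X q)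
    (hY : DifferentiableAt ℝ Y q)
    (hα : DifferentiableAt ℝ α q) (hβ : DifferentiableAt ℝ β q)
    (hγ : DifferentiableAt ℝ γ q) (hδ : DifferentiableAt ℝ δ q)
    (hspan : fderiv ℝ Y q (J (X q)) - fderiv ℝ X q (J (Y q)) ∈ Submodule.span ℝ {X q, Y q})
    (hD : π₁ (X q) * π₂ (Y q) - π₂ (X q) * π₁ (Y q) ≠ 0)
    (h11 : ∀ᶠ p in nhds q, π₁ (α p • X p + β p • Y p) = 1)
    (h12 : ∀ᶠ p in nhds q, π₂ (α p • X p + β p • Y p) = 0)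
    (h21 : ∀ᶠ p in nhds q, π₁ (γ p • X p + δ p • Y p) = 0)
    (h22 : ∀ᶠ p in nhds q, π₂ (γ p • X p + δ p • Y p) = 1) :
    fderiv ℝ (fun p => γ p • X p + δ p • Y p) q (J (α q • X q + β q • Y q))
      = fderiv ℝ (fun p => α p • X p + β p • Y p) q (J (γ q • X q + δ q • Y q)) := by
  have hcomp : ∀ {α β : N → ℝ}, DifferentiableAt ℝ α q → DifferentiableAt ℝ β q →
      ∀ (π : G →L[ℝ] ℝ) (r : ℝ), (∀ᶠ p in nhds q, π (α p • X p + β p • Y p) = r) →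
      ∀ w, π (fderiv ℝ (fun p => α p • X p + β p • Y p) q w) = 0 := by
    intro α β hα hβ π r h w
    have h1 := π.hasFDerivAt.comp q ((hα.smul hX).add (hβ.smul hY)).hasFDerivAt
    have h2 := h1.unique ((hasFDerivAt_const r q).congr_of_eventuallyEq h)
    exact DFunLike.congr_fun h2 w
  rw [← sub_eq_zero]
  -- A change of frame keeps the bracket in the span of X and Y.
  obtain ⟨m, n, hmn⟩ : ∃ m n : ℝ, fderiv ℝ (fun p => γ p • X p + δ p • Y p) q
      (J (α q • X q + β q • Y q))
      - fderiv ℝ (fun p => α p • X p + β p • Y p) q (J (γ q • X q + δ q • Y q))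
      = m • X q + n • Y q := by
    obtain ⟨m, n, h⟩ := Submodule.mem_span_pair.1 hspan
    rw [fderiv_frame hX hY hγ hδ, fderiv_frame hX hY hα hβ]
    generalize fderiv ℝ γ q _ = dγ
    generalize fderiv ℝ δ q _ = dδ
    generalize fderiv ℝ α q _ = dα
    generalize fderiv ℝ β q _ = dβ
    refine ⟨(α q * δ q - β q * γ q) * m + dγ - dα, (α q * δ q - β q * γ q) * n + dδ - dβ, ?_⟩
    have h' : fderiv ℝ Y q (J (X q)) = m • X q + n • Y q + fderiv ℝ X q (J (Y q)) := by
      rw [h, sub_add_cancel]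
    simp only [map_add, map_smul, h']
    module
  have e1 := congrArg π₁ hmn
  have e2 := congrArg π₂ hmn
  rw [map_sub, hcomp hγ hδ π₁ _ h21, hcomp hα hβ π₁ _ h11, sub_zero, map_add, map_smul,
    map_smul, smul_eq_mul, smul_eq_mul] at e1
  rw [map_sub, hcomp hγ hδ π₂ _ h22, hcomp hα hβ π₂ _ h12, sub_zero, map_add, map_smul,
    map_smul, smul_eq_mul, smul_eq_mul] at e2
  -- Both components of the new bracket vanish because the new fields have constant components;
  -- Cramer's rule then kills the coefficients.
  have hm : m = 0 := by
    refine (mul_eq_zero.1 ?_).resolve_right hD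
    linear_combination π₁ (Y q) * e2 - π₂ (Y q) * e1
  have hn : n = 0 := by
    refine (mul_eq_zero.1 ?_).resolve_right hD
    linear_combination π₂ (X q) * e1 - π₁ (X q) * e2
  rw [hmn, hm, hn, zero_smul, zero_smul, add_zero]

end Frames

/-! ### Lax pairs from normal pairs. -/

section NormalPairs

variable {d : ℕ} {A : PDE d} {c : Fin d → Fin d → J1 d → ℝ}

/-- A pair of fields depending on first derivatives only, whose `a`- and `b`-components are
`(1, 0)` and `(0, 1)` and whose bracket is a non-zero multiple of the equation. -/
structure PDE.IsNormalPair (A : PDE d) (U : Set (J1 d)) (I : Set ℝ) (a b : Fin d)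
    (ξ η C : J1 d × ℝ → Fin d → ℝ) : Prop where
  smooth_left : ContDiffOn ℝ ∞ ξ (U ×ˢ I)
  smooth_right : ContDiffOn ℝ ∞ η (U ×ˢ I)
  left_fst : ∀ q, ξ q a = 1
  left_snd : ∀ q, ξ q b = 0
  right_fst : ∀ q, η q a = 0
  right_snd : ∀ q, η q b = 1
  bracket : ∀ q ∈ U ×ˢ I, ∀ H k, dirD (lift (q.1, H) (ξ q), 0) (fun q => η q k) q
    - dirD (lift (q.1, H) (η q), 0) (fun q => ξ q k) q = A.F (q.1, H) * C q k
  ne_zero : ∀ q ∈ U ×ˢ I, C q ≠ 0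
  injective : ∀ z ∈ U, ∀ lam ∈ I, ∀ mu ∈ I, ξ (z, lam) = ξ (z, mu) → η (z, lam) = η (z, mu) →
    lam = mu

/-- The field without `∂/∂lam`-component defined by coefficients depending on the 1-jet. -/
def spectralField (ξ : J1 d × ℝ → Fin d → ℝ) : SpectralField d := fun θ lam => (ξ (θ.1, lam), 0)

lemma spectralField_smoothOn {ξ : J1 d × ℝ → Fin d → ℝ} {U : Set (J1 d)} {I : Set ℝ}
    (h : ContDiffOn ℝ ∞ ξ (U ×ˢ I)) {W : Set (J2 d)} (hW : ∀ θ ∈ W, θ.1 ∈ U) :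
    (spectralField ξ).SmoothOn W I := by
  have h2 : ContDiffOn ℝ ∞ (fun q : J2 d × ℝ => ξ (q.1.1, q.2)) (W ×ˢ I) :=
    h.comp (t := U ×ˢ I) (by fun_prop) fun q hq => ⟨hW _ hq.1, hq.2⟩
  exact h2.prodMk contDiffOn_const

lemma fderiv_spectralField {ξ : J1 d × ℝ → Fin d → ℝ} {q : J2 d × ℝ}
    (h : DifferentiableAt ℝ ξ (q.1.1, q.2)) (w : J2 d × ℝ) :
    fderiv ℝ (fun q : J2 d × ℝ => spectralField ξ q.1 q.2) q w
      = (fun k => dirD (w.1.1, w.2) (fun q => ξ q k) (q.1.1, q.2), 0) := by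
  have h1 : HasFDerivAt (fun q : J2 d × ℝ => ((q.1.1, q.2) : J1 d × ℝ))
      (((ContinuousLinearMap.fst ℝ (J1 d) (Sym d)).comp (ContinuousLinearMap.fst ℝ (J2 d) ℝ)).prod
        (ContinuousLinearMap.snd ℝ (J2 d) ℝ)) q :=
    (hasFDerivAt_fst.comp q hasFDerivAt_fst).prodMk hasFDerivAt_snd
  have h2 : HasFDerivAt ξ (fderiv ℝ ξ (q.1.1, q.2)) (q.1.1, q.2) := h.hasFDerivAt
  have h3 : HasFDerivAt (fun q : J2 d × ℝ => spectralField ξ q.1 q.2) _ q :=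
    (h2.comp q h1).prodMk (hasFDerivAt_const (0 : ℝ) q)
  rw [h3.fderiv]
  refine Prod.ext (funext fun k => ?_) rfl
  change fderiv ℝ ξ (q.1.1, q.2) (w.1.1, w.2) k
    = fderiv ℝ (fun q => ξ q k) (q.1.1, q.2) (w.1.1, w.2)
  have h4 : HasFDerivAt (fun q => ξ q k) _ (q.1.1, q.2) := (hasFDerivAt_pi'.1 h2) k
  rw [h4.fderiv]
  rfl

lemma PDE.IsNormalPair.bracket_spectralField {U : Set (J1 d)} {I : Set ℝ} {a b : Fin d}
    {ξ η C : J1 d × ℝ → Fin d → ℝ} (h : A.IsNormalPair U I a b ξ η C) (hU : IsOpen U)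
    (hI : IsOpen I) {q : J2 d × ℝ} (hq : (q.1.1, q.2) ∈ U ×ˢ I) {w w' : J2 d × ℝ}
    (hw : w.1.1 = lift q.1 (ξ (q.1.1, q.2))) (hw2 : w.2 = 0)
    (hw' : w'.1.1 = lift q.1 (η (q.1.1, q.2))) (hw2' : w'.2 = 0) :
    fderiv ℝ (fun q : J2 d × ℝ => spectralField η q.1 q.2) q w
      - fderiv ℝ (fun q : J2 d × ℝ => spectralField ξ q.1 q.2) q w'
      = A.F q.1 • spectralField C q.1 q.2 := by
  have hd : ∀ {ξ : J1 d × ℝ → Fin d → ℝ}, ContDiffOn ℝ ∞ ξ (U ×ˢ I) →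
      DifferentiableAt ℝ ξ (q.1.1, q.2) := fun h =>
    (h.contDiffAt ((hU.prod hI).mem_nhds hq)).differentiableAt (by simp)
  rw [fderiv_spectralField (hd h.smooth_right), fderiv_spectralField (hd h.smooth_left), hw, hw',
    hw2, hw2']
  refine Prod.ext (funext fun k => ?_) ?_
  · exact h.bracket _ hq q.1.2 k
  · simp [spectralField]

lemma hasFDerivAt_jet2_prod {V : Set (Fin d → ℝ)} {u : (Fin d → ℝ) → ℝ} (hV : IsOpen V)
    (hu : ContDiffOn ℝ ∞ u V) {q : (Fin d → ℝ) × ℝ} (hq : q.1 ∈ V) :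
    HasFDerivAt (fun q : (Fin d → ℝ) × ℝ => (jet2 u q.1, q.2))
      ((fderiv ℝ (jet2 u) q.1).prodMap (ContinuousLinearMap.id ℝ ℝ)) q :=
  HasFDerivAt.prodMap q ((((jet2_contDiffOn hV hu).contDiffAt (hV.mem_nhds hq)).differentiableAt
    (by simp)).hasFDerivAt) (hasFDerivAt_id _)

/-- The Lie bracket of spectral fields evaluated on a function. -/
lemma lieBracket_along {X Y : SpectralField d} {V : Set (Fin d → ℝ)} {u : (Fin d → ℝ) → ℝ}
    (hV : IsOpen V) (hu : ContDiffOn ℝ ∞ u V) {x : Fin d → ℝ} (hx : x ∈ V) {lam : ℝ}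
    (hX : DifferentiableAt ℝ (fun q : J2 d × ℝ => X q.1 q.2) (jet2 u x, lam))
    (hY : DifferentiableAt ℝ (fun q : J2 d × ℝ => Y q.1 q.2) (jet2 u x, lam)) :
    VectorField.lieBracket ℝ (X.along u) (Y.along u) (x, lam)
      = fderiv ℝ (fun q : J2 d × ℝ => Y q.1 q.2) (jet2 u x, lam)
          (((fderiv ℝ (jet2 u) x).prodMap (ContinuousLinearMap.id ℝ ℝ)) (X (jet2 u x) lam))
        - fderiv ℝ (fun q : J2 d × ℝ => X q.1 q.2) (jet2 u x, lam)
          (((fderiv ℝ (jet2 u) x).prodMap (ContinuousLinearMap.id ℝ ℝ)) (Y (jet2 u x) lam)) := by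
  have hj := hasFDerivAt_jet2_prod hV hu (q := (x, lam)) hx
  have h : ∀ {Z : SpectralField d},
      DifferentiableAt ℝ (fun q : J2 d × ℝ => Z q.1 q.2) (jet2 u x, lam) →
      fderiv ℝ (Z.along u) (x, lam) = (fderiv ℝ (fun q : J2 d × ℝ => Z q.1 q.2) (jet2 u x, lam)).comp
        ((fderiv ℝ (jet2 u) x).prodMap (ContinuousLinearMap.id ℝ ℝ)) := fun {Z} hZ =>
    (HasFDerivAt.comp (x, lam) (g := fun q : J2 d × ℝ => Z q.1 q.2)
      (f := fun q : (Fin d → ℝ) × ℝ => (jet2 u q.1, q.2)) hZ.hasFDerivAt hj).fderiv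
  rw [VectorField.lieBracket, h hX, h hY]
  rfl

/-- The normalised components make the coefficients readable off v; equal spans therefore force
equal fields, which reduces parameter dependence to `injective`. -/
lemma PDE.IsNormalPair.eq_of_mem_span {U : Set (J1 d)} {I : Set ℝ} {a b : Fin d}
    {ξ η C : J1 d × ℝ → Fin d → ℝ} (h : A.IsNormalPair U I a b ξ η C) {q : J1 d × ℝ}
    {v : Fin d → ℝ} (hv : (v, (0 : ℝ)) ∈ Submodule.span ℝ {((ξ q, 0) : (Fin d → ℝ) × ℝ), (η q, 0)}) :
    v = v a • ξ q + v b • η q := by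
  obtain ⟨m, n, hmn⟩ := Submodule.mem_span_pair.1 hv
  have h1 : m • ξ q + n • η q = v := congrArg Prod.fst hmn
  have ha := congrFun h1 a
  have hb := congrFun h1 b
  simp [h.left_fst, h.left_snd, h.right_fst, h.right_snd] at ha hb
  rw [← ha, ← hb, h1]

lemma PDE.IsNormalPair.isLaxPair {U : Set (J1 d)} {I : Set ℝ} {a b : Fin d}
    {ξ η C : J1 d × ℝ → Fin d → ℝ} (h : A.IsNormalPair U I a b ξ η C) (hU : IsOpen U)
    (hI : IsOpen I) {W : Set (J2 d)} (hW : ∀ θ ∈ W, θ.1 ∈ U) :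
    A.IsLaxPair W I (spectralField ξ) (spectralField η) where
  smooth_left := spectralField_smoothOn h.smooth_left hW
  smooth_right := spectralField_smoothOn h.smooth_right hW
  no_param_left _ _ _ _ := rfl
  no_param_right _ _ _ _ := rfl
  independent θ _ lam _ := by
    refine LinearIndependent.pair_iff.2 fun m n hmn => ?_
    have h1 : m • ξ (θ.1, lam) + n • η (θ.1, lam) = 0 := congrArg Prod.fst hmn
    have ha := congrFun h1 a
    have hb := congrFun h1 b
    simp [h.left_fst, h.left_snd, h.right_fst, h.right_snd] at ha hb
    exact ⟨ha, hb⟩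
  involutive V u hu hF x hx lam hlam := by
    have hq : ((jet2 u x).1, lam) ∈ U ×ˢ I := ⟨hW _ (hu.jet_mem x hx), hlam⟩
    have hd : ∀ {ζ : J1 d × ℝ → Fin d → ℝ}, ContDiffOn ℝ ∞ ζ (U ×ˢ I) →
        DifferentiableAt ℝ (fun q : J2 d × ℝ => spectralField ζ q.1 q.2) (jet2 u x, lam) := by
      intro ζ hζ
      have h2 : DifferentiableAt ℝ ζ ((jet2 u x).1, lam) :=
        (hζ.contDiffAt ((hU.prod hI).mem_nhds hq)).differentiableAt (by simp)
      exact (DifferentiableAt.comp (jet2 u x, lam) (g := ζ)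
        (f := fun q : J2 d × ℝ => (q.1.1, q.2)) h2 (by fun_prop)).prodMk (differentiableAt_const (0 : ℝ))
    have hl := fderiv_jet2_fst hu.isOpen hu.smooth hx
    rw [InvolutiveAt, lieBracket_along hu.isOpen hu.smooth hx (hd h.smooth_left)
      (hd h.smooth_right), h.bracket_spectralField hU hI hq (hl _) rfl (hl _) rfl, hF x hx, zero_smul]
    exact Submodule.zero_mem _

lemma PDE.IsNormalPair.depends_on_param {U : Set (J1 d)} {I : Set ℝ} {a b : Fin d}
    {ξ η C : J1 d × ℝ → Fin d → ℝ} (h : A.IsNormalPair U I a b ξ η C) {θ : J2 d} (hθ : θ.1 ∈ U)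
    {lam mu : ℝ} (hlam : lam ∈ I) (hmu : mu ∈ I)
    (hs : Submodule.span ℝ {spectralField ξ θ lam, spectralField η θ lam}
      = Submodule.span ℝ {spectralField ξ θ mu, spectralField η θ mu}) : lam = mu := by
  have h1 : spectralField ξ θ lam ∈ Submodule.span ℝ {spectralField ξ θ mu, spectralField η θ mu} :=
    hs ▸ Submodule.subset_span (Set.mem_insert _ _)
  have h2 : spectralField η θ lam ∈ Submodule.span ℝ {spectralField ξ θ mu, spectralField η θ mu} :=
    hs ▸ Submodule.subset_span (Set.mem_insert_of_mem _ rfl)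
  have e1 := h.eq_of_mem_span h1
  have e2 := h.eq_of_mem_span h2
  rw [h.left_fst, h.left_snd, one_smul, zero_smul, add_zero] at e1
  rw [h.right_fst, h.right_snd, one_smul, zero_smul, zero_add] at e2
  exact h.injective _ hθ _ hlam _ hmu e1 e2

end NormalPairs

/-! ### Essentiality of the Frobenius condition for normal pairs. -/

section Essential

variable {d : ℕ} {A : PDE d} {c : Fin d → Fin d → J1 d → ℝ}

/-- `cubicHess a b t s` as a linear map. -/
def cubicHessL (a b : Fin d) (t s : ℝ) : (Fin d → ℝ) →L[ℝ] Sym d :=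
  LinearMap.toContinuousLinearMap
    { toFun := cubicHess a b t s
      map_add' := fun v w => by
        simp only [cubicHess, Pi.add_apply]
        module
      map_smul' := fun c v => by
        simp only [cubicHess, Pi.smul_apply, smul_eq_mul, RingHom.id_apply]
        module }

/-- The derivative of `(x, lam) ↦ (j²u(x), lam)` for a cubic polynomial `u`. -/
def cubicFrame (a b : Fin d) (q : J2 d × ℝ) (t s : ℝ) : ((Fin d → ℝ) × ℝ) →L[ℝ] J2 d × ℝ :=
  ((liftL q.1).prod (cubicHessL a b t s)).prodMap (ContinuousLinearMap.id ℝ ℝ)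

lemma cubicFrame_apply (a b : Fin d) (q : J2 d × ℝ) (t s : ℝ) (v : (Fin d → ℝ) × ℝ) :
    cubicFrame a b q t s v = ((lift q.1 v.1, cubicHess a b t s v.1), v.2) := rfl

lemma cubicFrame_differentiable (a b : Fin d) (t s : ℝ) :
    Differentiable ℝ fun q : J2 d × ℝ => cubicFrame a b q t s := by
  refine (contDiff_clm_apply_iff.2 fun v => ?_ : ContDiff ℝ ∞ _).differentiable (by simp)
  have h1 : ∀ i j, ContDiff ℝ ∞ fun q : J2 d × ℝ => q.1.2.1 i j :=
    fun i j => (contDiff_hess i j).comp contDiff_fst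
  have h2 : ∀ i, ContDiff ℝ ∞ fun q : J2 d × ℝ => q.1.1.2.2 i :=
    fun i => (contDiff_p i).comp contDiff_fst
  have h3 : ContDiff ℝ ∞ fun q : J2 d × ℝ => lift q.1 v.1 :=
    contDiff_const.prodMk ((ContDiff.sum fun i _ => (h2 i).mul contDiff_const).prodMk
      (contDiff_pi.2 fun k => ContDiff.sum fun i _ => (h1 i k).mul contDiff_const))
  exact (h3.prodMk contDiff_const).prodMk contDiff_const

lemma cubicFrame_eq (a b : Fin d) (q : J2 d × ℝ) (t s : ℝ) :
    (fderiv ℝ (jet2 (cubic q.1 a b t s)) q.1.1.1).prodMap (ContinuousLinearMap.id ℝ ℝ)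
      = cubicFrame a b q t s := by
  refine ContinuousLinearMap.ext fun v => Prod.ext ?_ rfl
  exact fderiv_jet2_cubic q.1 a b t s v.1

lemma PDE.IsQuasilinear.apply_symUnit (hA : A.IsQuasilinear c) (z : J1 d) (i j : Fin d) :
    A.F (z, symUnit i j) = c i j z := by
  rw [hA.eq]
  change 2⁻¹ * ∑ k, ∑ l, c k l z * (symUnit i j).1 k l = _
  rw [sum_symUnit (fun k l => c k l z), hA.symmetric j i]
  ring

lemma PDE.IsQuasilinear.apply_cubicHess (hA : A.IsQuasilinear c) (z : J1 d) (a b : Fin d) (t s : ℝ)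
    (v : Fin d → ℝ) : A.F (z, cubicHess a b t s v) = (t * v a + s * v b) * c a b z := by
  have h : cubicHess a b t s v = ((0 + (t * v a + s * v b) • symUnit a b)
    + (t / 2 * v b) • symUnit a a) + (s / 2 * v a) • symUnit b b := by
    rw [zero_add]
    rfl
  rw [h, hA.apply_add_smul, hA.apply_add_smul, hA.apply_add_smul, hA.apply_symUnit,
    hA.apply_symUnit, hA.apply_symUnit, hA.diag a, hA.diag b, hA.eq]
  simp

lemma PDE.IsQuasilinear.differentiable (hA : A.IsQuasilinear c) : Differentiable ℝ A.F :=
  fun θ => (hA.hasFDerivAt θ 0).1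

/-- The Frobenius condition of a normal pair holds essentially modulo the equation. -/
theorem PDE.IsNormalPair.essential {U : Set (J1 d)} {I : Set ℝ} {a b : Fin d}
    {ξ η C : J1 d × ℝ → Fin d → ℝ} (h : A.IsNormalPair U I a b ξ η C) (hA : A.IsQuasilinear c)
    (hU : IsOpen U) (hI : IsOpen I) (hc : ∀ z ∈ U, c a b z ≠ 0) {W : Set (J2 d)} (hWo : IsOpen W)
    (hW : ∀ θ ∈ W, θ.1 ∈ U) {θ₀ : J2 d} (hθ₀ : θ₀ ∈ W) (hF₀ : A.F θ₀ = 0) {lam₀ : ℝ}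
    (hlam₀ : lam₀ ∈ I) {X' Y' : SpectralField d} (hX' : X'.SmoothOn W I) (hY' : Y'.SmoothOn W I)
    (heq : ∀ θ ∈ W, A.F θ = 0 → ∀ lam ∈ I,
      X' θ lam = spectralField ξ θ lam ∧ Y' θ lam = spectralField η θ lam) :
    ∃ V u, IsSection W V u ∧ ∃ x ∈ V, ∃ lam ∈ I, ¬ InvolutiveAt X' Y' u (x, lam) := by
  by_contra! hinv
  obtain ⟨x, hx⟩ : ∃ x : J2 d × ℝ → (Fin d → ℝ) × ℝ, x = fun q => X' q.1 q.2 := ⟨_, rfl⟩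
  obtain ⟨y, hy⟩ : ∃ y : J2 d × ℝ → (Fin d → ℝ) × ℝ, y = fun q => Y' q.1 q.2 := ⟨_, rfl⟩
  have hxs : ContDiffOn ℝ ∞ x (W ×ˢ I) := hx ▸ hX'
  have hys : ContDiffOn ℝ ∞ y (W ×ˢ I) := hy ▸ hY'
  let π : Fin d → ((Fin d → ℝ) × ℝ) →L[ℝ] ℝ := fun i =>
    (ContinuousLinearMap.proj (R := ℝ) (φ := fun _ : Fin d => ℝ) i).comp
      (ContinuousLinearMap.fst ℝ (Fin d → ℝ) ℝ)
  -- D is the determinant of the a- and b-components of the modified pair. It equals 1 on the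
  -- equation, so Ω is a neighbourhood of the equation inside W × I.
  let D : J2 d × ℝ → ℝ := fun q => π a (x q) * π b (y q) - π b (x q) * π a (y q)
  have hπx : ∀ i, ContDiffOn ℝ ∞ (fun q => π i (x q)) (W ×ˢ I) := fun i =>
    (π i).contDiff.comp_contDiffOn hxs
  have hπy : ∀ i, ContDiffOn ℝ ∞ (fun q => π i (y q)) (W ×ˢ I) := fun i =>
    (π i).contDiff.comp_contDiffOn hys
  have hDs : ContDiffOn ℝ ∞ D (W ×ˢ I) := ((hπx a).mul (hπy b)).sub ((hπx b).mul (hπy a))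
  let Ω : Set (J2 d × ℝ) := (W ×ˢ I) ∩ D ⁻¹' {0}ᶜ
  have hΩ : IsOpen Ω := hDs.continuousOn.isOpen_inter_preimage (hWo.prod hI) isOpen_compl_singleton
  have hΩW : Ω ⊆ W ×ˢ I := Set.inter_subset_left
  have hD0 : ∀ q ∈ Ω, D q ≠ 0 := fun q hq => hq.2
  have hΩU : ∀ q ∈ Ω, (q.1.1, q.2) ∈ U ×ˢ I := fun q hq => ⟨hW _ hq.1.1, hq.1.2⟩
  -- Cramer coefficients that bring the modified pair to components (1, 0) and (0, 1).
  let α : J2 d × ℝ → ℝ := fun q => π b (y q) / D q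
  let β : J2 d × ℝ → ℝ := fun q => -π b (x q) / D q
  let γ : J2 d × ℝ → ℝ := fun q => -π a (y q) / D q
  let δ : J2 d × ℝ → ℝ := fun q => π a (x q) / D q
  have hαs : ContDiffOn ℝ ∞ α Ω := ((hπy b).mono hΩW).div (hDs.mono hΩW) hD0
  have hβs : ContDiffOn ℝ ∞ β Ω := ((hπx b).mono hΩW).neg.div (hDs.mono hΩW) hD0
  have hγs : ContDiffOn ℝ ∞ γ Ω := ((hπy a).mono hΩW).neg.div (hDs.mono hΩW) hD0
  have hδs : ContDiffOn ℝ ∞ δ Ω := ((hπx a).mono hΩW).div (hDs.mono hΩW) hD0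
  let P : J2 d × ℝ → (Fin d → ℝ) × ℝ := fun q => α q • x q + β q • y q
  let Q : J2 d × ℝ → (Fin d → ℝ) × ℝ := fun q => γ q • x q + δ q • y q
  have hPs : ContDiffOn ℝ ∞ P Ω := (hαs.smul (hxs.mono hΩW)).add (hβs.smul (hys.mono hΩW))
  have hQs : ContDiffOn ℝ ∞ Q Ω := (hγs.smul (hxs.mono hΩW)).add (hδs.smul (hys.mono hΩW))
  let X : J2 d × ℝ → (Fin d → ℝ) × ℝ := fun q => spectralField ξ q.1 q.2
  let Y : J2 d × ℝ → (Fin d → ℝ) × ℝ := fun q => spectralField η q.1 q.2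
  have hXs : ContDiffOn ℝ ∞ X Ω := (spectralField_smoothOn h.smooth_left hW).mono hΩW
  have hYs : ContDiffOn ℝ ∞ Y Ω := (spectralField_smoothOn h.smooth_right hW).mono hΩW
  have hval : ∀ q ∈ W ×ˢ I, A.F q.1 = 0 → D q = 1 ∧ P q = X q ∧ Q q = Y q := by
    intro q hq hFq
    obtain ⟨e1, e2⟩ := heq q.1 hq.1 hFq q.2 hq.2
    have hxq : x q = X q := by rw [hx]; exact e1
    have hyq : y q = Y q := by rw [hy]; exact e2
    have h1 : π a (x q) = 1 := by rw [hxq]; exact h.left_fst _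
    have h2 : π b (x q) = 0 := by rw [hxq]; exact h.left_snd _
    have h3 : π a (y q) = 0 := by rw [hyq]; exact h.right_fst _
    have h4 : π b (y q) = 1 := by rw [hyq]; exact h.right_snd _
    have hDq : D q = 1 := by simp only [D, h1, h2, h3, h4]; norm_num
    refine ⟨hDq, ?_, ?_⟩
    · change (π b (y q) / D q) • x q + (-π b (x q) / D q) • y q = X q
      rw [h2, h4, hDq, hxq]
      simp
    · change (-π a (y q) / D q) • x q + (π a (x q) / D q) • y q = Y q
      rw [h1, h3, hDq, hyq]
      simp
  have hnorm : ∀ q ∈ Ω, π a (P q) = 1 ∧ π b (P q) = 0 ∧ π a (Q q) = 0 ∧ π b (Q q) = 1 := by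
    intro q hq
    have hDq := hD0 q hq
    have hDe : D q = π a (x q) * π b (y q) - π b (x q) * π a (y q) := rfl
    simp only [P, Q, α, β, γ, δ, map_add, map_smul, smul_eq_mul]
    refine ⟨?_, ?_, ?_, ?_⟩ <;> field_simp <;> rw [hDe] <;> ring
  -- Involutivity is tested on the cubic with 2-jet q.1 and third derivatives t, s; by the
  -- normalisation the fields P, Q then commute.
  have hcomm : ∀ q ∈ Ω, ∀ t s, fderiv ℝ Q q (cubicFrame a b q t s (P q))
      = fderiv ℝ P q (cubicFrame a b q t s (Q q)) := by
    intro q hq t s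
    obtain ⟨V, hxV, hV⟩ := exists_isSection_cubic q.1 a b t s hWo hq.1.1
    have hi := hinv V _ hV _ hxV q.2 hq.1.2
    have hdiff : ∀ {Z : J2 d × ℝ → (Fin d → ℝ) × ℝ}, ContDiffOn ℝ ∞ Z (W ×ˢ I) →
        DifferentiableAt ℝ Z q := fun hZ =>
      (hZ.contDiffAt ((hWo.prod hI).mem_nhds hq.1)).differentiableAt (by simp)
    have hdiff' : ∀ {Z : J2 d × ℝ → ℝ}, ContDiffOn ℝ ∞ Z Ω → DifferentiableAt ℝ Z q := fun hZ =>
      (hZ.contDiffAt (hΩ.mem_nhds hq)).differentiableAt (by simp)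
    have hjq : jet2 (cubic q.1 a b t s) q.1.1.1 = q.1 := jet2_cubic_self q.1 a b t s
    have hxd : DifferentiableAt ℝ (fun q : J2 d × ℝ => X' q.1 q.2)
        (jet2 (cubic q.1 a b t s) q.1.1.1, q.2) := by
      rw [hjq]
      exact hdiff hX'
    have hyd : DifferentiableAt ℝ (fun q : J2 d × ℝ => Y' q.1 q.2)
        (jet2 (cubic q.1 a b t s) q.1.1.1, q.2) := by
      rw [hjq]
      exact hdiff hY'
    rw [InvolutiveAt, lieBracket_along hV.isOpen hV.smooth hxV hxd hyd, cubicFrame_eq] at hi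
    simp only [SpectralField.along, hjq] at hi
    have hev : ∀ {R : J2 d × ℝ → Prop}, (∀ p ∈ Ω, R p) → ∀ᶠ p in nhds q, R p := fun hR =>
      Filter.mem_of_superset (hΩ.mem_nhds hq) hR
    refine bracket_frame_eq (cubicFrame a b q t s) (π a) (π b) (hdiff hxs) (hdiff hys)
      (hdiff' hαs) (hdiff' hβs) (hdiff' hγs) (hdiff' hδs) ?_ (hD0 q hq)
      (hev fun p hp => (hnorm p hp).1) (hev fun p hp => (hnorm p hp).2.1)
      (hev fun p hp => (hnorm p hp).2.2.1) (hev fun p hp => (hnorm p hp).2.2.2)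
    rw [hx, hy]
    exact hi
  have hFs : ∀ q : J2 d × ℝ, HasFDerivAt (fun q : J2 d × ℝ => A.F q.1)
      ((fderiv ℝ A.F q.1).comp (ContinuousLinearMap.fst ℝ (J2 d) ℝ)) q := fun q =>
    (hA.differentiable q.1).hasFDerivAt.comp q hasFDerivAt_fst
  have hgs : Differentiable ℝ fun q : J2 d × ℝ => c a b q.1.1 :=
    ((hA.smooth a b).differentiable (by simp)).comp (f := fun q : J2 d × ℝ => q.1.1) (by fun_prop)
  have hshift : ∀ (q : J2 d × ℝ) (τ : ℝ), A.F (q + τ • (((0, symUnit a b), 0) : J2 d × ℝ)).1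
      = A.F q.1 + τ * c a b q.1.1 := by
    intro q τ
    have : (q + τ • (((0, symUnit a b), 0) : J2 d × ℝ)).1 = (q.1.1, q.1.2 + τ • symUnit a b) := by
      refine Prod.ext ?_ rfl
      change q.1.1 + τ • 0 = _
      rw [smul_zero, add_zero]
    rw [this, ← hA.apply_symUnit, ← hA.apply_add_smul]
  have hq₀ : (θ₀, lam₀) ∈ W ×ˢ I := ⟨hθ₀, hlam₀⟩
  have hq₀Ω : (θ₀, lam₀) ∈ Ω := by
    refine ⟨hq₀, ?_⟩
    rw [Set.mem_preimage, (hval _ hq₀ hF₀).1]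
    exact one_ne_zero
  -- The transversal direction is E_ab in the Hessian, along which F has derivative c_ab ≠ 0.
  refine false_of_commuting_modification (Ω := Ω) (f := fun q => A.F q.1)
    (g := fun q => c a b q.1.1) (ν := ((0, symUnit a b), 0)) (q := (θ₀, lam₀)) (X := X) (Y := Y)
    (E := fun q => P q - X q) (H := fun q => Q q - Y q) (C := fun q => spectralField C q.1 q.2)
    (l := cubicFrame a b) hΩ hq₀Ω hF₀ (fun q _ => (hFs q).differentiableAt) (fun q _ => hgs q)
    (fun q hq => hc _ (hΩU q hq).1) ?_ ?_ hXs hYs (hPs.sub hXs) (hQs.sub hYs) ?_ ?_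
    (fun q _ t s => cubicFrame_differentiable a b t s q) ?_ ?_ ?_ ?_ ?_
  · intro q hq
    rw [sub_eq_add_neg, ← neg_smul, hshift, neg_mul, div_mul_cancel₀ _ (hc _ (hΩU q hq).1),
      add_neg_cancel]
  · intro τ
    rw [hshift, hF₀, zero_add]
  · intro q hq hFq
    rw [(hval q hq.1 hFq).2.1, sub_self]
  · intro q hq hFq
    rw [(hval q hq.1 hFq).2.2, sub_self]
  · intro q hq r r'
    have hg := hc _ (hΩU q hq).1
    have key : ∀ t s (v : Fin d → ℝ), fderiv ℝ (fun q : J2 d × ℝ => A.F q.1) q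
        (cubicFrame a b q t s (v, 0)) = fderiv ℝ A.F q.1 (lift q.1 v, 0)
          + (t * v a + s * v b) * c a b q.1.1 := by
      intro t s v
      rw [(hFs q).fderiv, cubicFrame_apply, ← hA.apply_cubicHess, ← hA.fderiv_vertical, ← map_add]
      simp
    -- The normalised components decouple the parameters: t moves only the derivative of F along the
    -- first field and s only that along the second, each with factor c_ab.
    refine ⟨(r - fderiv ℝ A.F q.1 (lift q.1 (ξ (q.1.1, q.2)), 0)) / c a b q.1.1,
      (r' - fderiv ℝ A.F q.1 (lift q.1 (η (q.1.1, q.2)), 0)) / c a b q.1.1,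
      (key _ _ _).trans ?_, (key _ _ _).trans ?_⟩
    · rw [h.left_fst, h.left_snd, mul_one, mul_zero, add_zero, div_mul_cancel₀ _ hg]
      ring
    · rw [h.right_fst, h.right_snd, mul_one, mul_zero, zero_add, div_mul_cancel₀ _ hg]
      ring
  · intro q hq t s
    exact h.bracket_spectralField hU hI (hΩU q hq) rfl rfl rfl rfl
  · intro τ
    simp [spectralField]
  · intro h0
    exact h.ne_zero _ (hΩU _ hq₀Ω) (congrArg Prod.fst h0)
  · intro q hq t s
    have e1 : (fun q => X q + (P q - X q)) = P := funext fun q => add_sub_cancel _ _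
    have e2 : (fun q => Y q + (Q q - Y q)) = Q := funext fun q => add_sub_cancel _ _
    rw [e1, e2, add_sub_cancel, add_sub_cancel]
    exact hcomm q hq t s

/-- A quasilinear equation with normal pairs is integrable. -/
theorem PDE.IsQuasilinear.isIntegrable (hA : A.IsQuasilinear c)
    (h : ∀ θ ∈ A.locus, ∃ a b U s t ξ η C, IsOpen U ∧ θ.1 ∈ U ∧ (∀ z ∈ U, c a b z ≠ 0) ∧ s < t ∧
      A.IsNormalPair U (Set.Ioo s t) a b ξ η C) : A.IsIntegrable := by
  intro θ hθ
  obtain ⟨a, b, U, s, t, ξ, η, C, hU, hθU, hc, hst, hp⟩ := h θ hθ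
  have hWo : IsOpen (A.dom ∩ Prod.fst ⁻¹' U) := A.isOpen_dom.inter (hU.preimage continuous_fst)
  have hW : ∀ θ ∈ A.dom ∩ Prod.fst ⁻¹' U, θ.1 ∈ U := fun θ h => h.2
  refine ⟨A.dom ∩ Prod.fst ⁻¹' U, hWo, ⟨hθ.1, hθU⟩, Set.inter_subset_left, s, t, hst,
    spectralField ξ, spectralField η, hp.isLaxPair hU isOpen_Ioo hW,
    fun θ' h' lam hlam mu hmu hs => hp.depends_on_param (hW _ h') hlam hmu hs,
    fun X' Y' hX hY heq => ?_⟩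
  exact hp.essential hA hU isOpen_Ioo hc hWo hW ⟨hθ.1, hθU⟩ hθ.2
    (lam₀ := (s + t) / 2) ⟨by linarith, by linarith⟩ hX hY heq

end Essential

/-! ### The Lax pair in dimension three -/

section Slopes

variable {d : ℕ}

/-- The function `(lam - x_k) l(p) / ((lam - x_i) l'(p))`. -/
def webSlope (i k : Fin d) (l l' : (Fin d → ℝ) →ₗ[ℝ] ℝ) (q : J1 d × ℝ) : ℝ :=
  ((q.2 - q.1.1 k) * l q.1.2.2) / ((q.2 - q.1.1 i) * l' q.1.2.2)

variable {i k : Fin d} {l l' : (Fin d → ℝ) →ₗ[ℝ] ℝ}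

lemma contDiff_sub_mul (k : Fin d) (l : (Fin d → ℝ) →ₗ[ℝ] ℝ) :
    ContDiff ℝ ∞ fun q : J1 d × ℝ => (q.2 - q.1.1 k) * l q.1.2.2 := by
  have h : ContDiff ℝ ∞ fun p : Fin d → ℝ => l p := l.toContinuousLinearMap.contDiff
  have h2 : ContDiff ℝ ∞ fun q : J1 d × ℝ => l q.1.2.2 := h.comp (by fun_prop)
  have h3 : ContDiff ℝ ∞ fun q : J1 d × ℝ => q.2 - q.1.1 k := by fun_prop
  exact h3.mul h2

lemma webSlope_contDiffOn {S : Set (J1 d × ℝ)}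
    (h : ∀ q ∈ S, q.2 - q.1.1 i ≠ 0 ∧ l' q.1.2.2 ≠ 0) : ContDiffOn ℝ ∞ (webSlope i k l l') S :=
  (contDiff_sub_mul k l).contDiffOn.div (contDiff_sub_mul i l').contDiffOn fun q hq =>
    mul_ne_zero (h q hq).1 (h q hq).2

lemma hasDirD_sub_mul (k : Fin d) (l : (Fin d → ℝ) →ₗ[ℝ] ℝ) (w q : J1 d × ℝ) :
    HasDirD (fun q : J1 d × ℝ => (q.2 - q.1.1 k) * l q.1.2.2)
      ((w.2 - w.1.1 k) * l q.1.2.2 + (q.2 - q.1.1 k) * l w.1.2.2) w q := by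
  have h1 : HasDirD (fun q : J1 d × ℝ => q.2 - q.1.1 k) (w.2 - w.1.1 k) w q :=
    HasFDerivAt.hasDirD (v := w) (f' := ContinuousLinearMap.snd ℝ (J1 d) ℝ
      - ((ContinuousLinearMap.proj (R := ℝ) (φ := fun _ : Fin d => ℝ) k).comp
      (ContinuousLinearMap.fst ℝ (Fin d → ℝ) (ℝ × (Fin d → ℝ)))).comp
      (ContinuousLinearMap.fst ℝ (J1 d) ℝ)) (hasFDerivAt_snd.sub
        (((ContinuousLinearMap.proj (R := ℝ) (φ := fun _ : Fin d => ℝ) k).comp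
      (ContinuousLinearMap.fst ℝ (Fin d → ℝ) (ℝ × (Fin d → ℝ)))).comp
      (ContinuousLinearMap.fst ℝ (J1 d) ℝ)).hasFDerivAt)
  have h2 : HasDirD (fun q : J1 d × ℝ => l q.1.2.2) (l w.1.2.2) w q :=
    HasFDerivAt.hasDirD (v := w) (l.toContinuousLinearMap.comp
      (((ContinuousLinearMap.snd ℝ ℝ (Fin d → ℝ)).comp
      (ContinuousLinearMap.snd ℝ (Fin d → ℝ) (ℝ × (Fin d → ℝ)))).comp
      (ContinuousLinearMap.fst ℝ (J1 d) ℝ))).hasFDerivAt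
  exact h1.mul h2

lemma dirD_webSlope (w : J1 d) {q : J1 d × ℝ} (hi : q.2 - q.1.1 i ≠ 0)
    (hl : l' q.1.2.2 ≠ 0) : dirD (w, 0) (webSlope i k l l') q =
      ((0 - w.1 k) * l q.1.2.2 + (q.2 - q.1.1 k) * l w.2.2)
          / ((q.2 - q.1.1 i) * l' q.1.2.2)
        - ((q.2 - q.1.1 k) * l q.1.2.2)
          * ((0 - w.1 i) * l' q.1.2.2 + (q.2 - q.1.1 i) * l' w.2.2)
          / ((q.2 - q.1.1 i) * l' q.1.2.2) ^ 2 :=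
  ((hasDirD_sub_mul k l (w, 0) q).div (hasDirD_sub_mul i l' (w, 0) q) (mul_ne_zero hi hl)).2

/-- As a function of λ the slope is a multiple of (λ - x_k)/(λ - x_i), which is injective unless x_k
= x_i. -/
lemma eq_zero_of_webSlope_eq {z : J1 d} {lam mu : ℝ} (hlam : lam - z.1 i ≠ 0) (hmu : mu - z.1 i ≠ 0)
    (hl : l' z.2.2 ≠ 0) (hne : lam ≠ mu)
    (h : webSlope i k l l' (z, lam) = webSlope i k l l' (z, mu)) :
    (z.1 k - z.1 i) * l z.2.2 = 0 := by
  simp only [webSlope] at h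
  rw [div_eq_div_iff (mul_ne_zero hlam hl) (mul_ne_zero hmu hl)] at h
  have : ((lam - mu) * l' z.2.2) * ((z.1 k - z.1 i) * l z.2.2) = 0 := by
    linear_combination h
  exact (mul_eq_zero.1 this).resolve_left (mul_ne_zero (sub_ne_zero.2 hne) hl)

lemma dirD_const (w q : J1 d × ℝ) (r : ℝ) : dirD w (fun _ => r) q = 0 := (HasDirD.const r).2

lemma exists_forall_lt (x : Fin d → ℝ) : ∃ M : ℝ, ∀ i, x i < M := by
  refine ⟨∑ i, |x i| + 1, fun i => ?_⟩
  have := Finset.single_le_sum (f := fun i => |x i|) (fun i _ => abs_nonneg _) (Finset.mem_univ i)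
  have := le_abs_self (x i)
  exact lt_of_le_of_lt (this.trans ‹_›) (lt_add_one _)

lemma isOpen_setOf_forall_lt (M : ℝ) : IsOpen {z : J1 d | ∀ i, z.1 i < M} := by
  simp only [Set.ofPred_forall]
  exact isOpen_iInter_of_finite fun i => isOpen_lt (by fun_prop) continuous_const

end Slopes

section ThreeDim

/-- The field `∂_0 - (u_0 (lam - x_2) / (u_2 (lam - x_0))) ∂_2`. -/
def laxLeft (q : J1 3 × ℝ) : Fin 3 → ℝ :=
  ![1, 0, webSlope 0 2 (-LinearMap.proj 0) (LinearMap.proj 2) q]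

/-- The field `∂_1 - (u_1 (lam - x_2) / (u_2 (lam - x_1))) ∂_2`. -/
def laxRight (q : J1 3 × ℝ) : Fin 3 → ℝ :=
  ![0, 1, webSlope 1 2 (-LinearMap.proj 1) (LinearMap.proj 2) q]

/-- The two fields span the kernel of Σ u_n/(λ - x_n) dx_n. Taking λ > M > x_n keeps all
denominators non-zero. -/
lemma veronese3_isNormalPair {M N : ℝ} : veronese3.IsNormalPair
    ({z : J1 3 | ∀ i, z.1 i < M} ∩ {z : J1 3 | (z, 0) ∈ veronese3.dom})
    (Set.Ioo M N) 0 1 laxLeft laxRight fun q =>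
      ![0, 0, (q.2 - q.1.1 2) / (q.1.2.2 2 ^ 2 * (q.2 - q.1.1 0) * (q.2 - q.1.1 1))] := by
  have hsub : ∀ {z : J1 3} {lam : ℝ}, (∀ i, z.1 i < M) → M < lam → ∀ i, lam - z.1 i ≠ 0 :=
    fun h1 h2 i => sub_ne_zero.2 ((h1 i).trans h2).ne'
  constructor
  · refine contDiffOn_pi.2 fun i => ?_
    fin_cases i
    · exact contDiffOn_const
    · exact contDiffOn_const
    · exact webSlope_contDiffOn fun q hq => ⟨hsub hq.1.1 hq.2.1 0, hq.1.2.2.2.2⟩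
  · refine contDiffOn_pi.2 fun i => ?_
    fin_cases i
    · exact contDiffOn_const
    · exact contDiffOn_const
    · exact webSlope_contDiffOn fun q hq => ⟨hsub hq.1.1 hq.2.1 1, hq.1.2.2.2.2⟩
  · exact fun q => rfl
  · exact fun q => rfl
  · exact fun q => rfl
  · exact fun q => rfl
  · intro q hq H k
    have h0 := hsub hq.1.1 hq.2.1 0
    have h1 := hsub hq.1.1 hq.2.1 1
    have hp : q.1.2.2 2 ≠ 0 := hq.1.2.2.2.2
    fin_cases k
    · change dirD _ (fun _ => (0 : ℝ)) q - dirD _ (fun _ => (1 : ℝ)) q = _ * 0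
      rw [dirD_const, dirD_const, sub_zero, mul_zero]
    · change dirD _ (fun _ => (1 : ℝ)) q - dirD _ (fun _ => (0 : ℝ)) q = _ * 0
      rw [dirD_const, dirD_const, sub_zero, mul_zero]
    · change dirD _ (webSlope 1 2 _ _) q - dirD _ (webSlope 0 2 _ _) q = _ * (_ / _)
      rw [dirD_webSlope _ h1 hp, dirD_webSlope _ h0 hp]
      have h10 : H.1 1 0 = H.1 0 1 := H.2 1 0
      have h20 : H.1 2 0 = H.1 0 2 := H.2 2 0
      have h21 : H.1 2 1 = H.1 1 2 := H.2 2 1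
      simp only [lift, laxLeft, laxRight, webSlope, veronese3, web, Fin.sum_univ_three,
        LinearMap.neg_apply, LinearMap.proj_apply, Matrix.cons_val, h10, h20, h21]
      field_simp
      ring
  · intro q hq h
    have := congrFun h 2
    simp only [Matrix.cons_val, Pi.zero_apply] at this
    exact div_ne_zero (hsub hq.1.1 hq.2.1 2) (mul_ne_zero (mul_ne_zero (pow_ne_zero 2 hq.1.2.2.2.2)
      (hsub hq.1.1 hq.2.1 0)) (hsub hq.1.1 hq.2.1 1)) this
  · intro z hz lam hlam mu hmu h _
    by_contra hne
    have := eq_zero_of_webSlope_eq (hsub hz.1 hlam.1 0) (hsub hz.1 hmu.1 0)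
      (l' := LinearMap.proj 2) hz.2.2.2.2 hne (congrFun h 2)
    exact mul_ne_zero (sub_ne_zero.2 hz.2.1.2.2) (neg_ne_zero.2 hz.2.2.1) this

lemma veronese3_isIntegrable : veronese3.IsIntegrable := by
  refine isQuasilinear_veronese3.isIntegrable fun θ hθ => ?_
  obtain ⟨M, hM⟩ := exists_forall_lt θ.1.1
  have hc : Continuous fun z : J1 3 => ((z, 0) : J2 3) := by fun_prop
  exact ⟨0, 1, _, M, M + 1, laxLeft, laxRight, _,
    (isOpen_setOf_forall_lt M).inter (veronese3.isOpen_dom.preimage hc), ⟨hM, hθ.1⟩,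
    fun z hz => webCoeff_crossForm_ne_zero (U := {z : J1 3 | (z, 0) ∈ veronese3.dom})
      (fun z hz => hz) z hz.2 0 1 (by decide), lt_add_one M, veronese3_isNormalPair⟩

end ThreeDim

/-! ### The Lax pair in dimension four -/

section FourDim

/-- The k-component of the bracket as a rational identity with Y_n = λ - x_n. The variable Q stands
for a_k p_l - a_l p_k and is expanded only after denominators are cleared. -/
lemma lax_bracket_identity (s Yi Yj Yk Yl ai aj ak al pi pj pk pl Hij Hik Hil Hjk Hjl Hkk Hkl Hll Q : ℝ)
    (hs : s ≠ 0) (hi : Yi ≠ 0) (hj : Yj ≠ 0) (hQ : Q ≠ 0)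
    (hQe : Q = ak * pl - al * pk) {ξk ξl ηk ηl : ℝ}
    (hξk : ξk = Yk * (al * pi - ai * pl) / (Yi * Q))
    (hξl : ξl = Yl * (ak * pi - ai * pk) / (Yi * -Q))
    (hηk : ηk = Yk * (al * pj - aj * pl) / (Yj * Q))
    (hηl : ηl = Yl * (ak * pj - aj * pk) / (Yj * -Q)) :
    ((0 - ξk) * (al * pj - aj * pl)
        + Yk * (al * (Hij + ξk * Hjk + ξl * Hjl) - aj * (Hil + ξk * Hkl + ξl * Hll)))
          / (Yj * Q)
      - (Yk * (al * pj - aj * pl)) * ((0 - 0) * Q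
          + Yj * (ak * (Hil + ξk * Hkl + ξl * Hll) - al * (Hik + ξk * Hkk + ξl * Hkl)))
          / (Yj * Q) ^ 2
      - (((0 - ηk) * (al * pi - ai * pl)
        + Yk * (al * (Hij + ηk * Hik + ηl * Hil) - ai * (Hjl + ηk * Hkl + ηl * Hll)))
          / (Yi * Q)
      - (Yk * (al * pi - ai * pl)) * ((0 - 0) * Q
          + Yi * (ak * (Hjl + ηk * Hkl + ηl * Hll) - al * (Hjk + ηk * Hkk + ηl * Hkl)))
          / (Yi * Q) ^ 2)
      = s * ((Yj - Yi) * (al * pk - ak * pl) * Hij + (Yk - Yi) * (aj * pl - al * pj) * Hik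
        + (Yl - Yi) * (ak * pj - aj * pk) * Hil + (Yk - Yj) * (al * pi - ai * pl) * Hjk
        + (Yl - Yj) * (ai * pk - ak * pi) * Hjl + (Yl - Yk) * (aj * pi - ai * pj) * Hkl)
        * ((s * Q ^ 2 * Yi * Yj)⁻¹ * (al * Yk)) := by
  rw [hξk, hξl, hηk, hηl]
  field_simp
  rw [hQe]
  ring

variable (a : Fin 4 → ℝ)

/-- The field `∂_i + ξ_k ∂_k + ξ_l ∂_l` annihilated by the forms
`∑ u_n / (lam - x_n) dx_n` and `∑ a_n / (lam - x_n) dx_n`. -/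
def laxField (i k l : Fin 4) (q : J1 4 × ℝ) (n : Fin 4) : ℝ :=
  if n = i then 1 else if n = k then webSlope i k (minorForm a l i) (minorForm a k l) q
    else if n = l then webSlope i l (minorForm a k i) (minorForm a l k) q else 0

variable {a} {i j k l : Fin 4}

/-- The symmetry in k and l lets the l-component of the bracket follow from the k-component. -/
lemma laxField_swap (h : k ≠ l) : laxField a i k l = laxField a i l k := by
  funext q n
  unfold laxField
  split_ifs with h1 h2 h3 <;> first | rfl | exact absurd (h2.symm.trans h3) h

lemma laxField_self (q : J1 4 × ℝ) : laxField a i k l q i = 1 := if_pos rfl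

lemma laxField_snd (h : k ≠ i) (q : J1 4 × ℝ) :
    laxField a i k l q k = webSlope i k (minorForm a l i) (minorForm a k l) q := by
  rw [laxField, if_neg h, if_pos rfl]

lemma laxField_thd (h : l ≠ i) (h' : k ≠ l) (q : J1 4 × ℝ) :
    laxField a i k l q l = webSlope i l (minorForm a k i) (minorForm a l k) q := by
  rw [laxField_swap h', laxField_snd h]

lemma laxField_of_ne {n : Fin 4} (h1 : n ≠ i) (h2 : n ≠ k) (h3 : n ≠ l) (q : J1 4 × ℝ) :
    laxField a i k l q n = 0 := by
  rw [laxField, if_neg h1, if_neg h2, if_neg h3]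

lemma veronese4_apply (h : Distinct4 i j k l) : ∃ s : ℝ, s ≠ 0 ∧
    dualForm a i j = s • minorForm a l k ∧ ∀ z H, (veronese4 a).F (z, H)
      = s * ((z.1 i - z.1 j) * minorForm a l k z.2.2 * H.1 i j
        + (z.1 i - z.1 k) * minorForm a j l z.2.2 * H.1 i k
        + (z.1 i - z.1 l) * minorForm a k j z.2.2 * H.1 i l
        + (z.1 j - z.1 k) * minorForm a l i z.2.2 * H.1 j k
        + (z.1 j - z.1 l) * minorForm a i k z.2.2 * H.1 j l
        + (z.1 k - z.1 l) * minorForm a j i z.2.2 * H.1 k l) := by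
  obtain ⟨s, hs, e1, e2, e3, e4, e5, e6⟩ := dualForm_eq a h
  refine ⟨s, hs, e1, fun z H => ?_⟩
  have hA := isQuasilinear_veronese4 a
  rw [hA.eq]
  have hd : ∀ n, webCoeff (dualForm a) n n z = 0 := fun n => by rw [hA.diag]; rfl
  have hc : ∀ m n, webCoeff (dualForm a) m n z = webCoeff (dualForm a) n m z := fun m n => by
    rw [hA.symmetric]
  have hH : ∀ m n, H.1 m n = H.1 n m := H.2
  simp only [h.sum_eq, hd, hc j i, hc k i, hc l i, hc k j, hc l j, hc l k, hH j i, hH k i, hH l i,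
    hH k j, hH l j, hH l k]
  simp only [webCoeff, e1, e2, e3, e4, e5, e6, LinearMap.smul_apply, smul_eq_mul]
  ring

lemma laxField_bracket (h : Distinct4 i j k l) {s : ℝ} (hs : s ≠ 0) {q : J1 4 × ℝ}
    (hi : q.2 - q.1.1 i ≠ 0) (hj : q.2 - q.1.1 j ≠ 0) (hQ : minorForm a k l q.1.2.2 ≠ 0) (H : Sym 4)
    (hF : (veronese4 a).F (q.1, H)
      = s * ((q.1.1 i - q.1.1 j) * minorForm a l k q.1.2.2 * H.1 i j
        + (q.1.1 i - q.1.1 k) * minorForm a j l q.1.2.2 * H.1 i k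
        + (q.1.1 i - q.1.1 l) * minorForm a k j q.1.2.2 * H.1 i l
        + (q.1.1 j - q.1.1 k) * minorForm a l i q.1.2.2 * H.1 j k
        + (q.1.1 j - q.1.1 l) * minorForm a i k q.1.2.2 * H.1 j l
        + (q.1.1 k - q.1.1 l) * minorForm a j i q.1.2.2 * H.1 k l)) :
    dirD (lift (q.1, H) (laxField a i k l q), 0) (fun q => laxField a j k l q k) q
      - dirD (lift (q.1, H) (laxField a j k l q), 0) (fun q => laxField a i k l q k) q
      = (veronese4 a).F (q.1, H) * ((s * minorForm a k l q.1.2.2 ^ 2 * (q.2 - q.1.1 i)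
        * (q.2 - q.1.1 j))⁻¹ * (a l * (q.2 - q.1.1 k))) := by
  obtain ⟨h1, h2, h3, h4, h5, h6⟩ := id h
  have f1 : (fun q => laxField a j k l q k) = webSlope j k (minorForm a l j) (minorForm a k l) :=
    funext fun q => laxField_snd h4.symm q
  have f2 : (fun q => laxField a i k l q k) = webSlope i k (minorForm a l i) (minorForm a k l) :=
    funext fun q => laxField_snd h2.symm q
  have hlk : minorForm a l k q.1.2.2 = - minorForm a k l q.1.2.2 := by
    simp only [minorForm_apply]
    ring
  have hH : ∀ m n, H.1 m n = H.1 n m := H.2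
  have hrow : ∀ (v : Fin 4 → ℝ) (n : Fin 4), (lift (q.1, H) v).2.2 n
      = H.1 i n * v i + H.1 j n * v j + H.1 k n * v k + H.1 l n * v l := fun v n => by
    simp only [lift, h.sum_eq]
  have hfst : ∀ v : Fin 4 → ℝ, (lift (q.1, H) v).1 = v := fun _ => rfl
  have key := lax_bracket_identity s (q.2 - q.1.1 i) (q.2 - q.1.1 j) (q.2 - q.1.1 k) (q.2 - q.1.1 l)
    (a i) (a j) (a k) (a l) (q.1.2.2 i) (q.1.2.2 j) (q.1.2.2 k) (q.1.2.2 l) (H.1 i j) (H.1 i k)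
    (H.1 i l) (H.1 j k) (H.1 j l) (H.1 k k) (H.1 k l) (H.1 l l) (minorForm a k l q.1.2.2)
    hs hi hj hQ (minorForm_apply a k l _) (ξk := laxField a i k l q k) (ξl := laxField a i k l q l)
    (ηk := laxField a j k l q k) (ηl := laxField a j k l q l)
    (laxField_snd h2.symm q) (by rw [laxField_thd h3.symm h6, ← hlk]; rfl)
    (laxField_snd h4.symm q) (by rw [laxField_thd h5.symm h6, ← hlk]; rfl)
  rw [f1, f2, dirD_webSlope _ hj hQ, dirD_webSlope _ hi hQ, hF]
  simp only [minorForm_apply a l j, minorForm_apply a l i, minorForm_apply a j l,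
    minorForm_apply a k j, minorForm_apply a i k, minorForm_apply a j i, hlk] at key ⊢
  rw [minorForm_apply a k l (lift _ _).2.2, minorForm_apply a k l (lift _ _).2.2]
  simp only [hrow, hfst, laxField_self, laxField_of_ne h1.symm h4 h5 q,
    laxField_of_ne h1 h2 h3 q, hH j i, hH l k, hH k i, hH l i, hH k j, hH l j]
  have hlk2 : -minorForm a k l q.1.2.2 = a l * q.1.2.2 k - a k * q.1.2.2 l := by
    rw [← hlk, minorForm_apply]
  rw [hlk2]
  refine Eq.trans ?_ (key.trans ?_)
  · ring
  · ring

lemma Distinct4.eq_or (h : Distinct4 i j k l) (n : Fin 4) : n = i ∨ n = j ∨ n = k ∨ n = l := by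
  revert i j k l n
  decide

/-- The coefficients of the bracket of the Lax pair. -/
def laxBracket (a : Fin 4 → ℝ) (s : ℝ) (i j k l : Fin 4) (q : J1 4 × ℝ) (n : Fin 4) : ℝ :=
  (s * minorForm a k l q.1.2.2 ^ 2 * (q.2 - q.1.1 i) * (q.2 - q.1.1 j))⁻¹ *
    if n = k then a l * (q.2 - q.1.1 k) else if n = l then -(a k * (q.2 - q.1.1 l)) else 0

/-- The determinant of the characteristic form is up to sign symmetric in the variables. -/
lemma discriminant_ne_zero (h : Distinct4 i j k l) {θ : J2 4} (hθ : θ ∈ (veronese4 a).dom) :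
    (θ.1.1 i - θ.1.1 j) * (θ.1.1 k - θ.1.1 l) * (minor a i l θ * minor a j k θ)
      - (θ.1.1 i - θ.1.1 l) * (θ.1.1 j - θ.1.1 k) * (minor a i j θ * minor a k l θ) ≠ 0 := by
  have h0 := sub_ne_zero.2 hθ
  -- Each relabelling reproduces the defining expression up to sign, by the Plücker relation between
  -- the minors and its analogue for differences of coordinates.
  have h0' := neg_ne_zero.2 h0
  unfold minor at *
  obtain ⟨h1, h2, h3, h4, h5, h6⟩ := h
  fin_cases i <;> fin_cases j <;> first | exact absurd rfl h1 | skip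
  all_goals fin_cases k <;> first | exact absurd rfl h2 | exact absurd rfl h4 | skip
  all_goals
    fin_cases l <;> first | exact absurd rfl h3 | exact absurd rfl h5 | exact absurd rfl h6 | skip
  all_goals
    simp only [Fin.zero_eta, Fin.mk_one, Fin.reduceFinMk]
    first
      | exact fun e => h0 (by linear_combination e)
      | exact fun e => h0' (by linear_combination e)

lemma minor_eq (m n : Fin 4) (θ : J2 4) : minor a m n θ = minorForm a m n θ.1.2.2 := rfl

/-- Two points of a plane with a non-zero coordinate are independent. -/
lemma eq_zero_of_minorForm_eq_zero {p : Fin 4 → ℝ} (hQ : minorForm a k l p ≠ 0)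
    (h1 : minorForm a l i p = 0) (h2 : minorForm a k i p = 0) : a i = 0 := by
  rw [minorForm_apply] at hQ h1 h2
  refine (mul_eq_zero.1 ?_).resolve_left hQ
  linear_combination a l * h2 - a k * h1

lemma veronese4_isNormalPair (ha : ∀ i, a i ≠ 0) (h : Distinct4 i j k l) {M N : ℝ} :
    ∃ C, (veronese4 a).IsNormalPair ({z : J1 4 | ∀ i, z.1 i < M} ∩ ({z : J1 4 |
      (z, 0) ∈ (veronese4 a).dom} ∩ {z : J1 4 | webCoeff (dualForm a) i j z ≠ 0}))
    (Set.Ioo M N) i j (laxField a i k l) (laxField a j k l) C := by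
  obtain ⟨s, hs, hsf, hF⟩ := veronese4_apply (a := a) h
  obtain ⟨h1, h2, h3, h4, h5, h6⟩ := id h
  have hsub : ∀ {z : J1 4} {lam : ℝ}, (∀ i, z.1 i < M) → M < lam → ∀ i, lam - z.1 i ≠ 0 :=
    fun h1 h2 i => sub_ne_zero.2 ((h1 i).trans h2).ne'
  have hlk : ∀ p, minorForm a l k p = - minorForm a k l p := fun p => by
    simp only [minorForm_apply]
    ring
  have hQ : ∀ {z : J1 4}, webCoeff (dualForm a) i j z ≠ 0 → minorForm a k l z.2.2 ≠ 0 := by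
    intro z hz h0
    refine right_ne_zero_of_mul hz ?_
    rw [hsf, LinearMap.smul_apply, hlk, h0, neg_zero, smul_zero]
  have hsmooth : ∀ m, ContDiffOn ℝ ∞ (laxField a m k l) (({z : J1 4 | ∀ i, z.1 i < M} ∩ ({z : J1 4 |
      (z, 0) ∈ (veronese4 a).dom} ∩ {z : J1 4 | webCoeff (dualForm a) i j z ≠ 0})) ×ˢ
      Set.Ioo M N) := by
    intro m
    refine contDiffOn_pi.2 fun n => ?_
    unfold laxField
    split_ifs
    · exact contDiffOn_const
    · exact webSlope_contDiffOn fun q hq => ⟨hsub hq.1.1 hq.2.1 m, hQ hq.1.2.2⟩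
    · exact webSlope_contDiffOn fun q hq => ⟨hsub hq.1.1 hq.2.1 m, by
        rw [hlk]; exact neg_ne_zero.2 (hQ hq.1.2.2)⟩
    · exact contDiffOn_const
  refine ⟨laxBracket a s i j k l, hsmooth i, hsmooth j, fun q => laxField_self q,
    fun q => laxField_of_ne h1.symm h4 h5 q, fun q => laxField_of_ne h1 h2 h3 q,
    fun q => laxField_self q, ?_, ?_, ?_⟩
  · intro q hq H n
    have hi := hsub hq.1.1 hq.2.1 i
    have hj := hsub hq.1.1 hq.2.1 j
    have hq0 := hQ hq.1.2.2
    rcases h.eq_or n with rfl | rfl | rfl | rfl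
    · have f1 : (fun q => laxField a j k l q n) = fun _ => 0 :=
        funext fun q => laxField_of_ne h1 h2 h3 q
      have f2 : (fun q => laxField a n k l q n) = fun _ => 1 := funext fun q => laxField_self q
      rw [f1, f2, dirD_const, dirD_const, laxBracket, if_neg h2, if_neg h3, mul_zero, mul_zero,
        sub_zero]
    · have f1 : (fun q => laxField a i k l q n) = fun _ => 0 :=
        funext fun q => laxField_of_ne h1.symm h4 h5 q
      have f2 : (fun q => laxField a n k l q n) = fun _ => 1 := funext fun q => laxField_self q
      rw [f1, f2, dirD_const, dirD_const, laxBracket, if_neg h4, if_neg h5, mul_zero, mul_zero,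
        sub_zero]
    · rw [laxField_bracket h hs hi hj hq0 H (hF q.1 H), laxBracket, if_pos rfl]
    -- Interchanging k and l reverses the common sign s of the six forms.
    · have hb := laxField_bracket (a := a) h.swap34 (neg_ne_zero.2 hs) hi hj
        (by rw [hlk]; exact neg_ne_zero.2 hq0) H (by
          have hH : H.1 n k = H.1 k n := H.2 n k
          rw [hF q.1 H, hH]
          simp only [minorForm_apply]
          ring)
      rw [laxField_swap h6, laxField_swap (i := j) h6, hb, laxBracket, if_neg h6.symm, if_pos rfl,
        hlk]
      simp only [neg_sq, neg_mul, inv_neg]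
      ring
  · intro q hq h0
    have := congrFun h0 k
    rw [laxBracket, if_pos rfl] at this
    exact mul_ne_zero (inv_ne_zero (mul_ne_zero (mul_ne_zero (mul_ne_zero hs
      (pow_ne_zero 2 (hQ hq.1.2.2))) (hsub hq.1.1 hq.2.1 i)) (hsub hq.1.1 hq.2.1 j)))
      (mul_ne_zero (ha l) (hsub hq.1.1 hq.2.1 k)) this
  · intro z hz lam hlam mu hmu e1 e2
    by_contra hne
    have hq0 := hQ hz.2.2
    have hq0' : minorForm a l k z.2.2 ≠ 0 := by
      rw [hlk]
      exact neg_ne_zero.2 hq0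
    have hx : z.1 i - z.1 j ≠ 0 := left_ne_zero_of_mul hz.2.2
    -- Equality of the fields at two different parameters forces each slope to be independent of λ.
    have key : ∀ m, k ≠ m → l ≠ m → laxField a m k l (z, lam) = laxField a m k l (z, mu) →
        (z.1 k - z.1 m) * minorForm a l m z.2.2 = 0 ∧ (z.1 l - z.1 m) * minorForm a k m z.2.2 = 0 := by
      intro m hkm hlm e
      have ek := congrFun e k
      have el := congrFun e l
      rw [laxField_snd hkm, laxField_snd hkm] at ek
      rw [laxField_thd hlm h6, laxField_thd hlm h6] at el
      exact ⟨eq_zero_of_webSlope_eq (hsub hz.1 hlam.1 m) (hsub hz.1 hmu.1 m) hq0 hne ek,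
        eq_zero_of_webSlope_eq (hsub hz.1 hlam.1 m) (hsub hz.1 hmu.1 m) hq0' hne el⟩
    obtain ⟨i1, i2⟩ := key i h2.symm h3.symm e1
    obtain ⟨j1, j2⟩ := key j h4.symm h5.symm e2
    have hΔ := discriminant_ne_zero h hz.2.1
    simp only [minor_eq] at hΔ
    have ni : ¬ (minorForm a l i z.2.2 = 0 ∧ minorForm a k i z.2.2 = 0) := fun hh =>
      ha i (eq_zero_of_minorForm_eq_zero hq0 hh.1 hh.2)
    have nj : ¬ (minorForm a l j z.2.2 = 0 ∧ minorForm a k j z.2.2 = 0) := fun hh =>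
      ha j (eq_zero_of_minorForm_eq_zero hq0 hh.1 hh.2)
    refine hΔ ?_
    -- If x_k = x_i, the relations give x_l = x_j and q_lj = q_ki = 0, and the discriminant is (x_i
    -- - x_j)² q_ik q_jl = 0 by Plücker. Otherwise q_li = 0 and x_l = x_i, and both of its terms
    -- vanish.
    by_cases hki : z.1 k - z.1 i = 0
    · have hkj : z.1 k - z.1 j ≠ 0 := fun e => hx (by linear_combination e - hki)
      have hlj := (mul_eq_zero.1 j1).resolve_left hkj
      have hxl := (mul_eq_zero.1 j2).resolve_right fun e => nj ⟨hlj, e⟩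
      have hk := (mul_eq_zero.1 i2).resolve_left fun e => hx (by linear_combination hxl - e)
      rw [sub_eq_zero.1 hki, sub_eq_zero.1 hxl]
      simp only [minorForm_apply] at hlj hk ⊢
      linear_combination (z.1 i - z.1 j) ^ 2 * (a k * z.2.2 i - a i * z.2.2 k) * hlj
    · have hli := (mul_eq_zero.1 i1).resolve_left hki
      have hxl := (mul_eq_zero.1 i2).resolve_right fun e => ni ⟨hli, e⟩
      have hil : minorForm a i l z.2.2 = 0 := by
        simp only [minorForm_apply] at hli ⊢
        linear_combination -hli
      rw [sub_eq_zero.1 hxl, hil]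
      ring

lemma veronese4_isIntegrable (ha : ∀ i, a i ≠ 0) : (veronese4 a).IsIntegrable := by
  refine (isQuasilinear_veronese4 a).isIntegrable fun θ hθ => ?_
  obtain ⟨M, hM⟩ := exists_forall_lt θ.1.1
  -- By non-degeneracy some c_ij is non-zero; that pair provides the normalised directions of the
  -- Lax fields.
  obtain ⟨i, j, hij⟩ : ∃ i j, webCoeff (dualForm a) i j θ.1 ≠ 0 := by
    by_contra! h0
    have := veronese4_isNondegenerate θ hθ (Pi.single 0 1) fun q => by
      rw [(isQuasilinear_veronese4 a).symbol_eq]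
      simp [h0]
    simpa using congrFun this 0
  have hne : i ≠ j := by
    rintro rfl
    exact hij (by rw [(isQuasilinear_veronese4 a).diag]; rfl)
  obtain ⟨k, l, h⟩ := Distinct4.exists_of_ne hne
  have hc : Continuous fun z : J1 4 => ((z, 0) : J2 4) := by fun_prop
  obtain ⟨C, hC⟩ := veronese4_isNormalPair ha h (M := M) (N := M + 1)
  exact ⟨i, j, _, M, M + 1, _, _, C, (isOpen_setOf_forall_lt M).inter
    (((veronese4 a).isOpen_dom.preimage hc).inter (isOpen_ne_fun
      ((isQuasilinear_veronese4 a).smooth i j).continuous continuous_const)),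
    ⟨hM, hθ.1, hij⟩, fun z hz => hz.2.2, lt_add_one M, hC⟩

end FourDim

end JetPDE

end

theorem mainTheorem4 :
    (JetPDE.veronese3.locus.Nonempty ∧
      JetPDE.veronese3.IsNondegenerate ∧
      JetPDE.veronese3.IsIntegrable ∧
      (∀ B : JetPDE.PDE 3, B.IsTranslationInvariant →
        ¬ JetPDE.ContactEquivalent JetPDE.veronese3 B) ∧
      (∀ U : Set (JetPDE.J1 3), IsOpen U → U.Nonempty → U ⊆ JetPDE.veronese3.base →
        ¬ JetPDE.veronese3.HasSimplyTransitiveAbelianSymmetry U)) ∧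
    (∀ a : Fin 4 → ℝ, (∀ i, a i ≠ 0) →
      (JetPDE.veronese4 a).locus.Nonempty ∧
      (JetPDE.veronese4 a).IsNondegenerate ∧
      (JetPDE.veronese4 a).IsIntegrable ∧
      ((∃ i j, |a i| ≠ |a j|) →
        (∀ B : JetPDE.PDE 4, B.IsTranslationInvariant →
          ¬ JetPDE.ContactEquivalent (JetPDE.veronese4 a) B) ∧
        (∀ U : Set (JetPDE.J1 4), IsOpen U → U.Nonempty → U ⊆ (JetPDE.veronese4 a).base →
          ¬ (JetPDE.veronese4 a).HasSimplyTransitiveAbelianSymmetry U))) :=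
  ⟨⟨JetPDE.veronese3_locus_nonempty, JetPDE.veronese3_isNondegenerate,
      JetPDE.veronese3_isIntegrable, JetPDE.veronese3_not_contactEquivalent,
      fun _ hU hne hb => JetPDE.veronese3_not_hasSimplyTransitiveAbelianSymmetry hU hne hb⟩,
    fun _ ha => ⟨JetPDE.veronese4_locus_nonempty ha, JetPDE.veronese4_isNondegenerate,
      JetPDE.veronese4_isIntegrable ha, fun hneq =>
        ⟨JetPDE.veronese4_not_contactEquivalent ha hneq, fun _ hU hne hb =>
          JetPDE.veronese4_not_hasSimplyTransitiveAbelianSymmetry ha hneq hU hne hb⟩⟩⟩
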